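/- **Conventions.** A *$C^*$-category* is a $\mathbb{C}$-linear dagger category whose Hom-spaces are Banach spaces, with $\|f\circ g\|\le\|f\|\,\|g\|$, $\|f^\dagger\circ f\|=\|f\|^2$, and $f^\dagger\circ f$ a positive element of the $C^*$-algebra $\mathrm{End}(X)$ for all $f:X\to Y$. A direct sum of a finite family $(X_k)$ is an object $Z$ with isometries $i_k:X_k\to Z$ such that $\sum_k i_k i_k^\dagger=\mathrm{id}_Z$. A $C^*$-category is *semisimple* if it has a zero object and pairwise direct sums, every $p=p^\dagger=p^2\in\mathrm{End}(X)$ is of the form $\iota\iota^\dagger$ for an isometry $\iota:V\to X$, and all $\mathrm{End}(X)$ are finite-dimensional. An object $X$ is *simple* if $\mathrm{End}(X)\cong\mathbb{C}$. A *$C^*$-2-category* is a (weak) 2-category whose Hom-categories are $C^*$-categories, whose horizontal composition $\otimes$ (written $X\otimes Y:r\to t$ for $X:r\to s$, $Y:s\to t$) is bilinear and compatible with the dagger, and whose associators and unitors are unitary. With one object it is a *$C^*$-tensor category*. A *right dual* of $X:r\to s$ is a 1-morphism $Y:s\to r$ with $\eta:\mathrm{id}_s\to Y\otimes X$ and $\epsilon:X\otimes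 Y\to\mathrm{id}_r$ satisfying the snake equations. A *rigid $C^*$-tensor category* is a semisimple $C^*$-tensor category in which every object has a right dual; its unit object need not be simple. When $\mathrm{End}(\mathrm{id}_r)$ is finite-dimensional (it is commutative), let $\mathrm{Tr}_r$ be its trace that sends every minimal projection to $1$; a right dual $(Y,\eta,\epsilon)$ of $X:r\to s$ is *standard* if $\mathrm{Tr}_s[\eta^\dagger(\mathrm{id}_Y\otimes f)\eta]=\mathrm{Tr}_r[\epsilon(f\otimes\mathrm{id}_Y)\epsilon^\dagger]$ for all $f\in\mathrm{End}(X)$. **SSFAs and $\mathrm{Bimod}(\mathcal{T})$.** Let $\mathcal{T}$ be a rigid $C^*$-tensor category. A *separable standard Frobenius algebra* (SSFA) in $\mathcal{T}$ is a unital associative algebra $(A,m,u)$ with $(m\otimes\mathrm{id})(\mathrm{id}\otimes m^\dagger)=m^\dagger m=(\mathrm{id}\otimes m)(m^\dagger\otimes\mathrm{id})$ (Frobenius), $m m^\dagger=\mathrm{id}_A$ (separable), and such that the cup $m^\dagger u:\mathbb{1}\to A\otimes A$ and the cap $u^\dagger m:A\otimes A\to\mathbb{1}$ form a standard duality of $A$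 with itself. A *dagger bimodule* ${}_AM_B$ is an $A$-$B$-bimodule $M$ whose left action $\lambda:A\otimes M\to M$ satisfies $\lambda=(u_A^\dagger m_A\otimes\mathrm{id}_M)(\mathrm{id}_A\otimes\lambda^\dagger)$, and whose right action satisfies the mirror-image equation. For dagger bimodules ${}_AM_B$ and ${}_BN_C$ the morphism $\left(\rho_M\otimes\lambda_N\right)\left(\mathrm{id}_M\otimes m_B^\dagger u_B\otimes\mathrm{id}_N\right)\in\mathrm{End}(M\otimes N)$ is a dagger idempotent ($\rho_M$, $\lambda_N$ being the actions of $B$); the *relative tensor product* $M\otimes_BN$ is its splitting, with the induced actions of $A$ and $C$. $\mathrm{Bimod}(\mathcal{T})$ is the $C^*$-2-category whose objects are the SSFAs in $\mathcal{T}$, whose 1-morphisms $A\to B$ are the dagger bimodules ${}_AM_B$, composed by relative tensor product with identities ${}_AA_A$, and whose 2-morphisms are the bimodule homomorphisms, with the dagger and the norm of $\mathcal{T}$. **Semisimple $C^*$-2-categories.** A *direct sum* of a finite family of objects $(r_k)$ in a $C^*$-2-category is an object $R$ with 1-morphisms $\iota_k:r_k\to R$ and $\rho_k:R\to r_k$ such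 that $\iota_k\otimes\rho_k$ is unitarily isomorphic to $\mathrm{id}_{r_k}$, $\iota_k\otimes\rho_l$ is a zero 1-morphism for $k\ne l$, and $\mathrm{id}_R$ is a direct sum of the $\rho_k\otimes\iota_k$. A $C^*$-2-category is *presemisimple* if all its Hom-categories are semisimple, every 1-morphism has a right dual, there is an object $\mathbf{0}$ with $\mathrm{End}(\mathbf{0})$ (equivalent to) the terminal category, any two objects have a direct sum, and every object is a finite direct sum of objects $r_k$ with $\mathrm{id}_{r_k}$ simple. In a presemisimple $C^*$-2-category, let $X:r\to s$ have a standard right dual $(X^*,\eta,\epsilon)$. Then $X$ is *separable* if $\dim_L(X)=\eta^\dagger\eta\in\mathrm{End}(\mathrm{id}_s)$ is invertible; with $n_X$ the positive square root of $\dim_L(X)$, the *pair of pants algebra* on $X\otimes X^*$ in $\mathrm{End}(r)$ has multiplication $\mathrm{id}_X\otimes(n_X^{-1}\eta^\dagger)\otimes\mathrm{id}_{X^*}$ and unit $(\mathrm{id}_X\otimes n_X\otimes\mathrm{id}_{X^*})\,\epsilon^\dagger$. An SSFA $A$ in the $C^*$-tensor category $\mathrm{End}(r)$ *splits* if there are an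 object $s$, a separable $X:r\to s$, and a unitary isomorphism $f:A\to X\otimes X^*$ to the pair of pants algebra $(P,m_P,u_P)$ on $P=X\otimes X^*$ which is a $*$-homomorphism, that is, $f$ preserves multiplication and unit and $f^\dagger=(\mathrm{id}_A\otimes u_P^\dagger m_P)(\mathrm{id}_A\otimes f\otimes\mathrm{id}_P)(m_A^\dagger u_A\otimes\mathrm{id}_P)$. A $C^*$-2-category is *semisimple* if it is presemisimple and, for every object $r$, every SSFA in $\mathrm{End}(r)$ splits. **Proposition.** For every rigid $C^*$-tensor category $\mathcal{T}$, the $C^*$-2-category $\mathrm{Bimod}(\mathcal{T})$ is semisimple. -/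

import Mathlib

open CategoryTheory

universe w v u

/-- A (complex linear) C*-category: a linear dagger category whose Hom-spaces are Banach spaces, with
submultiplicative norm, the C*-identity, and `f† ∘ f` a positive element of the C*-algebra
`End X` for every `f : X ⟶ Y`, i.e. (being self-adjoint) of spectrum contained in `[0, ∞)`.
Composition is written in diagrammatic order, so `f ≫ f†` is `f† ∘ f`. -/
class CStarCategory (C : Type u) [Category.{v} C] extends Preadditive C, Linear ℂ C where
  /-- The dagger. -/
  dag {X Y : C} (f : X ⟶ Y) : Y ⟶ X
  dag_dag {X Y : C} (f : X ⟶ Y) : dag (dag f) = f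
  dag_comp {X Y Z : C} (f : X ⟶ Y) (g : Y ⟶ Z) : dag (f ≫ g) = dag g ≫ dag f
  dag_add {X Y : C} (f g : X ⟶ Y) : dag (f + g) = dag f + dag g
  dag_smul {X Y : C} (c : ℂ) (f : X ⟶ Y) : dag (c • f) = (starRingEnd ℂ c) • dag f
  /-- The norm on the Hom-spaces. -/
  homNorm (X Y : C) : Norm (X ⟶ Y)
  normCore (X Y : C) : NormedSpace.Core ℂ (X ⟶ Y)
  complete (X Y : C) :
    letI := NormedAddCommGroup.ofCore (normCore X Y)
    CompleteSpace (X ⟶ Y)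
  norm_comp_le {X Y Z : C} (f : X ⟶ Y) (g : Y ⟶ Z) : ‖f ≫ g‖ ≤ ‖f‖ * ‖g‖
  norm_comp_dag {X Y : C} (f : X ⟶ Y) : ‖f ≫ dag f‖ = ‖f‖ ^ 2
  spectrum_nonneg {X Y : C} (f : X ⟶ Y) (z : ℂ)
    (hz : z ∈ spectrum ℂ (show End X from f ≫ dag f)) : 0 ≤ z.re ∧ z.im = 0

attribute [reducible, instance] CStarCategory.homNorm

/-- The dagger of a morphism. -/
postfix:max "†" => CStarCategory.dag

section CStarCategoryNotions

variable {C : Type u} [Category.{v} C] [CStarCategory C]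

theorem dag_id (X : C) : (𝟙 X)† = 𝟙 X := by
  have h := CStarCategory.dag_comp (𝟙 X)† (𝟙 X)
  rw [Category.comp_id, CStarCategory.dag_dag, Category.comp_id] at h
  exact h.symm

attribute [simp] CStarCategory.dag_dag CStarCategory.dag_comp dag_id

/-- `f† ∘ f = id`. -/
def IsIsometry {X Y : C} (f : X ⟶ Y) : Prop := f ≫ f† = 𝟙 X

/-- `f† ∘ f = id` and `f ∘ f† = id`. -/
def IsUnitary {X Y : C} (f : X ⟶ Y) : Prop := f ≫ f† = 𝟙 X ∧ f† ≫ f = 𝟙 Y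

/-- `f = g† ∘ g` for some `g`. -/
def IsPositive {X : C} (f : X ⟶ X) : Prop := ∃ (Y : C) (g : X ⟶ Y), f = g ≫ g†

/-- `Z` is a direct sum of the finite family `X`: there are isometries `i k : X k ⟶ Z` with
`∑ k, i k ∘ (i k)† = id`. -/
def IsDirectSum {ι : Type} [Fintype ι] (X : ι → C) (Z : C) : Prop :=
  ∃ i : ∀ k, X k ⟶ Z, (∀ k, IsIsometry (i k)) ∧ ∑ k, (i k)† ≫ i k = 𝟙 Z

/-- A C*-category is semisimple if it has a zero object and pairwise direct sums, every dagger
idempotent splits, and the endomorphism algebras are finite-dimensional. -/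
structure IsSemisimpleCStar (C : Type u) [Category.{v} C] [CStarCategory C] : Prop where
  exists_zero : ∃ Z : C, Limits.IsZero Z
  exists_directSum (X : Fin 2 → C) : ∃ Z : C, IsDirectSum X Z
  exists_splitting {X : C} (p : X ⟶ X) (hdag : p† = p) (hidem : p ≫ p = p) :
    ∃ (V : C) (i : V ⟶ X), IsIsometry i ∧ i† ≫ i = p
  finite_end (X : C) : FiniteDimensional ℂ (X ⟶ X)

/-- `X` is simple: `End X ≅ ℂ`. -/
def IsSimpleObj (X : C) : Prop := Module.finrank ℂ (X ⟶ X) = 1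

/-- The trace of `f ∈ End X`, computed as the trace of the operator of multiplication by `f` on `End X`.
On a commutative finite-dimensional C*-algebra `End X ≅ ℂⁿ` (the case in which it is used) this is
the unique trace that sends every minimal projection to `1`, see `endTrace_minimal`. -/
noncomputable def endTrace (X : C) (f : X ⟶ X) : ℂ :=
  LinearMap.trace ℂ (X ⟶ X) (Linear.leftComp ℂ X f)

theorem endTrace_minimal {X : C} [FiniteDimensional ℂ (X ⟶ X)] (p : X ⟶ X) (hp : p ≫ p = p)
    (h0 : p ≠ 0) (hmin : ∀ f : X ⟶ X, ∃ c : ℂ, p ≫ f = c • p) : endTrace X p = 1 := by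
  have h : LinearMap.IsProj (Submodule.span ℂ {p}) (Linear.leftComp ℂ X p) := by
    constructor
    · intro f
      obtain ⟨c, hc⟩ := hmin f
      exact Submodule.mem_span_singleton.2 ⟨c, hc.symm⟩
    · intro f hf
      obtain ⟨c, rfl⟩ := Submodule.mem_span_singleton.1 hf
      simp [hp]
  rw [endTrace, h.trace, finrank_span_singleton h0, Nat.cast_one]

end CStarCategoryNotions

section CStarBicat
open Bicategory

/-- A C*-2-category: a bicategory whose Hom-categories are C*-categories, such that horizontal
composition is linear and compatible with the dagger, and associators and unitors are unitary. -/
class CStarBicategory (B : Type u) [Bicategory.{w, v} B] where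
  /-- The C*-category structure on the Hom-categories. -/
  homCStar (a b : B) : CStarCategory (a ⟶ b)
  whiskerLeft_add {a b c : B} (f : a ⟶ b) {g h : b ⟶ c} (x y : g ⟶ h) :
    f ◁ (x + y) = f ◁ x + f ◁ y
  whiskerLeft_smul {a b c : B} (f : a ⟶ b) {g h : b ⟶ c} (z : ℂ) (x : g ⟶ h) :
    f ◁ (z • x) = z • f ◁ x
  add_whiskerRight {a b c : B} {f g : a ⟶ b} (x y : f ⟶ g) (h : b ⟶ c) :
    (x + y) ▷ h = x ▷ h + y ▷ h
  smul_whiskerRight {a b c : B} {f g : a ⟶ b} (z : ℂ) (x : f ⟶ g) (h : b ⟶ c) :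
    (z • x) ▷ h = z • x ▷ h
  dag_whiskerLeft {a b c : B} (f : a ⟶ b) {g h : b ⟶ c} (x : g ⟶ h) : (f ◁ x)† = f ◁ x†
  dag_whiskerRight {a b c : B} {f g : a ⟶ b} (x : f ⟶ g) (h : b ⟶ c) : (x ▷ h)† = x† ▷ h
  dag_associator {a b c d : B} (f : a ⟶ b) (g : b ⟶ c) (h : c ⟶ d) :
    (α_ f g h).hom† = (α_ f g h).inv
  dag_leftUnitor {a b : B} (f : a ⟶ b) : (λ_ f).hom† = (λ_ f).inv
  dag_rightUnitor {a b : B} (f : a ⟶ b) : (ρ_ f).hom† = (ρ_ f).inv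

attribute [reducible, instance] CStarBicategory.homCStar

end CStarBicat

section CStarTensor
open MonoidalCategory MonObj

/-- A C*-tensor category: a monoidal C*-category with linear tensor product compatible with the
dagger and with unitary associators and unitors. -/
class CStarTensorCategory (T : Type u) [Category.{v} T] [MonoidalCategory T] extends
    CStarCategory T, MonoidalPreadditive T, MonoidalLinear ℂ T where
  dag_whiskerLeft (X : T) {Y Z : T} (f : Y ⟶ Z) : (X ◁ f)† = X ◁ f†
  dag_whiskerRight {Y Z : T} (f : Y ⟶ Z) (X : T) : (f ▷ X)† = f† ▷ X
  dag_associator (X Y Z : T) : (α_ X Y Z).hom† = (α_ X Y Z).inv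
  dag_leftUnitor (X : T) : (λ_ X).hom† = (λ_ X).inv
  dag_rightUnitor (X : T) : (ρ_ X).hom† = (ρ_ X).inv

/-- A rigid C*-tensor category: a semisimple C*-tensor category in which every object `X` has a right
dual `Y`, with cup `𝟙_ T ⟶ Y ⊗ X` and cap `X ⊗ Y ⟶ 𝟙_ T`. The tensor unit need not be simple. -/
class RigidCStarTensorCategory (T : Type u) [Category.{v} T] [MonoidalCategory T] extends
    CStarTensorCategory T where
  semisimple : IsSemisimpleCStar T
  exists_dual (X : T) : ∃ Y : T, Nonempty (ExactPairing Y X)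

variable {T : Type u} [Category.{v} T] [MonoidalCategory T] [CStarTensorCategory T]

/-- The duality `cup`, `cap` between `X` and `Y` is standard: for `f ∈ End X`, the trace of
`cup† ∘ (id ⊗ f) ∘ cup` equals the trace of `cap ∘ (f ⊗ id) ∘ cap†`. -/
def IsStandardPairing {X Y : T} (cup : 𝟙_ T ⟶ Y ⊗ X) (cap : X ⊗ Y ⟶ 𝟙_ T) : Prop :=
  ∀ f : X ⟶ X, endTrace (𝟙_ T) (cup ≫ Y ◁ f ≫ cup†) = endTrace (𝟙_ T) (cap† ≫ f ▷ Y ≫ cap)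

/-- The cup `m† ∘ u` of an algebra. -/
def frobCup (A : T) [MonObj A] : 𝟙_ T ⟶ A ⊗ A := η[A] ≫ μ[A]†

/-- The cap `u† ∘ m` of an algebra. -/
def frobCap (A : T) [MonObj A] : A ⊗ A ⟶ 𝟙_ T := μ[A] ≫ η[A]†

variable (T) in
/-- Separable standard Frobenius algebras in a C*-tensor category. -/
structure SSFA extends Mon T where
  frob_left : X ◁ μ[X]† ≫ (α_ X X X).inv ≫ μ[X] ▷ X = μ[X] ≫ μ[X]†
  frob_right : μ[X]† ▷ X ≫ (α_ X X X).hom ≫ X ◁ μ[X] = μ[X] ≫ μ[X]†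
  separable : μ[X]† ≫ μ[X] = 𝟙 X
  standard : IsStandardPairing (frobCup X) (frobCap X)

/-- Dagger bimodules: bimodules `M` whose left action `ρ : A ⊗ M ⟶ M` satisfies
`(cap_A ⊗ id_M) ∘ (id_A ⊗ ρ†) = ρ`, and similarly on the right. -/
structure DaggerBimod (A B : SSFA T) extends Bimod A.toMon B.toMon where
  left_dag : A.X ◁ actLeft† ≫ (α_ A.X A.X X).inv ≫ frobCap A.X ▷ X ≫ (λ_ X).hom = actLeft
  right_dag : actRight† ▷ B.X ≫ (α_ X B.X B.X).hom ≫ X ◁ frobCap B.X ≫ (ρ_ X).hom = actRight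

/-- `f` is a `*`-homomorphism from the algebra `(A, mA, uA)` to the algebra `(B, mB, uB)`:
`f ∘ mA = mB ∘ (f ⊗ f)`, `f ∘ uA = uB` and
`f† = (id_A ⊗ (uB† ∘ mB)) ∘ (id_A ⊗ f ⊗ id_B) ∘ ((mA† ∘ uA) ⊗ id_B)`. -/
structure IsStarHom {A B : T} (mA : A ⊗ A ⟶ A) (uA : 𝟙_ T ⟶ A) (mB : B ⊗ B ⟶ B) (uB : 𝟙_ T ⟶ B)
    (f : A ⟶ B) : Prop where
  map_mul : mA ≫ f = (f ⊗ₘ f) ≫ mB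
  map_one : uA ≫ f = uB
  map_dag : f† = (λ_ B).inv ≫ (uA ≫ mA†) ▷ B ≫ (α_ A A B).hom ≫ A ◁ f ▷ B ≫
    A ◁ (mB ≫ uB†) ≫ (ρ_ A).hom

@[simp] theorem dag_wl (X : T) {Y Z : T} (f : Y ⟶ Z) : (X ◁ f)† = X ◁ f† :=
  CStarTensorCategory.dag_whiskerLeft X f
@[simp] theorem dag_wr {Y Z : T} (f : Y ⟶ Z) (X : T) : (f ▷ X)† = f† ▷ X :=
  CStarTensorCategory.dag_whiskerRight f X
@[simp] theorem dag_a (X Y Z : T) : (α_ X Y Z).hom† = (α_ X Y Z).inv :=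
  CStarTensorCategory.dag_associator X Y Z
@[simp] theorem dag_l (X : T) : (λ_ X).hom† = (λ_ X).inv :=
  CStarTensorCategory.dag_leftUnitor X
@[simp] theorem dag_r (X : T) : (ρ_ X).hom† = (ρ_ X).inv :=
  CStarTensorCategory.dag_rightUnitor X
@[simp] theorem dag_a' (X Y Z : T) : (α_ X Y Z).inv† = (α_ X Y Z).hom := by
  rw [← dag_a, CStarCategory.dag_dag]
@[simp] theorem dag_l' (X : T) : (λ_ X).inv† = (λ_ X).hom := by
  rw [← dag_l, CStarCategory.dag_dag]
@[simp] theorem dag_r' (X : T) : (ρ_ X).inv† = (ρ_ X).hom := by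
  rw [← dag_r, CStarCategory.dag_dag]

theorem dag_inj {X Y : T} {f g : X ⟶ Y} (h : f† = g†) : f = g := by
  rw [← CStarCategory.dag_dag f, h, CStarCategory.dag_dag]

@[simp] theorem frobCup_dag (A : T) [MonObj A] : (frobCup A)† = frobCap A := by
  simp [frobCup, frobCap]
@[simp] theorem frobCap_dag (A : T) [MonObj A] : (frobCap A)† = frobCup A := by
  simp [frobCup, frobCap]

namespace SSFA
variable (A : SSFA T)

theorem cup_left : A.X ◁ frobCup A.X ≫ (α_ _ _ _).inv ≫ μ[A.X] ▷ A.X = (ρ_ A.X).hom ≫ μ[A.X]† := by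
  rw [frobCup, whiskerLeft_comp, Category.assoc, A.frob_left, MonObj.mul_one_assoc]

theorem cup_right : frobCup A.X ▷ A.X ≫ (α_ _ _ _).hom ≫ A.X ◁ μ[A.X] = (λ_ A.X).hom ≫ μ[A.X]† := by
  rw [frobCup, comp_whiskerRight, Category.assoc, A.frob_right, MonObj.one_mul_assoc]

theorem counit_left : μ[A.X]† ≫ η[A.X]† ▷ A.X ≫ (λ_ A.X).hom = 𝟙 A.X := by
  apply dag_inj
  simp

theorem counit_right : μ[A.X]† ≫ A.X ◁ η[A.X]† ≫ (ρ_ A.X).hom = 𝟙 A.X := by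
  apply dag_inj
  simp

end SSFA

namespace DaggerBimod
variable {A B : SSFA T} (M : DaggerBimod A B)

theorem actLeft_dag : M.actLeft† =
    (λ_ M.X).inv ≫ frobCup A.X ▷ M.X ≫ (α_ _ _ _).hom ≫ A.X ◁ M.actLeft := by
  conv_lhs => rw [← M.left_dag]
  simp

theorem actRight_dag : M.actRight† =
    (ρ_ M.X).inv ≫ M.X ◁ frobCup B.X ≫ (α_ _ _ _).inv ≫ M.actRight ▷ B.X := by
  conv_lhs => rw [← M.right_dag]
  simp

theorem left_frob : M.actLeft ≫ M.actLeft† =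
    μ[A.X]† ▷ M.X ≫ (α_ _ _ _).hom ≫ A.X ◁ M.actLeft := by
  have h := congrArg (fun t => t ▷ M.X) A.cup_right
  calc M.actLeft ≫ M.actLeft† 
      = 𝟙 _ ⊗≫ (𝟙_ T ◁ M.actLeft ≫ frobCup A.X ▷ M.X) ⊗≫ A.X ◁ M.actLeft := by
        rw [actLeft_dag]; monoidal
    _ = 𝟙 _ ⊗≫ frobCup A.X ▷ A.X ▷ M.X ⊗≫ A.X ◁ ((α_ _ _ _).hom ≫ A.X ◁ M.actLeft ≫ M.actLeft) := by
        rw [whisker_exchange]; monoidal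
    _ = 𝟙 _ ⊗≫ (frobCup A.X ▷ A.X ≫ (α_ _ _ _).hom ≫ A.X ◁ μ[A.X]) ▷ M.X ⊗≫ A.X ◁ M.actLeft := by
        rw [← M.left_assoc]; monoidal
    _ = _ := by rw [A.cup_right]; monoidal

theorem left_frob' : M.actLeft ≫ M.actLeft† =
    A.X ◁ M.actLeft† ≫ (α_ _ _ _).inv ≫ μ[A.X] ▷ M.X := by
  have := congrArg CStarCategory.dag M.left_frob
  simpa using this

theorem right_frob : M.actRight ≫ M.actRight† =
    M.X ◁ μ[B.X]† ≫ (α_ _ _ _).inv ≫ M.actRight ▷ B.X := by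
  calc M.actRight ≫ M.actRight† 
      = 𝟙 _ ⊗≫ (M.actRight ▷ 𝟙_ T ≫ M.X ◁ frobCup B.X) ⊗≫ M.actRight ▷ B.X := by
        rw [actRight_dag]; monoidal
    _ = 𝟙 _ ⊗≫ M.X ◁ B.X ◁ frobCup B.X ⊗≫ ((α_ _ _ _).inv ≫ M.actRight ▷ B.X ≫ M.actRight) ▷ B.X := by
        rw [← whisker_exchange]; monoidal
    _ = 𝟙 _ ⊗≫ M.X ◁ (B.X ◁ frobCup B.X ≫ (α_ _ _ _).inv ≫ μ[B.X] ▷ B.X) ⊗≫ M.actRight ▷ B.X := by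
        rw [← M.right_assoc]; monoidal
    _ = _ := by rw [B.cup_left]; monoidal

theorem right_frob' : M.actRight ≫ M.actRight† =
    M.actRight† ▷ B.X ≫ (α_ _ _ _).hom ≫ M.X ◁ μ[B.X] := by
  have := congrArg CStarCategory.dag M.right_frob
  simpa using this

theorem left_sep : M.actLeft† ≫ M.actLeft = 𝟙 M.X := by
  have h : M.actLeft† ≫ M.actLeft = 
     (λ_ M.X).inv ≫ (η[A.X] ≫ μ[A.X]† ≫ μ[A.X]) ▷ M.X ≫ M.actLeft := by
    rw [actLeft_dag]; simp [frobCup]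
  rw [h, A.separable]; simp

theorem right_sep : M.actRight† ≫ M.actRight = 𝟙 M.X := by
  have h : M.actRight† ≫ M.actRight = 
     (ρ_ M.X).inv ≫ M.X ◁ (η[B.X] ≫ μ[B.X]† ≫ μ[B.X]) ≫ M.actRight := by
    rw [actRight_dag]; simp [frobCup]
  rw [h, B.separable]; simp


/-- The category of dagger bimodules and bimodule homomorphisms. -/
instance : Category (DaggerBimod A B) where
  Hom M N := Bimod.Hom M.toBimod N.toBimod
  id M := Bimod.id' M.toBimod
  comp f g := Bimod.comp f g

@[ext] theorem hom_ext {M N : DaggerBimod A B} {f g : M ⟶ N} (h : f.hom = g.hom) : f = g :=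
  Bimod.Hom.ext h

@[simp] theorem id_hom (M : DaggerBimod A B) : Bimod.Hom.hom (𝟙 M) = 𝟙 M.X := rfl
@[simp] theorem comp_hom {M N P : DaggerBimod A B} (f : M ⟶ N) (g : N ⟶ P) :
    Bimod.Hom.hom (f ≫ g) = f.hom ≫ g.hom := rfl

variable {M}

/-- The adjoint of a bimodule homomorphism is a bimodule homomorphism. -/
def dagHom {N : DaggerBimod A B} (f : M ⟶ N) : N ⟶ M where
  hom := f.hom†
  left_act_hom := by
    have h : A.X ◁ f.hom† ≫ A.X ◁ M.actLeft† = A.X ◁ N.actLeft† ≫ A.X ◁ A.X ◁ f.hom† := by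
      rw [← whiskerLeft_comp, ← whiskerLeft_comp]
      have := congrArg CStarCategory.dag f.left_act_hom
      simp only [CStarCategory.dag_comp, dag_wl] at this
      rw [this]
    rw [← M.left_dag, ← N.left_dag, reassoc_of% h]
    simp only [Category.assoc]
    rw [associator_inv_naturality_right_assoc, whisker_exchange_assoc]
    simp
  right_act_hom := by
    have h : f.hom† ▷ B.X ≫ M.actRight† ▷ B.X = N.actRight† ▷ B.X ≫ f.hom† ▷ B.X ▷ B.X := by
      rw [← comp_whiskerRight, ← comp_whiskerRight]
      have := congrArg CStarCategory.dag f.right_act_hom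
      simp only [CStarCategory.dag_comp, dag_wr] at this
      rw [this]
    rw [← M.right_dag, ← N.right_dag, reassoc_of% h]
    simp only [Category.assoc]
    rw [associator_naturality_left_assoc, ← whisker_exchange_assoc]
    simp

/-- Make an isomorphism out of a bimodule homomorphism that is unitary in `T`. -/
@[simps] def unitaryIso {N : DaggerBimod A B} (f : M ⟶ N) (h₁ : f.hom ≫ f.hom† = 𝟙 M.X)
    (h₂ : f.hom† ≫ f.hom = 𝟙 N.X) : M ≅ N where
  hom := f
  inv := dagHom f
  hom_inv_id := hom_ext h₁
  inv_hom_id := hom_ext h₂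

variable (A) in
/-- The trivial bimodule `A` over `A`. -/
@[simps X actLeft actRight]
abbrev regular : DaggerBimod A A where
  X := A.X
  actLeft := μ[A.X]
  one_actLeft := MonObj.one_mul A.X
  left_assoc := MonObj.mul_assoc A.X
  actRight := μ[A.X]
  actRight_one := MonObj.mul_one A.X
  right_assoc := by rw [MonObj.mul_assoc, Iso.inv_hom_id_assoc]
  middle_assoc := MonObj.mul_assoc A.X
  left_dag := by
    have := A.frob_left
    simp only [frobCap, comp_whiskerRight, Category.assoc]
    rw [reassoc_of% this, A.counit_left, Category.comp_id]
  right_dag := by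
    have := A.frob_right
    simp only [frobCap, whiskerLeft_comp, Category.assoc]
    rw [reassoc_of% this, A.counit_right, Category.comp_id]

/-- The bimodule structure on a splitting of an idempotent bimodule endomorphism. -/
@[simps X actLeft actRight]
abbrev ofSplitting (e : M ⟶ M) {V : T} (i : V ⟶ M.X) (hi : i ≫ i† = 𝟙 V) (he : i† ≫ i = e.hom) :
    DaggerBimod A B where
  X := V
  actLeft := A.X ◁ i ≫ M.actLeft ≫ i†
  one_actLeft := by
    rw [← whisker_exchange_assoc, Bimod.one_actLeft_assoc, leftUnitor_naturality_assoc, hi,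
      Category.comp_id]
  left_assoc := by
    have h : M.actLeft ≫ e.hom = A.X ◁ e.hom ≫ M.actLeft := e.left_act_hom
    have h2 : e.hom ≫ i† = i† := by rw [← he, Category.assoc, hi, Category.comp_id]
    calc _ = (A.X ⊗ A.X) ◁ i ≫ (α_ _ _ _).hom ≫ A.X ◁ M.actLeft ≫ M.actLeft ≫ i† := by
          rw [← whisker_exchange_assoc, Bimod.left_assoc_assoc]
      _ = (A.X ⊗ A.X) ◁ i ≫ (α_ _ _ _).hom ≫ A.X ◁ M.actLeft ≫ A.X ◁ e.hom ≫ M.actLeft ≫ i† := by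
          rw [← reassoc_of% h, h2]
      _ = _ := by rw [← he]; monoidal
  actRight := i ▷ B.X ≫ M.actRight ≫ i†
  actRight_one := by
    rw [whisker_exchange_assoc, Bimod.actRight_one_assoc, rightUnitor_naturality_assoc, hi,
      Category.comp_id]
  right_assoc := by
    have h : M.actRight ≫ e.hom = e.hom ▷ B.X ≫ M.actRight := e.right_act_hom
    have h2 : e.hom ≫ i† = i† := by rw [← he, Category.assoc, hi, Category.comp_id]
    calc _ = i ▷ (B.X ⊗ B.X) ≫ (α_ _ _ _).inv ≫ M.actRight ▷ B.X ≫ M.actRight ≫ i† := by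
          rw [whisker_exchange_assoc, Bimod.right_assoc_assoc]
      _ = i ▷ (B.X ⊗ B.X) ≫ (α_ _ _ _).inv ≫ M.actRight ▷ B.X ≫ e.hom ▷ B.X ≫ M.actRight ≫ i† := by
          rw [← reassoc_of% h, h2]
      _ = _ := by rw [← he]; monoidal
  middle_assoc := by
    have h : M.actRight ≫ e.hom = e.hom ▷ B.X ≫ M.actRight := e.right_act_hom
    have h' : M.actLeft ≫ e.hom = A.X ◁ e.hom ≫ M.actLeft := e.left_act_hom
    have h2 : e.hom ≫ i† = i† := by rw [← he, Category.assoc, hi, Category.comp_id]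
    calc _ = (A.X ◁ i) ▷ B.X ≫ M.actLeft ▷ B.X ≫ (i† ≫ i) ▷ B.X ≫ M.actRight ≫ i† := by
          monoidal
      _ = (A.X ◁ i) ▷ B.X ≫ M.actLeft ▷ B.X ≫ M.actRight ≫ i† := by
          rw [he, ← reassoc_of% h, h2]
      _ = (A.X ◁ i) ▷ B.X ≫ (α_ _ _ _).hom ≫ A.X ◁ M.actRight ≫ A.X ◁ (i† ≫ i) ≫ M.actLeft ≫ i† := by
          rw [he, ← reassoc_of% h', h2, Bimod.middle_assoc_assoc]
      _ = _ := by monoidal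
  left_dag := by
    conv_rhs => rw [← M.left_dag]
    simp only [CStarCategory.dag_comp, CStarCategory.dag_dag, dag_wl, whiskerLeft_comp,
      Category.assoc]
    rw [associator_inv_naturality_right_assoc, whisker_exchange_assoc, leftUnitor_naturality]
  right_dag := by
    conv_rhs => rw [← M.right_dag]
    simp only [CStarCategory.dag_comp, CStarCategory.dag_dag, dag_wr, comp_whiskerRight,
      Category.assoc]
    rw [associator_naturality_left_assoc, ← whisker_exchange_assoc, rightUnitor_naturality]

theorem ofSplitting_left (e : M ⟶ M) {V : T} (i : V ⟶ M.X) (hi : i ≫ i† = 𝟙 V) (he : i† ≫ i = e.hom) :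
    M.actLeft ≫ i† = A.X ◁ i† ≫ (ofSplitting e i hi he).actLeft := by
  have h' : M.actLeft ≫ e.hom = A.X ◁ e.hom ≫ M.actLeft := e.left_act_hom
  have h2 : e.hom ≫ i† = i† := by rw [← he, Category.assoc, hi, Category.comp_id]
  change _ = A.X ◁ i† ≫ A.X ◁ i ≫ M.actLeft ≫ i†
  rw [← whiskerLeft_comp_assoc, he, ← reassoc_of% h', h2]

theorem ofSplitting_right (e : M ⟶ M) {V : T} (i : V ⟶ M.X) (hi : i ≫ i† = 𝟙 V) (he : i† ≫ i = e.hom) :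
    M.actRight ≫ i† = i† ▷ B.X ≫ (ofSplitting e i hi he).actRight := by
  have h' : M.actRight ≫ e.hom = e.hom ▷ B.X ≫ M.actRight := e.right_act_hom
  have h2 : e.hom ≫ i† = i† := by rw [← he, Category.assoc, hi, Category.comp_id]
  change _ = i† ▷ B.X ≫ i ▷ B.X ≫ M.actRight ≫ i†
  rw [← comp_whiskerRight_assoc, he, ← reassoc_of% h', h2]

variable {C D E : SSFA T}

/-- The bimodule `M ⊗ N` with the outer actions. -/
@[simps X actLeft actRight]
abbrev outer (M : DaggerBimod A B) (N : DaggerBimod C D) : DaggerBimod A D where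
  X := M.X ⊗ N.X
  actLeft := (α_ _ _ _).inv ≫ M.actLeft ▷ N.X
  one_actLeft := by
    calc _ = (α_ _ _ _).inv ≫ (η[A.X] ▷ M.X ≫ M.actLeft) ▷ N.X := by monoidal
      _ = _ := by rw [M.one_actLeft]; monoidal
  left_assoc := by
    calc _ = (α_ _ _ _).inv ≫ (μ[A.X] ▷ M.X ≫ M.actLeft) ▷ N.X := by monoidal
      _ = _ := by rw [M.left_assoc]; monoidal
  actRight := (α_ _ _ _).hom ≫ M.X ◁ N.actRight
  actRight_one := by
    calc _ = (α_ _ _ _).hom ≫ M.X ◁ (N.X ◁ η[D.X] ≫ N.actRight) := by monoidal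
      _ = _ := by rw [N.actRight_one]; monoidal
  right_assoc := by
    calc _ = (α_ _ _ _).hom ≫ M.X ◁ (N.X ◁ μ[D.X] ≫ N.actRight) := by monoidal
      _ = _ := by rw [N.right_assoc]; monoidal
  middle_assoc := by
    calc _ = 𝟙 _ ⊗≫ (M.actLeft ▷ (N.X ⊗ D.X) ≫ M.X ◁ N.actRight) ⊗≫ 𝟙 _ := by monoidal
      _ = _ := by rw [← whisker_exchange]; monoidal
  left_dag := by
    conv_rhs => rw [← M.left_dag]
    simp
  right_dag := by
    conv_rhs => rw [← N.right_dag]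
    simp

/-- The dagger idempotent on `M ⊗ N` that defines the relative tensor product: create a pair of
`B`-wires with the Frobenius cup and let them act on `M` from the right and on `N` from the left. -/
def relIdem (M : DaggerBimod A B) (N : DaggerBimod B C) : M.X ⊗ N.X ⟶ M.X ⊗ N.X :=
  M.X ◁ ((λ_ N.X).inv ≫ frobCup B.X ▷ N.X ≫ (α_ B.X B.X N.X).hom) ≫
    (α_ M.X B.X (B.X ⊗ N.X)).inv ≫ (M.actRight ⊗ₘ N.actLeft)

variable (M : DaggerBimod A B) (N : DaggerBimod B C)

theorem relIdem_eq_left : relIdem M N = M.X ◁ N.actLeft† ≫ (α_ _ _ _).inv ≫ M.actRight ▷ N.X := by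
  rw [relIdem, actLeft_dag, MonoidalCategory.tensorHom_def']
  simp

theorem relIdem_eq_right : relIdem M N = M.actRight† ▷ N.X ≫ (α_ _ _ _).hom ≫ M.X ◁ N.actLeft := by
  rw [relIdem, actRight_dag, MonoidalCategory.tensorHom_def]
  simp

theorem relIdem_dag : (relIdem M N)† = relIdem M N := by
  conv_lhs => rw [relIdem_eq_left]
  rw [relIdem_eq_right]; simp

theorem relIdem_idem : relIdem M N ≫ relIdem M N = relIdem M N := by
  have h : N.actLeft† ≫ B.X ◁ N.actLeft† = N.actLeft† ≫ μ[B.X]† ▷ N.X ≫ (α_ _ _ _).hom := by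
    have := congrArg CStarCategory.dag N.left_assoc
    simp only [CStarCategory.dag_comp, dag_wl, dag_wr, dag_a] at this
    rw [← Category.assoc, this]; simp
  calc relIdem M N ≫ relIdem M N
      = 𝟙 _ ⊗≫ M.X ◁ N.actLeft† ⊗≫ (M.actRight ▷ N.X ≫ M.X ◁ N.actLeft†) ⊗≫ M.actRight ▷ N.X := by
        rw [relIdem_eq_left]; monoidal
    _ = 𝟙 _ ⊗≫ M.X ◁ (N.actLeft† ≫ B.X ◁ N.actLeft†) ⊗≫
          ((α_ _ _ _).inv ≫ M.actRight ▷ B.X ≫ M.actRight) ▷ N.X := by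
        rw [← whisker_exchange]; monoidal
    _ = M.X ◁ N.actLeft† ⊗≫ M.X ◁ (μ[B.X]† ≫ μ[B.X]) ▷ N.X ⊗≫ M.actRight ▷ N.X := by
        rw [h, ← M.right_assoc]; monoidal
    _ = _ := by rw [B.separable, relIdem_eq_left]; monoidal

theorem relIdem_natural_left {M' : DaggerBimod D B} (f : M.X ⟶ M'.X)
    (hf : M.actRight ≫ f = f ▷ B.X ≫ M'.actRight) :
    relIdem M N ≫ f ▷ N.X = f ▷ N.X ≫ relIdem M' N := by
  rw [relIdem_eq_left, relIdem_eq_left, ← whisker_exchange_assoc]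
  simp only [Category.assoc]
  rw [← comp_whiskerRight, hf]; simp

theorem relIdem_natural_right {N' : DaggerBimod B D} (f : N.X ⟶ N'.X)
    (hf : N.actLeft ≫ f = B.X ◁ f ≫ N'.actLeft) :
    relIdem M N ≫ M.X ◁ f = M.X ◁ f ≫ relIdem M N' := by
  rw [relIdem_eq_right, relIdem_eq_right, whisker_exchange_assoc]
  simp only [Category.assoc]
  rw [← whiskerLeft_comp, hf]; simp

/-- The idempotent `relIdem` is a bimodule homomorphism for the outer actions. -/
@[simps hom] def relIdemHom : outer M N ⟶ outer M N where
  hom := relIdem M N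
  left_act_hom := by
    have h := M.middle_assoc
    simp only [relIdem_eq_left]
    calc _ = 𝟙 _ ⊗≫ (M.actLeft ▷ N.X ≫ M.X ◁ N.actLeft†) ⊗≫ M.actRight ▷ N.X := by monoidal
      _ = 𝟙 _ ⊗≫ A.X ◁ M.X ◁ N.actLeft† ⊗≫ (M.actLeft ▷ B.X ≫ M.actRight) ▷ N.X := by
        rw [← whisker_exchange]; monoidal
      _ = _ := by rw [h]; monoidal
  right_act_hom := by
    have h := N.middle_assoc
    simp only [relIdem_eq_right]
    calc _ = 𝟙 _ ⊗≫ (M.X ◁ N.actRight ≫ M.actRight† ▷ N.X) ⊗≫ M.X ◁ N.actLeft := by monoidal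
      _ = 𝟙 _ ⊗≫ M.actRight† ▷ N.X ▷ C.X ⊗≫ M.X ◁ ((α_ _ _ _).hom ≫ B.X ◁ N.actRight ≫ N.actLeft) := by
        rw [whisker_exchange]; monoidal
      _ = _ := by rw [← h]; monoidal

theorem relIdem_outer_left (L : DaggerBimod D E) :
    relIdem (outer L M) N = (α_ _ _ _).hom ≫ L.X ◁ relIdem M N ≫ (α_ _ _ _).inv := by
  rw [relIdem_eq_left, relIdem_eq_left]
  simp

theorem relIdem_outer_right (P : DaggerBimod D E) :
    relIdem M (outer N P) = (α_ _ _ _).inv ≫ relIdem M N ▷ P.X ≫ (α_ _ _ _).hom := by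
  rw [relIdem_eq_left, relIdem_eq_left]
  simp

theorem relIdem_balanced : M.actRight ▷ N.X ≫ relIdem M N =
    (α_ _ _ _).hom ≫ M.X ◁ N.actLeft ≫ relIdem M N := by
  calc _ = (M.actRight ≫ M.actRight†) ▷ N.X ≫ (α_ _ _ _).hom ≫ M.X ◁ N.actLeft := by
        rw [relIdem_eq_right]; simp
    _ = 𝟙 _ ⊗≫ M.X ◁ (μ[B.X]† ▷ N.X ≫ (α_ _ _ _).hom ≫ B.X ◁ N.actLeft) ⊗≫ M.actRight ▷ N.X := by
        rw [right_frob]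
        calc _ = 𝟙 _ ⊗≫ M.X ◁ μ[B.X]† ▷ N.X ⊗≫ (M.actRight ▷ (B.X ⊗ N.X) ≫ M.X ◁ N.actLeft) := by monoidal
          _ = _ := by rw [← whisker_exchange]; monoidal
    _ = _ := by rw [← left_frob, relIdem_eq_left]; monoidal


/-- `id ⊗ g` as a homomorphism for the outer actions. -/
@[simps] def outerWhiskerLeft (M : DaggerBimod A B) {N N' : DaggerBimod C D} (g : N ⟶ N') :
    outer M N ⟶ outer M N' where
  hom := M.X ◁ g.hom
  left_act_hom := by
    simp only [Category.assoc]
    rw [← whisker_exchange]; simp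
  right_act_hom := by
    simp only [Category.assoc]
    rw [← whiskerLeft_comp, g.right_act_hom]; simp

/-- `f ⊗ id` as a homomorphism for the outer actions. -/
@[simps] def outerWhiskerRight {M M' : DaggerBimod A B} (f : M ⟶ M') (N : DaggerBimod C D) :
    outer M N ⟶ outer M' N where
  hom := f.hom ▷ N.X
  left_act_hom := by
    simp only [Category.assoc]
    rw [← comp_whiskerRight, f.left_act_hom]; simp
  right_act_hom := by
    simp only [Category.assoc]
    rw [whisker_exchange]; simp

/-- The associator of `T` as a homomorphism for the outer actions. -/
@[simps] def outerAssoc {F : SSFA T} (L : DaggerBimod A B) (M : DaggerBimod C D)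
    (N : DaggerBimod E F) : outer (outer L M) N ⟶ outer L (outer M N) where
  hom := (α_ L.X M.X N.X).hom
  left_act_hom := by simp
  right_act_hom := by simp

/-- The left action as a bimodule homomorphism. -/
@[simps] def actLeftHom (M : DaggerBimod A B) : outer (regular A) M ⟶ M where
  hom := M.actLeft
  left_act_hom := by
    change ((α_ _ _ _).inv ≫ μ[A.X] ▷ M.X) ≫ M.actLeft = A.X ◁ M.actLeft ≫ M.actLeft
    rw [Category.assoc, M.left_assoc]; simp
  right_act_hom := by
    change ((α_ _ _ _).hom ≫ A.X ◁ M.actRight) ≫ M.actLeft = M.actLeft ▷ B.X ≫ M.actRight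
    rw [M.middle_assoc]; simp

/-- The right action as a bimodule homomorphism. -/
@[simps] def actRightHom (M : DaggerBimod A B) : outer M (regular B) ⟶ M where
  hom := M.actRight
  left_act_hom := by
    change ((α_ _ _ _).inv ≫ M.actLeft ▷ B.X) ≫ M.actRight = A.X ◁ M.actRight ≫ M.actLeft
    rw [Category.assoc, M.middle_assoc]; simp
  right_act_hom := by
    change ((α_ _ _ _).hom ≫ M.X ◁ μ[B.X]) ≫ M.actRight = M.actRight ▷ B.X ≫ M.actRight
    rw [Category.assoc, M.right_assoc]; simp

end DaggerBimod
end CStarTensor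

section RigidCStarTensor
open MonoidalCategory MonObj
variable {T : Type u} [Category.{v} T] [MonoidalCategory T] [RigidCStarTensorCategory T]

namespace DaggerBimod
variable {A B C D E : SSFA T}

theorem exists_relIdem_splitting (M : DaggerBimod A B) (N : DaggerBimod B C) :
    ∃ (V : T) (i : V ⟶ M.X ⊗ N.X), IsIsometry i ∧ i† ≫ i = relIdem M N :=
  RigidCStarTensorCategory.semisimple.exists_splitting _ (relIdem_dag M N) (relIdem_idem M N)

/-- The relative tensor product `M ⊗_B N`: a splitting of the dagger idempotent `relIdem M N`. -/
noncomputable def relTensor (M : DaggerBimod A B) (N : DaggerBimod B C) : DaggerBimod A C :=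
  ofSplitting (relIdemHom M N) (exists_relIdem_splitting M N).choose_spec.choose
    (exists_relIdem_splitting M N).choose_spec.choose_spec.1
    (exists_relIdem_splitting M N).choose_spec.choose_spec.2

/-- The isometry `M ⊗_B N ⟶ M ⊗ N`. -/
noncomputable def relIncl (M : DaggerBimod A B) (N : DaggerBimod B C) :
    (relTensor M N).X ⟶ M.X ⊗ N.X :=
  (exists_relIdem_splitting M N).choose_spec.choose

/-- The coisometry `M ⊗ N ⟶ M ⊗_B N`. -/
noncomputable abbrev relProj (M : DaggerBimod A B) (N : DaggerBimod B C) :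
    M.X ⊗ N.X ⟶ (relTensor M N).X :=
  (relIncl M N)†

section
variable (M : DaggerBimod A B) (N : DaggerBimod B C)
@[simp] theorem incl_proj : relIncl M N ≫ relProj M N = 𝟙 _ :=
  (exists_relIdem_splitting M N).choose_spec.choose_spec.1

@[simp] theorem incl_proj_assoc {Z : T} (h : (relTensor M N).X ⟶ Z) :
    relIncl M N ≫ relProj M N ≫ h = h := by
  rw [← Category.assoc, incl_proj, Category.id_comp]

theorem proj_incl : relProj M N ≫ relIncl M N = relIdem M N :=
  (exists_relIdem_splitting M N).choose_spec.choose_spec.2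

theorem proj_incl_assoc {Z : T} (h : M.X ⊗ N.X ⟶ Z) :
    relProj M N ≫ relIncl M N ≫ h = relIdem M N ≫ h := by
  rw [← Category.assoc, proj_incl]

@[simp] theorem idem_proj : relIdem M N ≫ relProj M N = relProj M N := by
  rw [← proj_incl, Category.assoc, incl_proj, Category.comp_id]

@[simp] theorem idem_proj_assoc {Z : T} (h : (relTensor M N).X ⟶ Z) :
    relIdem M N ≫ relProj M N ≫ h = relProj M N ≫ h := by
  rw [← Category.assoc, idem_proj]

@[simp] theorem incl_idem : relIncl M N ≫ relIdem M N = relIncl M N := by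
  rw [← proj_incl, incl_proj_assoc]

@[simp] theorem incl_idem_assoc {Z : T} (h : M.X ⊗ N.X ⟶ Z) :
    relIncl M N ≫ relIdem M N ≫ h = relIncl M N ≫ h := by
  rw [← Category.assoc, incl_idem]

/-- `relProj` as a bimodule homomorphism. -/
noncomputable def projHom : outer M N ⟶ relTensor M N where
  hom := relProj M N
  left_act_hom := ofSplitting_left (relIdemHom M N) (relIncl M N)
    (exists_relIdem_splitting M N).choose_spec.choose_spec.1
    (exists_relIdem_splitting M N).choose_spec.choose_spec.2
  right_act_hom := ofSplitting_right (relIdemHom M N) (relIncl M N)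
    (exists_relIdem_splitting M N).choose_spec.choose_spec.1
    (exists_relIdem_splitting M N).choose_spec.choose_spec.2

/-- `relIncl` as a bimodule homomorphism. -/
noncomputable def inclHom : relTensor M N ⟶ outer M N := dagHom (projHom M N)

@[simp] theorem projHom_hom : (projHom M N).hom = relProj M N := rfl
@[simp] theorem inclHom_hom : (inclHom M N).hom = relIncl M N := CStarCategory.dag_dag _

instance : IsSplitEpi (relProj M N) := ⟨⟨⟨relIncl M N, incl_proj M N⟩⟩⟩
end

instance {X Y : T} (f : X ⟶ Y) [IsSplitEpi f] (Z : T) : IsSplitEpi (f ▷ Z) :=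
  ⟨⟨⟨section_ f ▷ Z, by rw [← comp_whiskerRight, IsSplitEpi.id, id_whiskerRight]⟩⟩⟩

instance {X Y : T} (f : X ⟶ Y) [IsSplitEpi f] (Z : T) : IsSplitEpi (Z ◁ f) :=
  ⟨⟨⟨Z ◁ section_ f, by rw [← whiskerLeft_comp, IsSplitEpi.id, whiskerLeft_id]⟩⟩⟩

/-- The relative tensor product `id ⊗_B g`. -/
noncomputable def relWhiskerLeft (M : DaggerBimod A B) {N N' : DaggerBimod B C} (g : N ⟶ N') :
    relTensor M N ⟶ relTensor M N' :=
  inclHom M N ≫ outerWhiskerLeft M g ≫ projHom M N'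

/-- The relative tensor product `f ⊗_B id`. -/
noncomputable def relWhiskerRight {M M' : DaggerBimod A B} (f : M ⟶ M') (N : DaggerBimod B C) :
    relTensor M N ⟶ relTensor M' N :=
  inclHom M N ≫ outerWhiskerRight f N ≫ projHom M' N

/-- The associator `(M ⊗_B N) ⊗_C O ⟶ M ⊗_B (N ⊗_C O)`. -/
noncomputable def relAssocHom (M : DaggerBimod A B) (N : DaggerBimod B C) (O : DaggerBimod C D) :
    relTensor (relTensor M N) O ⟶ relTensor M (relTensor N O) :=
  inclHom _ O ≫ outerWhiskerRight (inclHom M N) O ≫ outerAssoc M N O ≫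
    outerWhiskerLeft M (projHom N O) ≫ projHom M _

/-- The left unitor `A ⊗_A M ⟶ M`, given by the action. -/
noncomputable def relLeftUnitorHom (M : DaggerBimod A B) : relTensor (regular A) M ⟶ M :=
  inclHom _ _ ≫ actLeftHom M

/-- The right unitor `M ⊗_B B ⟶ M`, given by the action. -/
noncomputable def relRightUnitorHom (M : DaggerBimod A B) : relTensor M (regular B) ⟶ M :=
  inclHom _ _ ≫ actRightHom M

@[simp] theorem proj_relWhiskerLeft (M : DaggerBimod A B) {N N' : DaggerBimod B C} (g : N ⟶ N') :
    relProj M N ≫ (relWhiskerLeft M g).hom = M.X ◁ g.hom ≫ relProj M N' := by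
  simp only [relWhiskerLeft, comp_hom, inclHom_hom, projHom_hom, outerWhiskerLeft_hom]
  rw [proj_incl_assoc, ← Category.assoc, relIdem_natural_right M N g.hom g.left_act_hom,
    Category.assoc, idem_proj]

@[simp] theorem proj_relWhiskerLeft_assoc (M : DaggerBimod A B) {N N' : DaggerBimod B C}
    (g : N ⟶ N') {Z : T} (h : (relTensor M N').X ⟶ Z) :
    relProj M N ≫ (relWhiskerLeft M g).hom ≫ h = M.X ◁ g.hom ≫ relProj M N' ≫ h := by
  simpa only [Category.assoc] using congrArg (fun t => t ≫ h) (proj_relWhiskerLeft M g)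

@[simp] theorem proj_relWhiskerRight {M M' : DaggerBimod A B} (f : M ⟶ M') (N : DaggerBimod B C) :
    relProj M N ≫ (relWhiskerRight f N).hom = f.hom ▷ N.X ≫ relProj M' N := by
  simp only [relWhiskerRight, comp_hom, inclHom_hom, projHom_hom, outerWhiskerRight_hom]
  rw [proj_incl_assoc, ← Category.assoc, relIdem_natural_left M N f.hom f.right_act_hom,
    Category.assoc, idem_proj]

@[simp] theorem proj_relWhiskerRight_assoc {M M' : DaggerBimod A B} (f : M ⟶ M')
    (N : DaggerBimod B C) {Z : T} (h : (relTensor M' N).X ⟶ Z) :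
    relProj M N ≫ (relWhiskerRight f N).hom ≫ h = f.hom ▷ N.X ≫ relProj M' N ≫ h := by
  simpa only [Category.assoc] using congrArg (fun t => t ≫ h) (proj_relWhiskerRight f N)

theorem proj_assoc (M : DaggerBimod A B) (N : DaggerBimod B C) (O : DaggerBimod C D) :
    relProj M N ▷ O.X ≫ relProj (relTensor M N) O ≫ (relAssocHom M N O).hom =
      (α_ _ _ _).hom ≫ M.X ◁ relProj N O ≫ relProj M (relTensor N O) := by
  have h1 := relIdem_natural_left (relTensor M N) O (M' := outer M N) (relIncl M N)
    (by simpa using (inclHom M N).right_act_hom)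
  have h2 := relIdem_natural_right M (outer N O) (N' := relTensor N O) (relProj N O)
    (projHom N O).left_act_hom
  rw [relIdem_outer_left] at h1
  rw [relIdem_outer_right] at h2
  simp only [relAssocHom, comp_hom, inclHom_hom, projHom_hom, outerWhiskerRight_hom,
    outerWhiskerLeft_hom, outerAssoc_hom]
  rw [proj_incl_assoc, reassoc_of% h1, ← comp_whiskerRight_assoc, proj_incl,
    Iso.inv_hom_id_assoc, ← whiskerLeft_comp_assoc, idem_proj]
  simp only [Category.assoc] at h2
  rw [Iso.inv_comp_eq] at h2
  have h3 := congrArg (fun t => t ≫ relProj M (relTensor N O)) h2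
  simpa using h3

theorem proj_assoc_assoc (M : DaggerBimod A B) (N : DaggerBimod B C) (O : DaggerBimod C D)
    {Z : T} (h : (relTensor M (relTensor N O)).X ⟶ Z) :
    relProj M N ▷ O.X ≫ relProj (relTensor M N) O ≫ (relAssocHom M N O).hom ≫ h =
      (α_ _ _ _).hom ≫ M.X ◁ relProj N O ≫ relProj M (relTensor N O) ≫ h := by
  simpa only [Category.assoc] using congrArg (fun t => t ≫ h) (proj_assoc M N O)

theorem proj_assoc_dag (M : DaggerBimod A B) (N : DaggerBimod B C) (O : DaggerBimod C D) :
    M.X ◁ relProj N O ≫ relProj M (relTensor N O) ≫ (relAssocHom M N O).hom† =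
      (α_ _ _ _).inv ≫ relProj M N ▷ O.X ≫ relProj (relTensor M N) O := by
  have h1 := relIdem_natural_right M (relTensor N O) (N' := outer N O) (relIncl N O)
    (by simpa using (inclHom N O).left_act_hom)
  have h2 := relIdem_natural_left (outer M N) O (M' := relTensor M N) (relProj M N)
    (projHom M N).right_act_hom
  rw [relIdem_outer_right] at h1
  rw [relIdem_outer_left] at h2
  simp only [relAssocHom, comp_hom, inclHom_hom, projHom_hom, outerWhiskerRight_hom,
    outerWhiskerLeft_hom, outerAssoc_hom, CStarCategory.dag_comp, CStarCategory.dag_dag,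
    dag_wl, dag_wr, dag_a, Category.assoc]
  rw [proj_incl_assoc, reassoc_of% h1, ← whiskerLeft_comp_assoc, proj_incl,
    Iso.hom_inv_id_assoc, ← comp_whiskerRight_assoc, idem_proj]
  simp only [Category.assoc] at h2
  have h3 := congrArg (fun t => (α_ _ _ _).inv ≫ t ≫ relProj (relTensor M N) O) h2
  simpa using h3

theorem proj_assoc_dag_assoc (M : DaggerBimod A B) (N : DaggerBimod B C) (O : DaggerBimod C D)
    {Z : T} (h : (relTensor (relTensor M N) O).X ⟶ Z) :
    M.X ◁ relProj N O ≫ relProj M (relTensor N O) ≫ (relAssocHom M N O).hom† ≫ h =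
      (α_ _ _ _).inv ≫ relProj M N ▷ O.X ≫ relProj (relTensor M N) O ≫ h := by
  simpa only [Category.assoc] using congrArg (fun t => t ≫ h) (proj_assoc_dag M N O)

theorem regular_left (M : DaggerBimod A B) : relIdem (regular A) M = M.actLeft ≫ M.actLeft† := by
  rw [relIdem_eq_left, left_frob']

theorem regular_right (M : DaggerBimod A B) : relIdem M (regular B) = M.actRight ≫ M.actRight† := by
  rw [relIdem_eq_right, right_frob']

@[simp] theorem proj_leftUnitor (M : DaggerBimod A B) :
    relProj (regular A) M ≫ (relLeftUnitorHom M).hom = M.actLeft := by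
  simp only [relLeftUnitorHom, comp_hom, inclHom_hom, actLeftHom_hom]
  rw [proj_incl_assoc, regular_left, Category.assoc, left_sep, Category.comp_id]

@[simp] theorem proj_leftUnitor_assoc (M : DaggerBimod A B) {Z : T} (h : M.X ⟶ Z) :
    relProj (regular A) M ≫ (relLeftUnitorHom M).hom ≫ h = M.actLeft ≫ h := by
  simpa only [Category.assoc] using congrArg (fun t => t ≫ h) (proj_leftUnitor M)

@[simp] theorem proj_rightUnitor (M : DaggerBimod A B) :
    relProj M (regular B) ≫ (relRightUnitorHom M).hom = M.actRight := by
  simp only [relRightUnitorHom, comp_hom, inclHom_hom, actRightHom_hom]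
  rw [proj_incl_assoc, regular_right, Category.assoc, right_sep, Category.comp_id]

@[simp] theorem proj_rightUnitor_assoc (M : DaggerBimod A B) {Z : T} (h : M.X ⟶ Z) :
    relProj M (regular B) ≫ (relRightUnitorHom M).hom ≫ h = M.actRight ≫ h := by
  simpa only [Category.assoc] using congrArg (fun t => t ≫ h) (proj_rightUnitor M)

/-- The associator is unitary. -/
noncomputable def relAssoc (M : DaggerBimod A B) (N : DaggerBimod B C) (O : DaggerBimod C D) :
    relTensor (relTensor M N) O ≅ relTensor M (relTensor N O) :=
  unitaryIso (relAssocHom M N O)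
    (by
      rw [← cancel_epi (relProj (relTensor M N) O), ← cancel_epi (relProj M N ▷ O.X),
        proj_assoc_assoc, proj_assoc_dag]
      simp)
    (by
      rw [← cancel_epi (relProj M (relTensor N O)), ← cancel_epi (M.X ◁ relProj N O),
        proj_assoc_dag_assoc, proj_assoc]
      simp)

/-- The left unitor is unitary. -/
noncomputable def relLeftUnitor (M : DaggerBimod A B) : relTensor (regular A) M ≅ M :=
  unitaryIso (relLeftUnitorHom M)
    (by
      simp only [relLeftUnitorHom, comp_hom, inclHom_hom, actLeftHom_hom, CStarCategory.dag_comp,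
        Category.assoc]
      rw [← Category.assoc M.actLeft, ← regular_left]
      exact (incl_idem_assoc _ _ _).trans (incl_proj _ _))
    (by
      simp only [relLeftUnitorHom, comp_hom, inclHom_hom, actLeftHom_hom, CStarCategory.dag_comp,
        Category.assoc]
      rw [proj_incl_assoc, regular_left, Category.assoc, left_sep, Category.comp_id, left_sep])

/-- The right unitor is unitary. -/
noncomputable def relRightUnitor (M : DaggerBimod A B) : relTensor M (regular B) ≅ M :=
  unitaryIso (relRightUnitorHom M)
    (by
      simp only [relRightUnitorHom, comp_hom, inclHom_hom, actRightHom_hom, CStarCategory.dag_comp,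
        Category.assoc]
      rw [← Category.assoc M.actRight, ← regular_right]
      exact (incl_idem_assoc _ _ _).trans (incl_proj _ _))
    (by
      simp only [relRightUnitorHom, comp_hom, inclHom_hom, actRightHom_hom, CStarCategory.dag_comp,
        Category.assoc]
      rw [proj_incl_assoc, regular_right, Category.assoc, right_sep, Category.comp_id, right_sep])

@[simp] theorem relAssoc_hom (M : DaggerBimod A B) (N : DaggerBimod B C) (O : DaggerBimod C D) :
   (relAssoc M N O).hom = relAssocHom M N O := rfl
@[simp] theorem relLeftUnitor_hom (M : DaggerBimod A B) :
   (relLeftUnitor M).hom = relLeftUnitorHom M := rfl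
@[simp] theorem relRightUnitor_hom (M : DaggerBimod A B) :
   (relRightUnitor M).hom = relRightUnitorHom M := rfl

end DaggerBimod

open DaggerBimod

/-- The bicategory with objects the separable standard Frobenius algebras in `T`, 1-morphisms the
dagger bimodules (composed by the relative tensor product), 2-morphisms the bimodule
homomorphisms. -/
noncomputable instance : Bicategory (SSFA T) where
  Hom A B := DaggerBimod A B
  id A := regular A
  comp M N := relTensor M N
  homCategory A B := inferInstanceAs (Category (DaggerBimod A B))
  whiskerLeft M _ _ g := relWhiskerLeft M g
  whiskerRight f N := relWhiskerRight f N
  associator M N O := relAssoc M N O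
  leftUnitor M := relLeftUnitor M
  rightUnitor M := relRightUnitor M
  whiskerLeft_id M N := by
    apply hom_ext
    rw [← cancel_epi (relProj M N)]
    simp
  whiskerLeft_comp {_ _ _} M {N N' N''} g h := by
    apply hom_ext
    rw [← cancel_epi (relProj M N)]
    simp
  id_whiskerLeft {A B M N} f := by
    rw [← Category.assoc, Iso.eq_comp_inv]
    apply hom_ext
    rw [← cancel_epi (relProj (regular A) M)]
    simp
  comp_whiskerLeft {_ _ _ _} M N {O O'} g := by
    rw [← Category.assoc, Iso.eq_comp_inv]
    apply hom_ext
    rw [← cancel_epi (relProj _ O), ← cancel_epi (relProj M N ▷ O.X)]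
    simp only [comp_hom, relAssoc_hom, proj_assoc_assoc, proj_relWhiskerLeft_assoc, proj_relWhiskerLeft]
    rw [← whisker_exchange_assoc, proj_assoc, ← whiskerLeft_comp_assoc]
    simp
  id_whiskerRight M N := by
    apply hom_ext
    rw [← cancel_epi (relProj M N)]
    simp
  comp_whiskerRight {_ _ _ M _ _} f g N := by
    apply hom_ext
    rw [← cancel_epi (relProj M N)]
    simp
  whiskerRight_id {A B M N} f := by
    rw [← Category.assoc, Iso.eq_comp_inv]
    apply hom_ext
    rw [← cancel_epi (relProj M (regular B))]
    simp
  whiskerRight_comp {_ _ _ _ M M'} f N O := by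
    rw [Iso.eq_inv_comp]
    apply hom_ext
    rw [← cancel_epi (relProj _ O), ← cancel_epi (relProj M N ▷ O.X)]
    simp only [comp_hom, relAssoc_hom, proj_assoc_assoc, proj_relWhiskerRight_assoc, proj_relWhiskerRight]
    rw [← comp_whiskerRight_assoc, proj_relWhiskerRight, whisker_exchange_assoc,
      comp_whiskerRight_assoc, proj_assoc]
    simp
  whisker_assoc {_ _ _ _} M {N N'} g O := by
    rw [← Category.assoc, Iso.eq_comp_inv]
    apply hom_ext
    rw [← cancel_epi (relProj _ O), ← cancel_epi (relProj M N ▷ O.X)]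
    simp only [comp_hom, relAssoc_hom, proj_assoc_assoc, proj_relWhiskerRight_assoc,
      proj_relWhiskerLeft]
    rw [← comp_whiskerRight_assoc, proj_relWhiskerLeft, ← whiskerLeft_comp_assoc,
      comp_whiskerRight_assoc, proj_assoc, proj_relWhiskerRight]
    simp
  whisker_exchange {_ _ _ M M' N N'} f g := by
    apply hom_ext
    rw [← cancel_epi (relProj M N)]
    simp only [comp_hom, proj_relWhiskerLeft_assoc, proj_relWhiskerRight_assoc,
      proj_relWhiskerLeft, proj_relWhiskerRight]
    rw [whisker_exchange_assoc]
  pentagon M N O P := by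
    apply hom_ext
    rw [← cancel_epi (relProj _ P), ← cancel_epi (relProj _ O ▷ P.X),
      ← cancel_epi (relProj M N ▷ O.X ▷ P.X)]
    simp only [comp_hom, relAssoc_hom, proj_assoc_assoc, proj_relWhiskerRight_assoc]
    have h : relProj M N ▷ O.X ▷ P.X ≫ relProj (relTensor M N) O ▷ P.X ≫ 
        (relAssocHom M N O).hom ▷ P.X = 
        (α_ _ _ _).hom ▷ P.X ≫ (M.X ◁ relProj N O) ▷ P.X ≫ relProj M (relTensor N O) ▷ P.X := by
      simp only [← comp_whiskerRight, proj_assoc]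
    have h' : M.X ◁ relProj N O ▷ P.X ≫ M.X ◁ relProj (relTensor N O) P ≫
        M.X ◁ (relAssocHom N O P).hom = M.X ◁ (α_ _ _ _).hom ≫ M.X ◁ N.X ◁ relProj O P ≫
          M.X ◁ relProj N (relTensor O P) := by
      simp only [← whiskerLeft_comp, proj_assoc]
    rw [reassoc_of% h, proj_assoc_assoc, proj_relWhiskerLeft, associator_naturality_middle_assoc,
      reassoc_of% h']
    rw [associator_naturality_left_assoc, ← whisker_exchange_assoc, proj_assoc]
    simp
  triangle {A B C} M N := by
    apply hom_ext
    rw [← cancel_epi (relProj _ N), ← cancel_epi (relProj M (regular B) ▷ N.X)]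
    simp only [comp_hom, relAssoc_hom, proj_assoc_assoc, proj_relWhiskerRight,
      proj_relWhiskerLeft]
    rw [← whiskerLeft_comp_assoc, ← comp_whiskerRight_assoc, relLeftUnitor_hom,
      relRightUnitor_hom, proj_leftUnitor, proj_rightUnitor]
    have := congrArg (fun t => t ≫ relProj M N) (relIdem_balanced M N)
    simpa using this.symm


namespace DaggerBimod
variable {A B : SSFA T}

/-- The bimodule homomorphisms `M ⟶ N` as a subspace of the morphisms of `T`. -/
def homSubmodule (M N : DaggerBimod A B) : Submodule ℂ (M.X ⟶ N.X) where
  carrier := {f | M.actLeft ≫ f = A.X ◁ f ≫ N.actLeft ∧ M.actRight ≫ f = f ▷ B.X ≫ N.actRight}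
  zero_mem' := by simp
  add_mem' {f g} hf hg := by
    constructor
    · simp [hf.1, hg.1]
    · simp [hf.2, hg.2]
  smul_mem' c f hf := by
    constructor
    · simp [hf.1]
    · simp [hf.2]

/-- Bimodule homomorphisms are the elements of `homSubmodule`. -/
def homEquiv (M N : DaggerBimod A B) : (M ⟶ N) ≃ homSubmodule M N where
  toFun f := ⟨f.hom, f.left_act_hom, f.right_act_hom⟩
  invFun f := ⟨f.1, f.2.1, f.2.2⟩
  left_inv _ := rfl
  right_inv _ := rfl

instance : Preadditive (DaggerBimod A B) where
  homGroup M N := (homEquiv M N).addCommGroup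
  add_comp _ _ _ f f' g := hom_ext (Preadditive.add_comp _ _ _ f.hom f'.hom g.hom)
  comp_add _ _ _ f g g' := hom_ext (Preadditive.comp_add _ _ _ f.hom g.hom g'.hom)

instance : Linear ℂ (DaggerBimod A B) where
  homModule M N := (homEquiv M N).module ℂ
  smul_comp _ _ _ c f g := hom_ext (Linear.smul_comp _ _ _ c f.hom g.hom)
  comp_smul _ _ _ f c g := hom_ext (Linear.comp_smul _ _ _ f.hom c g.hom)

@[simp] theorem add_hom {M N : DaggerBimod A B} (f g : M ⟶ N) :
    Bimod.Hom.hom (f + g) = f.hom + g.hom := rfl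
@[simp] theorem neg_hom {M N : DaggerBimod A B} (f : M ⟶ N) :
    Bimod.Hom.hom (-f) = -f.hom := rfl
@[simp] theorem sub_hom {M N : DaggerBimod A B} (f g : M ⟶ N) :
    Bimod.Hom.hom (f - g) = f.hom - g.hom := rfl
@[simp] theorem zero_hom (M N : DaggerBimod A B) :
    Bimod.Hom.hom (0 : M ⟶ N) = 0 := rfl
@[simp] theorem smul_hom {M N : DaggerBimod A B} (c : ℂ) (f : M ⟶ N) :
    Bimod.Hom.hom (c • f) = c • f.hom := rfl

/-- The inclusion of the bimodule homomorphisms into the morphisms of `T`. -/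
def homLinear (M N : DaggerBimod A B) : (M ⟶ N) →ₗ[ℂ] (M.X ⟶ N.X) where
  toFun f := f.hom
  map_add' _ _ := rfl
  map_smul' _ _ := rfl

theorem finiteDimensional_hom (X Y : T) : FiniteDimensional ℂ (X ⟶ Y) := by
  obtain ⟨Z, i, hi, -⟩ :=
    (RigidCStarTensorCategory.semisimple (T := T)).exists_directSum ![X, Y]
  have := (RigidCStarTensorCategory.semisimple (T := T)).finite_end Z
  let i₀ : X ⟶ Z := i 0
  let i₁ : Y ⟶ Z := i 1
  have h₀ : i₀ ≫ i₀† = 𝟙 X := hi 0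
  have h₁ : i₁ ≫ i₁† = 𝟙 Y := hi 1
  refine FiniteDimensional.of_injective (V₂ := (Z ⟶ Z))
    ((Linear.leftComp ℂ Z i₀†).comp (Linear.rightComp ℂ X i₁)) ?_
  intro f g h
  have h' : i₀† ≫ f ≫ i₁ = i₀† ≫ g ≫ i₁ := h
  have := congrArg (fun t => i₀ ≫ t ≫ i₁†) h'
  simpa [h₁, reassoc_of% h₀] using this

instance (M N : DaggerBimod A B) : FiniteDimensional ℂ (M ⟶ N) :=
  have := finiteDimensional_hom M.X N.X
  FiniteDimensional.of_injective (homLinear M N) (fun _ _ h => hom_ext h)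

instance (M N : DaggerBimod A B) : Norm (M ⟶ N) := ⟨fun f => ‖f.hom‖⟩

theorem normCore (M N : DaggerBimod A B) : NormedSpace.Core ℂ (M ⟶ N) where
  norm_nonneg f := (CStarCategory.normCore M.X N.X).norm_nonneg f.hom
  norm_smul c f := (CStarCategory.normCore M.X N.X).norm_smul c f.hom
  norm_triangle f g := (CStarCategory.normCore M.X N.X).norm_triangle f.hom g.hom
  norm_eq_zero_iff f := ((CStarCategory.normCore M.X N.X).norm_eq_zero_iff f.hom).trans
    ⟨fun h => hom_ext h, fun h => congrArg Bimod.Hom.hom h⟩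

theorem isUnit_of_hom {M : DaggerBimod A B} (f : End M) (h : IsUnit (show End M.X from f.hom)) :
    IsUnit f := by
  obtain ⟨⟨_, g, h₁, h₂⟩, rfl⟩ := h
  have h₁ : g ≫ f.hom = 𝟙 M.X := h₁
  have h₂ : f.hom ≫ g = 𝟙 M.X := h₂
  let g' : M ⟶ M :=
    { hom := g
      left_act_hom := by
        have := congrArg (fun t => A.X ◁ g ≫ t ≫ g) f.left_act_hom
        simp only [Category.assoc, h₂, Category.comp_id, ← whiskerLeft_comp_assoc, h₁] at this
        simpa using this.symm
      right_act_hom := by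
        have := congrArg (fun t => g ▷ B.X ≫ t ≫ g) f.right_act_hom
        simp only [Category.assoc, h₂, Category.comp_id, ← comp_whiskerRight_assoc, h₁] at this
        simpa using this.symm }
  exact ⟨⟨f, g', hom_ext h₁, hom_ext h₂⟩, rfl⟩

/-- The norm and the dagger on bimodule homomorphisms are those of `T`. -/
noncomputable instance : CStarCategory (DaggerBimod A B) where
  dag f := dagHom f
  dag_dag f := hom_ext (CStarCategory.dag_dag f.hom)
  dag_comp f g := hom_ext (CStarCategory.dag_comp f.hom g.hom)
  dag_add f g := hom_ext (CStarCategory.dag_add f.hom g.hom)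
  dag_smul c f := hom_ext (CStarCategory.dag_smul c f.hom)
  homNorm M N := inferInstance
  normCore M N := normCore M N
  complete M N := by
    let _ := NormedAddCommGroup.ofCore (normCore M N)
    let _ : NormedSpace ℂ (M ⟶ N) := NormedSpace.ofCore (normCore M N)
    exact FiniteDimensional.complete ℂ (M ⟶ N)
  norm_comp_le f g := CStarCategory.norm_comp_le f.hom g.hom
  norm_comp_dag f := CStarCategory.norm_comp_dag f.hom
  spectrum_nonneg f z hz := CStarCategory.spectrum_nonneg f.hom z
    (fun h => hz (isUnit_of_hom _ h))

@[simp] theorem dag_hom {M N : DaggerBimod A B} (f : M ⟶ N) : Bimod.Hom.hom f† = f.hom† := rfl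

variable {D : SSFA T}

theorem relWhiskerLeft_add (M : DaggerBimod A B) {N N' : DaggerBimod B D} (f g : N ⟶ N') :
    relWhiskerLeft M (f + g) = relWhiskerLeft M f + relWhiskerLeft M g := by
  apply hom_ext
  rw [← cancel_epi (relProj M N)]
  simp

theorem relWhiskerLeft_smul (M : DaggerBimod A B) {N N' : DaggerBimod B D} (c : ℂ) (f : N ⟶ N') :
    relWhiskerLeft M (c • f) = c • relWhiskerLeft M f := by
  apply hom_ext
  rw [← cancel_epi (relProj M N)]
  simp

theorem add_relWhiskerRight {M M' : DaggerBimod A B} (f g : M ⟶ M') (N : DaggerBimod B D) :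
    relWhiskerRight (f + g) N = relWhiskerRight f N + relWhiskerRight g N := by
  apply hom_ext
  rw [← cancel_epi (relProj M N)]
  simp

theorem smul_relWhiskerRight {M M' : DaggerBimod A B} (c : ℂ) (f : M ⟶ M') (N : DaggerBimod B D) :
    relWhiskerRight (c • f) N = c • relWhiskerRight f N := by
  apply hom_ext
  rw [← cancel_epi (relProj M N)]
  simp

end DaggerBimod

/-- The C*-structure of the bicategory of dagger bimodules. -/
noncomputable instance : CStarBicategory (SSFA T) where
  homCStar A B := inferInstanceAs (CStarCategory (DaggerBimod A B))
  whiskerLeft_add M _ _ f g := relWhiskerLeft_add M f g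
  whiskerLeft_smul M _ _ c f := relWhiskerLeft_smul M c f
  add_whiskerRight f g N := add_relWhiskerRight f g N
  smul_whiskerRight c f N := smul_relWhiskerRight c f N
  dag_whiskerLeft M _ _ f := by
    apply hom_ext
    change ((inclHom _ _).hom ≫ M.X ◁ f.hom ≫ (projHom _ _).hom)† =
      (inclHom _ _).hom ≫ M.X ◁ f.hom† ≫ (projHom _ _).hom
    simp
  dag_whiskerRight f N := by
    apply hom_ext
    change ((inclHom _ _).hom ≫ f.hom ▷ N.X ≫ (projHom _ _).hom)† =
      (inclHom _ _).hom ≫ f.hom† ▷ N.X ≫ (projHom _ _).hom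
    simp
  dag_associator _ _ _ := rfl
  dag_leftUnitor _ := rfl
  dag_rightUnitor _ := rfl

variable (T) in
/-- `Bimod(T)`: the C*-2-category of separable standard Frobenius algebras, dagger bimodules and
bimodule homomorphisms in `T`. -/
abbrev BimodTwoCat := SSFA T

end RigidCStarTensor

section TwoCat
open Bicategory

variable {B : Type u} [Bicategory.{w, v} B] [CStarBicategory B]

/-- `End z` is (equivalent to) the terminal category. -/
def IsZeroObject (z : B) : Prop := Nonempty ((z ⟶ z) ≌ Discrete PUnit.{1})

/-- `R` is a direct sum of the objects `r k`, with inclusions `ι k : r k ⟶ R` and projections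
`ρ k : R ⟶ r k`: `ι k ⊗ ρ k` is unitarily isomorphic to the identity, `ι k ⊗ ρ l` is zero for
`k ≠ l`, and `id_R` is a direct sum of the `ρ k ⊗ ι k`. -/
def IsObjectDirectSum {ι : Type} [Fintype ι] (r : ι → B) (R : B) : Prop :=
  ∃ (inc : ∀ k, r k ⟶ R) (pr : ∀ k, R ⟶ r k),
    (∀ k, ∃ u : inc k ≫ pr k ⟶ 𝟙 (r k), IsUnitary u) ∧
    (∀ k l, k ≠ l → Limits.IsZero (inc k ≫ pr l)) ∧
    IsDirectSum (fun k => pr k ≫ inc k) (𝟙 R)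

variable (B) in
/-- A C*-2-category is presemisimple if it is locally semisimple, rigid (every 1-morphism `X` has a
right dual `Y`, with cup `id ⟶ Y ⊗ X` and cap `X ⊗ Y ⟶ id`), additive, and every object is a
finite direct sum of objects with simple identity 1-morphism. -/
structure IsPresemisimple : Prop where
  locally_semisimple (r s : B) : IsSemisimpleCStar (r ⟶ s)
  rigid {r s : B} (X : r ⟶ s) : ∃ Y : s ⟶ r, Nonempty (Y ⊣ X)
  exists_zero : ∃ z : B, IsZeroObject z
  exists_directSum (r : Fin 2 → B) : ∃ R : B, IsObjectDirectSum r R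
  decomposition (R : B) : ∃ (n : ℕ) (r : Fin n → B),
    (∀ k, IsSimpleObj (𝟙 (r k))) ∧ IsObjectDirectSum r R

variable {r s : B} {X : r ⟶ s} {Y : s ⟶ r}

/-- The right dual `Y` of `X`, with cup `η = d.unit` and cap `ε = d.counit`, is standard: for all
`f ∈ End X`, the trace of `η† ∘ (id ⊗ f) ∘ η` equals the trace of `ε ∘ (f ⊗ id) ∘ ε†`. -/
def IsStandardDual (d : Y ⊣ X) : Prop :=
  ∀ f : X ⟶ X, endTrace (𝟙 s) (d.unit ≫ Y ◁ f ≫ d.unit†) =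
    endTrace (𝟙 r) (d.counit† ≫ f ▷ Y ≫ d.counit)

/-- The left dimension `η† ∘ η` of `X`, for `d` a standard dual. -/
def leftDim (d : Y ⊣ X) : 𝟙 s ⟶ 𝟙 s := d.unit ≫ d.unit†

/-- The multiplication `id_X ⊗ (nInv ∘ η†) ⊗ id_Y` on `X ⊗ Y`. -/
def pantsMul (d : Y ⊣ X) (nInv : 𝟙 s ⟶ 𝟙 s) : (X ≫ Y) ≫ (X ≫ Y) ⟶ X ≫ Y :=
  (α_ X Y (X ≫ Y)).hom ≫ X ◁ ((α_ Y X Y).inv ≫ (d.unit† ≫ nInv) ▷ Y ≫ (λ_ Y).hom)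

/-- The unit `(id_X ⊗ n ⊗ id_Y) ∘ ε†` on `X ⊗ Y`. -/
def pantsUnit (d : Y ⊣ X) (n : 𝟙 s ⟶ 𝟙 s) : 𝟙 r ⟶ X ≫ Y :=
  d.counit† ≫ X ◁ ((λ_ Y).inv ≫ n ▷ Y ≫ (λ_ Y).hom)

/-- The endomorphisms of an object of a C*-2-category form a C*-tensor category. -/
instance (r : B) : CStarTensorCategory (r ⟶ r) where
  whiskerLeft_add f g := CStarBicategory.whiskerLeft_add _ f g
  whiskerLeft_zero {X Y Z} := by
    have := CStarBicategory.whiskerLeft_smul X (0 : ℂ) (0 : Y ⟶ Z)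
    rw [zero_smul, zero_smul] at this
    exact this
  add_whiskerRight f g := CStarBicategory.add_whiskerRight f g _
  zero_whiskerRight {X Y Z} := by
    have := CStarBicategory.smul_whiskerRight (0 : ℂ) (0 : Y ⟶ Z) X
    rw [zero_smul, zero_smul] at this
    exact this
  whiskerLeft_smul X _ _ z f := CStarBicategory.whiskerLeft_smul X z f
  smul_whiskerRight z _ _ f X := CStarBicategory.smul_whiskerRight z f X
  dag_whiskerLeft X _ _ f := CStarBicategory.dag_whiskerLeft X f
  dag_whiskerRight f X := CStarBicategory.dag_whiskerRight f X
  dag_associator X Y Z := CStarBicategory.dag_associator X Y Z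
  dag_leftUnitor X := CStarBicategory.dag_leftUnitor X
  dag_rightUnitor X := CStarBicategory.dag_rightUnitor X

/-- A separable standard Frobenius algebra `A` in `End r` splits: there are a 1-morphism `X : r ⟶ s`
with a standard right dual `Y`, that is separable (its left dimension is invertible, with positive
square root `n`), and a unitary `*`-isomorphism from `A` to the pair of pants algebra `X ⊗ Y`. -/
def SSFA.Splits {r : B} (A : SSFA (r ⟶ r)) : Prop :=
  ∃ (s : B) (X : r ⟶ s) (Y : s ⟶ r) (d : Y ⊣ X) (n nInv : 𝟙 s ⟶ 𝟙 s),
    IsStandardDual d ∧ IsIso (leftDim d) ∧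
    IsPositive n ∧ n ≫ n = leftDim d ∧ n ≫ nInv = 𝟙 (𝟙 s) ∧ nInv ≫ n = 𝟙 (𝟙 s) ∧
    ∃ f : A.X ⟶ X ≫ Y, IsUnitary f ∧
      IsStarHom (T := (r ⟶ r)) (B := X ≫ Y) MonObj.mul MonObj.one
        (pantsMul d nInv) (pantsUnit d n) f

variable (B) in
/-- A presemisimple C*-2-category is semisimple if every separable standard Frobenius algebra in
every endomorphism category splits. -/
structure IsSemisimpleTwoCat : Prop extends IsPresemisimple B where
  splits {r : B} (A : SSFA (r ⟶ r)) : A.Splits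

end TwoCat

/-! Presemisimplicity is inherited from `T`. Actions can be carried along isometries, so zero
objects, direct sums and splittings of projections pass from `T` to every category of bimodules
(`DaggerBimod.isSemisimple`). A zero object of `T` carries the zero algebra, and algebras are added
componentwise. The endomorphisms of `regular R` form a finite-dimensional commutative C*-algebra,
spanned by orthogonal projections; cutting `R` along them gives the summands with simple identity
(`SSFA.exists_decomposition`, `isObjectDirectSum_of_isometries`).

For rigidity, an algebra `A`, viewed as a module over itself, is adjoint on both sides to its mirror
image: the multiplication is the counit of one adjunction, its adjoint the unit of the other. By
separability the regular bimodule embeds isometrically in `A ⊗ A`, so every bimodule is a retract of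
a free one `A ⊗ M ⊗ B`, a composite of 1-morphisms with left adjoints whose middle part is dualized
in `T`. Retracts inherit adjoints because the mate of an idempotent is an idempotent; it need not be
self-adjoint, and is split by way of Kaplansky's formula (`CStarCategory.exists_splitting_of_idem`).

For splitting, let `P` be the bimodule underlying an SSFA in `End R`. Composing with `P ⊗ P → P ⊗_R
P` gives a separable Frobenius algebra `(P, m, u)` in `T`, and the natural splitting is `P` itself,
as an `R`-`P`-bimodule `X` and a `P`-`R`-bimodule `Y`. The obstacle is standardness: it is tested by
the trace of `End (regular R)` in one place and by the trace of `End (𝟙_ T)`, evaluated on the unit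
of `R`, in the other. The two differ by a positive weight `g⁴` in the center of `R`. Hence `m` is
replaced by `m'`, which sends `x ⊗ y` to `k (x g y)`, where the central `k` restores separability.
The powers of `g` then balance, and `(P, m')` is an SSFA in `T` (`isFrobAlg_twist`,
`IsRelAlg.isStandardCup_twist`).

The multiplications `m` and `m'` associate and satisfy the Frobenius equation with each other
(`isCompatible_twist`). So `X` and `Y` are modules over the twisted algebra, `m'` identifies `X ⊗ Y`
with `P` unitarily, and `n ≫ m†` with `m' ≫ n⁻¹ ≫ u†` is a duality for any suitable self-adjoint
central `n`. A second weight, on the center of the twisted algebra, determines a positive `n` that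
makes this duality standard (`trace_twist`, `IsRelAlg.isStandardDual`). Since `m†` is isometric, the
left dimension is `n²`; the normalizing factors of the pair of pants algebra then cancel those of
the duality and give back `m` and `u`. -/

namespace CStarCategory
variable {C : Type u} [Category.{v} C] [CStarCategory C]

/-! ### Functional calculus, idempotents and traces in C*-categories -/

/-- The C*-algebra `End X`. -/
@[reducible] noncomputable def endCStarAlgebra (X : C) : CStarAlgebra (End X) :=
  letI g : NormedAddCommGroup (X ⟶ X) := NormedAddCommGroup.ofCore (normCore X X)
  letI s : NormedSpace ℂ (X ⟶ X) := NormedSpace.ofCore (normCore X X)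
  letI r : NormedRing (End X) :=
    { (inferInstance : Ring (End X)), g with
      dist_eq := g.dist_eq
      norm_mul_le := fun a b => (norm_comp_le b a).trans (mul_comm _ _).le }
  letI a : NormedAlgebra ℂ (End X) :=
    { (inferInstance : Algebra ℂ (End X)) with
      norm_smul_le := s.norm_smul_le }
  letI st : StarRing (End X) :=
    { star := fun f => dag f
      star_involutive := dag_dag
      star_mul := fun f g => dag_comp g f
      star_add := dag_add }
  letI c : CompleteSpace (End X) := complete X X
  { r, a, st, c with
    norm_mul_self_le := fun f => by
      change ‖(show X ⟶ X from f)‖ * ‖(show X ⟶ X from f)‖ ≤ ‖(show X ⟶ X from f) ≫ dag f‖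
      rw [norm_comp_dag, sq]
    star_smul := dag_smul }

/-- By finite dimension the element is algebraic, and its spectrum lies among the roots of an
annihilating polynomial. -/
theorem finite_spectrum {A : Type*} [Ring A] [Algebra ℝ A] [FiniteDimensional ℝ A] (a : A) :
    (spectrum ℝ a).Finite := by
  obtain ⟨p, hp, hpa⟩ := Algebra.IsAlgebraic.isAlgebraic (R := ℝ) a
  refine (p.rootSet_finite ℝ).subset fun x hx => ?_
  have := spectrum.subset_polynomial_aeval a p ⟨x, hx, rfl⟩
  rw [Polynomial.mem_rootSet]
  refine ⟨hp, ?_⟩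
  by_contra h
  rw [hpa, spectrum.mem_iff, sub_zero] at this
  exact this ((IsUnit.mk0 _ (by simpa using h)).map (algebraMap ℝ A))

/-- On a finite spectrum the functional calculus is polynomial. Membership in the generated algebra
lets properties of `f ≫ f†` that define a subalgebra, such as centrality, pass to its inverse square
root. -/
theorem exists_invSqrt_mem_adjoin {X Y : C} [FiniteDimensional ℂ (X ⟶ X)] (f : X ⟶ Y)
    [IsIso (f ≫ f†)] :
    ∃ k : X ⟶ X, k† = k ∧ k ≫ k ≫ f ≫ f† = 𝟙 X ∧
      (show End X from k) ∈ Algebra.adjoin ℂ {(show End X from f ≫ f†)} := by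
  let _ := endCStarAlgebra X
  set z : End X := (f ≫ f†) with hz
  have : FiniteDimensional ℂ (End X) := ‹FiniteDimensional ℂ (X ⟶ X)›
  have : FiniteDimensional ℝ (End X) := FiniteDimensional.trans ℝ ℂ (End X)
  have hsa : IsSelfAdjoint z := by
    change (f ≫ f†)† = f ≫ f†
    simp
  have hpos : ∀ x ∈ spectrum ℝ z, 0 < x := by
    intro x hx
    have h1 := CStarCategory.spectrum_nonneg f x (by
      have := (spectrum.algebraMap_mem_iff ℂ (r := x) (a := z)).2 hx
      exact this)
    refine lt_of_le_of_ne (by simpa using h1.1) ?_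
    rintro rfl
    have : IsUnit z := (isUnit_iff_isIso (f ≫ f†)).2 inferInstance
    exact (spectrum.zero_notMem_iff ℝ).2 this hx
  have hfin := finite_spectrum z
  -- Interpolates `x ↦ x^(-1/2)` on the spectrum, which consists of positive numbers.
  let q : Polynomial ℝ := Lagrange.interpolate hfin.toFinset id (fun x => (Real.sqrt x)⁻¹)
  have hq : ∀ x ∈ spectrum ℝ z, q.eval x = (Real.sqrt x)⁻¹ := fun x hx =>
    Lagrange.eval_interpolate_at_node (v := id) _ (Set.injOn_id _) (hfin.mem_toFinset.2 hx)
  let k : End X := Polynomial.aeval z q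
  have hk : k = cfc (fun x => q.eval x) z := (cfc_polynomial q z hsa).symm
  have hkz : k * k * z = 1 := by
    have : k * k * z = Polynomial.aeval z (q * q * Polynomial.X) := by simp [k]
    rw [this, ← cfc_polynomial _ z hsa, ← cfc_one ℝ z hsa]
    refine cfc_congr fun x hx => ?_
    have := hpos x hx
    simp only [Polynomial.eval_mul, Polynomial.eval_X, hq x hx, Pi.one_apply]
    rw [← mul_inv, Real.mul_self_sqrt this.le, inv_mul_cancel₀ this.ne']
  have hmem : k ∈ Algebra.adjoin ℂ {z} := by
    have h1 : k ∈ Algebra.adjoin ℝ {z} := Polynomial.aeval_mem_adjoin_singleton ℝ z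
    have h2 : Algebra.adjoin ℝ {z} ≤ (Algebra.adjoin ℂ {z}).restrictScalars ℝ :=
      Algebra.adjoin_le (by simp)
    exact h2 h1
  have hcomm : k * z = z * k := by
    have := congrArg (Polynomial.aeval z) (mul_comm q Polynomial.X)
    rwa [map_mul, map_mul, Polynomial.aeval_X] at this
  refine ⟨k, ?_, ?_, hmem⟩
  · have : IsSelfAdjoint k := hk ▸ cfc_predicate _ _
    exact this
  · have h : z * k * k = 1 := by rw [← hkz, ← hcomm, mul_assoc, ← hcomm, mul_assoc]
    exact h

theorem isUnit_one_add {X Y : C} (f : X ⟶ Y) : IsIso (𝟙 X + f ≫ f†) := by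
  have h : (-1 : ℂ) ∉ spectrum ℂ (show End X from f ≫ f†) := fun h => by
    have := (spectrum_nonneg f (-1) h).1
    norm_num at this
  rw [spectrum.notMem_iff] at h
  have h2 := (isUnit_iff_isIso (X := X) _).1 h.neg
  convert h2 using 1
  rw [map_neg, map_one, neg_sub, sub_neg_eq_add]
  exact add_comm (𝟙 X) (f ≫ f†)

/-- Kaplansky's formula for a projection with the same range as an idempotent `q`; in the
application `q'` is the adjoint of `q`. The element `w = 1 + (q - q') (q' - q)` satisfies `q w = q
q' q = w q` and similarly for `q'`, so its inverse `z` commutes with both. The last equation gives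
self-adjointness of `q q' z` once `z` is self-adjoint. -/
theorem kaplansky {R : Type*} [Ring R] (q q' z : R) (hq : q * q = q) (hq' : q' * q' = q')
    (hz : z * (1 + (q - q') * (q' - q)) = 1) (hz' : (1 + (q - q') * (q' - q)) * z = 1) :
    (q * q' * z) * q = q ∧ q * (q * q' * z) = q * q' * z ∧ 
      (q * q' * z) * (q * q' * z) = q * q' * z ∧ z * (q * q') = (q * q') * z := by
  have hw : 1 + (q - q') * (q' - q) = 1 + q * q' - q - q' + q' * q := by
    calc _ = 1 + q * q' - q * q - q' * q' + q' * q := by noncomm_ring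
      _ = _ := by rw [hq, hq']
  rw [hw] at hz hz'
  set w := 1 + q * q' - q - q' + q' * q with hw'
  have h1 : q * w = q * q' * q := by
    calc _ = q + (q * q) * q' - q * q - q * q' + q * q' * q := by rw [hw']; noncomm_ring
      _ = _ := by rw [hq]; abel
  have h2 : w * q = q * q' * q := by
    calc _ = q + q * q' * q - q * q - q' * q + q' * (q * q) := by rw [hw']; noncomm_ring
      _ = _ := by rw [hq]; abel
  have h3 : q' * w = q' * q * q' := by
    calc _ = q' + q' * q * q' - q' * q - q' * q' + q' * q' * q := by rw [hw']; noncomm_ring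
      _ = _ := by rw [hq']; abel
  have h4 : w * q' = q' * q * q' := by
    calc _ = q' + q * (q' * q') - q * q' - q' * q' + q' * q * q' := by rw [hw']; noncomm_ring
      _ = _ := by rw [hq']; abel
  have c1 : z * q = q * z := by
    calc z * q = z * (q * w) * z := by rw [mul_assoc, mul_assoc, hz', mul_one]
      _ = q * z := by rw [h1, ← h2, ← mul_assoc, hz, one_mul]
  have c2 : z * q' = q' * z := by
    calc z * q' = z * (q' * w) * z := by rw [mul_assoc, mul_assoc, hz', mul_one]
      _ = q' * z := by rw [h3, ← h4, ← mul_assoc, hz, one_mul]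
  have c3 : z * (q * q') = (q * q') * z := by rw [← mul_assoc, c1, mul_assoc, c2, mul_assoc]
  have a1 : (q * q' * z) * q = q := by
    rw [mul_assoc, c1, ← mul_assoc, ← h1, mul_assoc, hz', mul_one]
  refine ⟨a1, by rw [← mul_assoc, ← mul_assoc, hq], ?_, c3⟩
  rw [← mul_assoc, ← mul_assoc, a1]

/-- Semisimplicity only splits self-adjoint idempotents. A splitting of the projection with the same
range as `q` also splits `q`. -/
theorem exists_splitting_of_idem (hC : IsSemisimpleCStar C) {X : C} (q : X ⟶ X) (hq : q ≫ q = q) :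
    ∃ (V : C) (a : X ⟶ V) (b : V ⟶ X), a ≫ b = q ∧ b ≫ a = 𝟙 V := by
  have hq' : q† ≫ q† = q† := by rw [← dag_comp, hq]
  have hsub : ∀ f g : X ⟶ X, (f - g)† = f† - g† := fun f g => by
    rw [eq_sub_iff_add_eq, ← dag_add, sub_add_cancel]
  have := isUnit_one_add (q† - q)
  rw [hsub, dag_dag] at this
  let z := inv (𝟙 X + (q† - q) ≫ (q - q†))
  obtain ⟨h1, h2, h3, h4⟩ := kaplansky (R := End X) q q† z hq hq'
    (IsIso.hom_inv_id (𝟙 X + (q† - q) ≫ (q - q†))) (IsIso.inv_hom_id (𝟙 X + (q† - q) ≫ (q - q†)))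
  -- Multiplication in `End X` is composition in the opposite order, so the projection `q q† z`
  -- reads `z ≫ q† ≫ q`.
  have h1 : q ≫ z ≫ q† ≫ q = q := h1
  have h2 : (z ≫ q† ≫ q) ≫ q = z ≫ q† ≫ q := h2
  have h3 : (z ≫ q† ≫ q) ≫ (z ≫ q† ≫ q) = z ≫ q† ≫ q := h3
  have h4 : (q† ≫ q) ≫ z = z ≫ q† ≫ q := h4
  have hzd : z† = z := by
    have : (𝟙 X + (q† - q) ≫ (q - q†))† = 𝟙 X + (q† - q) ≫ (q - q†) := by
      rw [dag_add, dag_comp, hsub, hsub, dag_dag, dag_id]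
    have h5 := congrArg dag (IsIso.hom_inv_id (𝟙 X + (q† - q) ≫ (q - q†)))
    rw [dag_comp, this, dag_id] at h5
    exact (IsIso.eq_inv_of_inv_hom_id h5)
  obtain ⟨V, i, hi, hip⟩ := hC.exists_splitting (z ≫ q† ≫ q)
    (by rw [dag_comp, dag_comp, dag_dag, hzd, h4]) h3
  have hi : i ≫ i† = 𝟙 V := hi
  refine ⟨V, q ≫ i†, i, by rw [Category.assoc, hip, h1], ?_⟩
  have h6 : i ≫ q = i := by
    calc i ≫ q = i ≫ (i† ≫ i) ≫ q := by rw [Category.assoc, ← Category.assoc, hi, Category.id_comp]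
      _ = _ := by rw [hip, h2, ← hip, ← Category.assoc, hi, Category.id_comp]
  rw [← Category.assoc, h6, hi]

/-- A finite-dimensional commutative endomorphism algebra is spanned by orthogonal projections. -/
theorem exists_projections {X : C} [FiniteDimensional ℂ (X ⟶ X)]
    (hcomm : ∀ f g : X ⟶ X, f ≫ g = g ≫ f) :
    ∃ (n : ℕ) (p : Fin n → (X ⟶ X)), (∀ i, (p i)† = p i) ∧ (∀ i, p i ≠ 0) ∧
      (∀ i, p i ≫ p i = p i) ∧ (∀ i j, i ≠ j → p i ≫ p j = 0) ∧ ∑ i, p i = 𝟙 X ∧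
      ∀ f : X ⟶ X, ∃ c : Fin n → ℂ, f = ∑ i, c i • p i := by
  let _ : CommCStarAlgebra (End X) :=
    { endCStarAlgebra X with mul_comm := fun f g => hcomm g f }
  have : FiniteDimensional ℂ (End X) := ‹FiniteDimensional ℂ (X ⟶ X)›
  let K := WeakDual.characterSpace ℂ (End X)
  have hinj : Function.Injective (fun (φ : K) => ((φ : End X →ₐ[ℂ] ℂ) : End X →* ℂ)) := by
    intro φ ψ h
    ext a
    exact DFunLike.congr_fun h a
  -- Distinct characters are linearly independent functionals, so there are finitely many. The
  -- Gelfand transform then identifies `End X` with all functions on a finite discrete space, and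
  -- the indicators of points pull back to the projections.
  have hfin : Finite K := by
    have h1 := (linearIndependent_monoidHom (End X) ℂ).comp _ hinj
    let L : K → Module.Dual ℂ (End X) := fun φ => (φ : End X →ₐ[ℂ] ℂ).toLinearMap
    have h2 : LinearIndependent ℂ L := by
      refine LinearIndependent.of_comp (M' := End X → ℂ)
        { toFun := fun l a => l a, map_add' := fun _ _ => rfl, map_smul' := fun _ _ => rfl } ?_
      exact h1
    exact h2.finite
  let _ := Fintype.ofFinite K
  classical
  let G := gelfandStarTransform (End X)
  have hG : ∀ a b : End X, G a = G b → a = b := fun a b h => G.injective h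
  let e : K → C(K, ℂ) := fun φ => ⟨fun ψ => if ψ = φ then 1 else 0, continuous_of_discreteTopology⟩
  let P : K → End X := fun φ => G.symm (e φ)
  have hGP : ∀ φ, G (P φ) = e φ := fun φ => G.apply_symm_apply _
  have hexp : ∀ f : C(K, ℂ), f = ∑ φ, f φ • e φ := by
    intro f
    ext ψ
    simp [e, ContinuousMap.sum_apply]
  let σ := (Fintype.equivFin K).symm
  refine ⟨Fintype.card K, fun i => P (σ i), fun i => ?_, fun i h => ?_, fun i => ?_,
    fun i j hij => ?_, ?_, fun f => ⟨fun i => G f (σ i), ?_⟩⟩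
  · change star (P (σ i)) = _
    apply hG
    rw [map_star, hGP]
    ext ψ
    simp [e, apply_ite]
  · have h1 : G (P (σ i)) = 0 := by
      have h' : P (σ i) = 0 := h
      rw [h', map_zero]
    rw [hGP] at h1
    simpa [e] using DFunLike.congr_fun h1 (σ i)
  · change P (σ i) * P (σ i) = _
    apply hG
    rw [map_mul, hGP]
    ext ψ
    simp [e]
  · change P (σ j) * P (σ i) = 0
    apply hG
    rw [map_mul, hGP, hGP, map_zero]
    ext ψ
    by_cases h : ψ = σ j
    · have : σ j ≠ σ i := fun h => hij (σ.injective h.symm)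
      simp [e, h, this]
    · simp [e, h]
  · change ∑ i, P (σ i) = 1
    rw [σ.sum_comp P]
    apply hG
    rw [map_sum, map_one, hexp 1]
    exact Finset.sum_congr rfl fun φ _ => by rw [hGP, ContinuousMap.one_apply, one_smul]
  · change f = ∑ i, (fun φ => (G f φ) • P φ) (σ i)
    rw [σ.sum_comp (fun φ => (G f φ) • P φ)]
    apply hG
    rw [map_sum]
    refine (hexp (G f)).trans (Finset.sum_congr rfl fun φ _ => ?_)
    rw [← hGP]
    exact (map_smul G _ _).symm

theorem endTrace_add (X : C) (f g : X ⟶ X) : endTrace X (f + g) = endTrace X f + endTrace X g := by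
  rw [endTrace, endTrace, endTrace, ← map_add]
  congr 1
  ext
  simp

theorem endTrace_smul (X : C) (c : ℂ) (f : X ⟶ X) : endTrace X (c • f) = c • endTrace X f := by
  rw [endTrace, endTrace, ← map_smul]
  congr 1
  ext
  simp

/-- `endTrace` as a linear functional. -/
noncomputable def endTraceLinear (X : C) : (X ⟶ X) →ₗ[ℂ] ℂ where
  toFun := endTrace X
  map_add' := endTrace_add X
  map_smul' := endTrace_smul X

theorem endTrace_sum_smul {X : C} [FiniteDimensional ℂ (X ⟶ X)] {n : ℕ} {p : Fin n → (X ⟶ X)}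
    (hp : ∀ i, p i ≫ p i = p i) (h0 : ∀ i, p i ≠ 0) (ho : ∀ i j, i ≠ j → p i ≫ p j = 0)
    (hs : ∀ f : X ⟶ X, ∃ c : Fin n → ℂ, f = ∑ i, c i • p i) (c : Fin n → ℂ) :
    endTrace X (∑ i, c i • p i) = ∑ i, c i := by
  change endTraceLinear X _ = _
  rw [map_sum]
  refine Finset.sum_congr rfl fun i _ => ?_
  rw [map_smul]
  change c i • endTrace X (p i) = _
  rw [endTrace_minimal (p i) (hp i) (h0 i), smul_eq_mul, mul_one]
  intro f
  obtain ⟨d, rfl⟩ := hs f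
  refine ⟨d i, ?_⟩
  rw [Preadditive.comp_sum, Finset.sum_eq_single i]
  · rw [Linear.comp_smul, hp]
  · intro j _ hj
    rw [Linear.comp_smul, ho i j hj.symm, smul_zero]
  · simp

/-- A functional that is positive on nonzero projections is `endTrace` weighted by a fourth power. -/
theorem exists_weight {X : C} [FiniteDimensional ℂ (X ⟶ X)]
    (hcomm : ∀ f g : X ⟶ X, f ≫ g = g ≫ f) (τ : (X ⟶ X) →ₗ[ℂ] ℂ)
    (hτ : ∀ p : X ⟶ X, p† = p → p ≫ p = p → p ≠ 0 → ∃ r : ℝ, 0 < r ∧ τ p = r) :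
    ∃ g : X ⟶ X, IsPositive g ∧ g† = g ∧ IsIso g ∧
      ∀ z, τ z = endTrace X (g ≫ g ≫ g ≫ g ≫ z) := by
  obtain ⟨n, p, hd, h0, hp, ho, h1, hs⟩ := exists_projections hcomm
  choose r hr hτr using fun i => hτ (p i) (hd i) (hp i) (h0 i)
  have hmul : ∀ (c d : Fin n → ℂ), (∑ i, c i • p i) ≫ (∑ i, d i • p i) = ∑ i, (c i * d i) • p i := by
    intro c d
    rw [Preadditive.sum_comp]
    refine Finset.sum_congr rfl fun i _ => ?_
    rw [Preadditive.comp_sum, Finset.sum_eq_single i]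
    · rw [Linear.smul_comp, Linear.comp_smul, hp, smul_smul]
    · intro j _ hj
      rw [Linear.smul_comp, Linear.comp_smul, ho i j hj.symm, smul_zero, smul_zero]
    · simp
  have hdag : ∀ c : Fin n → ℝ, (∑ i, (c i : ℂ) • p i)† = ∑ i, (c i : ℂ) • p i := by
    intro c
    let D : (X ⟶ X) →+ (X ⟶ X) := ⟨⟨dag, by simpa using dag_smul (0 : ℂ) (0 : X ⟶ X)⟩, dag_add⟩
    change D _ = _
    rw [map_sum]
    refine Finset.sum_congr rfl fun i _ => ?_
    change dag _ = _
    rw [dag_smul, hd, Complex.conj_ofReal]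
  have htr : ∀ c : Fin n → ℂ, endTrace X (∑ i, c i • p i) = ∑ i, c i :=
    endTrace_sum_smul hp h0 ho hs
  -- The fourth root is what the twist needs: there two of the four powers are cancelled on one
  -- side, and two powers appear on the other.
  let c : Fin n → ℝ := fun i => (r i) ^ (1 / 4 : ℝ)
  have hc : ∀ i, 0 < c i := fun i => Real.rpow_pos_of_pos (hr i) _
  have hc4 : ∀ i, (c i) * (c i * (c i * c i)) = r i := fun i => by
    have : (c i) ^ (4 : ℕ) = r i := by
      rw [← Real.rpow_natCast, ← Real.rpow_mul (hr i).le]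
      norm_num
    rw [← this]; ring
  refine ⟨∑ i, (c i : ℂ) • p i, ⟨X, ∑ i, (Real.sqrt (c i) : ℂ) • p i, ?_⟩, hdag c,
    ⟨∑ i, ((c i)⁻¹ : ℂ) • p i, ?_, ?_⟩, fun z => ?_⟩
  · rw [hdag fun i => Real.sqrt (c i), hmul]
    refine Finset.sum_congr rfl fun i _ => ?_
    rw [← Complex.ofReal_mul, Real.mul_self_sqrt (hc i).le]
  · rw [hmul, ← h1]
    refine Finset.sum_congr rfl fun i _ => ?_
    rw [mul_inv_cancel₀ (by exact_mod_cast (hc i).ne'), one_smul]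
  · rw [hmul, ← h1]
    refine Finset.sum_congr rfl fun i _ => ?_
    rw [inv_mul_cancel₀ (by exact_mod_cast (hc i).ne'), one_smul]
  · obtain ⟨d, rfl⟩ := hs z
    rw [hmul, hmul, hmul, hmul, htr, map_sum]
    refine Finset.sum_congr rfl fun i _ => ?_
    rw [map_smul, hτr, ← hc4, smul_eq_mul]
    push_cast
    ring

/-- The coefficients of `f ≫ f†` with respect to the orthogonal projections lie in its spectrum,
hence are nonnegative; by the C*-identity they are not all zero. -/
theorem endTrace_pos {X Y : C} [FiniteDimensional ℂ (X ⟶ X)]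
    (hcomm : ∀ f g : X ⟶ X, f ≫ g = g ≫ f) (f : X ⟶ Y) (hf : f ≠ 0) :
    ∃ r : ℝ, 0 < r ∧ endTrace X (f ≫ f†) = r := by
  obtain ⟨n, p, hd, h0, hp, ho, h1, hs⟩ := exists_projections hcomm
  obtain ⟨c, hc⟩ := hs (f ≫ f†)
  have hpf : ∀ i, p i ≫ f ≫ f† = c i • p i := by
    intro i
    rw [hc, Preadditive.comp_sum, Finset.sum_eq_single i]
    · rw [Linear.comp_smul, hp]
    · intro j _ hj
      rw [Linear.comp_smul, ho i j hj.symm, smul_zero]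
    · simp
  have hspec : ∀ i, 0 ≤ (c i).re ∧ (c i).im = 0 := by
    intro i
    refine spectrum_nonneg f (c i) ?_
    rw [spectrum.mem_iff]
    rintro ⟨⟨_, g, h2, h3⟩, rfl⟩
    have h4 : (algebraMap ℂ (End X) (c i) - (show End X from f ≫ f†)) * (show End X from p i) = 0 := by
      rw [sub_mul, Algebra.algebraMap_eq_smul_one, smul_mul_assoc, one_mul, sub_eq_zero]
      exact (hpf i).symm
    have h5 : (show End X from p i) = g * ((algebraMap ℂ (End X) (c i) -
        (show End X from f ≫ f†)) * (show End X from p i)) := by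
      rw [← mul_assoc, h3, one_mul]
    rw [h4, mul_zero] at h5
    exact h0 i h5
  have hre : ∀ i, c i = ((c i).re : ℂ) := fun i => Complex.ext rfl (by simp [(hspec i).2])
  have htr : endTrace X (f ≫ f†) = ∑ i, c i := by
    rw [hc, endTrace_sum_smul hp h0 ho hs]
  refine ⟨∑ i, (c i).re, ?_, ?_⟩
  · refine lt_of_le_of_ne (Finset.sum_nonneg fun i _ => (hspec i).1) fun h => hf ?_
    have h2 := (Finset.sum_eq_zero_iff_of_nonneg fun i _ => (hspec i).1).1 h.symm
    have h3 : f ≫ f† = 0 := by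
      rw [hc]
      refine Finset.sum_eq_zero fun i hi => ?_
      rw [hre, h2 i hi, Complex.ofReal_zero, zero_smul]
    have h4 := norm_comp_dag f
    rw [h3, (normCore X X).norm_eq_zero_iff 0 |>.2 rfl] at h4
    exact ((normCore X Y).norm_eq_zero_iff f).1 (pow_eq_zero_iff two_ne_zero |>.1 h4.symm)
  · rw [htr]
    push_cast
    exact Finset.sum_congr rfl fun i _ => hre i

end CStarCategory

/-! ### Semisimplicity of the categories of bimodules -/

section
open MonoidalCategory MonObj
variable {T : Type u} [Category.{v} T] [MonoidalCategory T] [RigidCStarTensorCategory T]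

namespace DaggerBimod
variable {A B C D : SSFA T}

theorem isZero_of_id {M : DaggerBimod A B} (h : 𝟙 M.X = 0) : Limits.IsZero M :=
  (Limits.IsZero.iff_id_eq_zero M).2 (hom_ext h)

/-- The zero bimodule. -/
abbrev zeroBimod (A B : SSFA T) {Z : T} (hZ : Limits.IsZero Z) : DaggerBimod A B where
  X := Z
  actLeft := 0
  one_actLeft := hZ.eq_of_tgt _ _
  left_assoc := hZ.eq_of_tgt _ _
  actRight := 0
  actRight_one := hZ.eq_of_tgt _ _
  right_assoc := hZ.eq_of_tgt _ _
  middle_assoc := hZ.eq_of_tgt _ _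
  left_dag := hZ.eq_of_tgt _ _
  right_dag := hZ.eq_of_tgt _ _

section Sum
variable (M N : DaggerBimod A B) {Z : T} (i : M.X ⟶ Z) (j : N.X ⟶ Z)
  (hi : i ≫ i† = 𝟙 _) (hj : j ≫ j† = 𝟙 _) (hij : i ≫ j† = 0) (hji : j ≫ i† = 0)
  (h : i† ≫ i + j† ≫ j = 𝟙 Z)

/-- The direct sum of two bimodules on a direct sum of the underlying objects. -/
abbrev sum : DaggerBimod A B where
  X := Z
  actLeft := A.X ◁ i† ≫ M.actLeft ≫ i + A.X ◁ j† ≫ N.actLeft ≫ j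
  one_actLeft := by
    rw [Preadditive.comp_add, ← whisker_exchange_assoc, ← whisker_exchange_assoc,
      M.one_actLeft_assoc, N.one_actLeft_assoc, leftUnitor_naturality_assoc,
      leftUnitor_naturality_assoc, ← Preadditive.comp_add, h, Category.comp_id]
  left_assoc := by
    simp only [Preadditive.comp_add, Preadditive.add_comp, MonoidalPreadditive.whiskerLeft_add,
      whiskerLeft_comp, Category.assoc]
    simp only [← whiskerLeft_comp_assoc, hi, hj, hij, hji]
    simp only [Category.comp_id, whiskerLeft_comp, Category.assoc, Limits.comp_zero, Limits.zero_comp,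
      MonoidalPreadditive.whiskerLeft_zero, add_zero, zero_add]
    rw [← whisker_exchange_assoc, ← whisker_exchange_assoc, M.left_assoc_assoc, N.left_assoc_assoc]
    simp
  actRight := i† ▷ B.X ≫ M.actRight ≫ i + j† ▷ B.X ≫ N.actRight ≫ j
  actRight_one := by
    rw [Preadditive.comp_add, whisker_exchange_assoc, whisker_exchange_assoc,
      M.actRight_one_assoc, N.actRight_one_assoc, rightUnitor_naturality_assoc,
      rightUnitor_naturality_assoc, ← Preadditive.comp_add, h, Category.comp_id]
  right_assoc := by
    simp only [Preadditive.comp_add, Preadditive.add_comp, MonoidalPreadditive.add_whiskerRight,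
      comp_whiskerRight, Category.assoc]
    simp only [← comp_whiskerRight_assoc, hi, hj, hij, hji]
    simp only [Category.comp_id, comp_whiskerRight, Category.assoc, Limits.comp_zero, Limits.zero_comp,
      MonoidalPreadditive.zero_whiskerRight, add_zero, zero_add]
    rw [whisker_exchange_assoc, whisker_exchange_assoc, M.right_assoc_assoc, N.right_assoc_assoc]
    simp
  middle_assoc := by
    simp only [Preadditive.comp_add, Preadditive.add_comp, MonoidalPreadditive.add_whiskerRight,
      MonoidalPreadditive.whiskerLeft_add, whiskerLeft_comp,
      comp_whiskerRight, Category.assoc]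
    simp only [← comp_whiskerRight_assoc, ← whiskerLeft_comp_assoc, hi, hj, hij, hji]
    simp only [Category.comp_id, comp_whiskerRight, whiskerLeft_comp, Category.assoc,
      Limits.comp_zero, Limits.zero_comp, MonoidalPreadditive.zero_whiskerRight,
      MonoidalPreadditive.whiskerLeft_zero, add_zero, zero_add]
    rw [M.middle_assoc_assoc, N.middle_assoc_assoc]
    simp
  left_dag := by
    conv_rhs => rw [← M.left_dag, ← N.left_dag]
    simp only [CStarCategory.dag_add, CStarCategory.dag_comp, CStarCategory.dag_dag, dag_wl,
      MonoidalPreadditive.whiskerLeft_add, whiskerLeft_comp, Category.assoc, Preadditive.add_comp]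
    rw [associator_inv_naturality_right_assoc, whisker_exchange_assoc, leftUnitor_naturality,
      associator_inv_naturality_right_assoc, whisker_exchange_assoc, leftUnitor_naturality]
  right_dag := by
    conv_rhs => rw [← M.right_dag, ← N.right_dag]
    simp only [CStarCategory.dag_add, CStarCategory.dag_comp, CStarCategory.dag_dag, dag_wr,
      MonoidalPreadditive.add_whiskerRight, comp_whiskerRight, Category.assoc, Preadditive.add_comp]
    rw [associator_naturality_left_assoc, ← whisker_exchange_assoc, rightUnitor_naturality,
      associator_naturality_left_assoc, ← whisker_exchange_assoc, rightUnitor_naturality]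

theorem sum_left (hi : i ≫ i† = 𝟙 _) (hij : i ≫ j† = 0) : M.actLeft ≫ i = A.X ◁ i ≫ (A.X ◁ i† ≫ M.actLeft ≫ i + A.X ◁ j† ≫ N.actLeft ≫ j) := by
  rw [Preadditive.comp_add, ← whiskerLeft_comp_assoc, ← whiskerLeft_comp_assoc, hi, hij]
  simp

theorem sum_right (hi : i ≫ i† = 𝟙 _) (hij : i ≫ j† = 0) : M.actRight ≫ i =
    i ▷ B.X ≫ (i† ▷ B.X ≫ M.actRight ≫ i + j† ▷ B.X ≫ N.actRight ≫ j) := by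
  rw [Preadditive.comp_add, ← comp_whiskerRight_assoc, ← comp_whiskerRight_assoc, hi, hij]
  simp

end Sum

/-- Inserting `i† ≫ i + j† ≫ j` between `i` and `j†` produces `i ≫ j†` twice, while it is the
identity; so `i ≫ j†` equals its double. -/
theorem isometry_orthogonal {X Y Z : T} {i : X ⟶ Z} {j : Y ⟶ Z} (hi : i ≫ i† = 𝟙 _)
    (hj : j ≫ j† = 𝟙 _) (h : i† ≫ i + j† ≫ j = 𝟙 Z) : i ≫ j† = 0 := by
  have h1 : i ≫ (i† ≫ i + j† ≫ j) ≫ j† = i ≫ j† + i ≫ j† := by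
    rw [Preadditive.add_comp, Preadditive.comp_add, Category.assoc, Category.assoc, hj,
      reassoc_of% hi, Category.comp_id]
  rw [h, Category.id_comp] at h1
  simpa using h1

/-- Each structure is taken in `T` and then equipped with actions transported along the isometries,
which thereby become bimodule homomorphisms. -/
theorem isSemisimple (A B : SSFA T) : IsSemisimpleCStar (DaggerBimod A B) where
  exists_zero := by
    obtain ⟨Z, hZ⟩ := (RigidCStarTensorCategory.semisimple (T := T)).exists_zero
    exact ⟨zeroBimod A B hZ, isZero_of_id (hZ.eq_of_src _ _)⟩
  exists_directSum X := by
    obtain ⟨Z, i, hi, h⟩ :=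
      (RigidCStarTensorCategory.semisimple (T := T)).exists_directSum fun k => (X k).X
    rw [Fin.sum_univ_two] at h
    have h0 : i 0 ≫ (i 0)† = 𝟙 _ := hi 0
    have h1 : i 1 ≫ (i 1)† = 𝟙 _ := hi 1
    have h01 := isometry_orthogonal h0 h1 h
    have h10 := isometry_orthogonal h1 h0 ((add_comm _ _).trans h)
    let S := sum (X 0) (X 1) (i 0) (i 1) h0 h1 h01 h10 h
    let a : X 0 ⟶ S :=
      { hom := i 0
        left_act_hom := sum_left (X 0) (X 1) (i 0) (i 1) h0 h01
        right_act_hom := sum_right (X 0) (X 1) (i 0) (i 1) h0 h01 }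
    let b : X 1 ⟶ S :=
      { hom := i 1
        left_act_hom := (sum_left (X 1) (X 0) (i 1) (i 0) h1 h10).trans (by rw [add_comm])
        right_act_hom := (sum_right (X 1) (X 0) (i 1) (i 0) h1 h10).trans (by rw [add_comm]) }
    refine ⟨S, Fin.cons a (Fin.cons b finZeroElim), ?_, ?_⟩
    · rw [Fin.forall_fin_two]
      exact ⟨hom_ext h0, hom_ext h1⟩
    · rw [Fin.sum_univ_two]
      exact hom_ext h
  exists_splitting {M} p hd hp := by
    obtain ⟨V, i, hi, hip⟩ := (RigidCStarTensorCategory.semisimple (T := T)).exists_splitting p.hom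
      (congrArg Bimod.Hom.hom hd) (congrArg Bimod.Hom.hom hp)
    let c : M ⟶ ofSplitting p i hi hip :=
      { hom := i†
        left_act_hom := ofSplitting_left p i hi hip
        right_act_hom := ofSplitting_right p i hi hip }
    refine ⟨_, dagHom c, hom_ext ?_, hom_ext ?_⟩
    · change i†† ≫ i†† † = _
      rw [CStarCategory.dag_dag]
      exact hi
    · change i††† ≫ i†† = _
      rw [CStarCategory.dag_dag, CStarCategory.dag_dag]
      exact hip
  finite_end X := inferInstance

end DaggerBimod
end

/-! ### The zero algebra and direct sums of algebras -/

section
open MonoidalCategory MonObj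

section
variable {T : Type u} [Category.{v} T] [MonoidalCategory T] [CStarTensorCategory T]

/-- The standardness condition for `u ≫ m†` and its adjoint. -/
def IsStandardCup {X : T} (m : X ⊗ X ⟶ X) (u : 𝟙_ T ⟶ X) : Prop :=
  ∀ f : X ⟶ X, endTrace (𝟙_ T) (u ≫ m† ≫ X ◁ f ≫ m ≫ u†) =
    endTrace (𝟙_ T) (u ≫ m† ≫ f ▷ X ≫ m ≫ u†)

namespace SSFA

/-- An algebra satisfying one half of the Frobenius equation, as a separable standard Frobenius
algebra. -/
abbrev ofMul (X : T) (m : X ⊗ X ⟶ X) (u : 𝟙_ T ⟶ X) (one_mul : u ▷ X ≫ m = (λ_ X).hom)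
    (mul_one : X ◁ u ≫ m = (ρ_ X).hom) (mul_assoc : m ▷ X ≫ m = (α_ X X X).hom ≫ X ◁ m ≫ m)
    (frob : X ◁ m† ≫ (α_ X X X).inv ≫ m ▷ X = m ≫ m†) (sep : m† ≫ m = 𝟙 X)
    (std : IsStandardCup m u) : SSFA T where
  X := X
  mon := { one := u, mul := m, one_mul := one_mul, mul_one := mul_one, mul_assoc := mul_assoc }
  frob_left := frob
  frob_right := by
    have := congrArg CStarCategory.dag frob
    simpa using this
  separable := sep
  standard f := by
    have := std f
    change endTrace _ ((u ≫ m†) ≫ X ◁ f ≫ (u ≫ m†)†) = endTrace _ ((m ≫ u†)† ≫ f ▷ X ≫ m ≫ u†)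
    simpa using this

theorem isStandardCup (A : SSFA T) : IsStandardCup (μ[A.X]) (η[A.X]) := fun f => by
  have := A.standard f
  rw [frobCap_dag, frobCup_dag, frobCup, frobCap] at this
  simpa using this

end SSFA
end

variable {T : Type u} [Category.{v} T] [MonoidalCategory T] [RigidCStarTensorCategory T]

open DaggerBimod

namespace SSFA

/-- The zero algebra. -/
abbrev zeroAlg {Z : T} (hZ : Limits.IsZero Z) : SSFA T :=
  ofMul Z 0 0
    (hZ.eq_of_tgt _ _) (hZ.eq_of_tgt _ _) (hZ.eq_of_tgt _ _)
    (by
      have : (α_ Z Z Z).inv ≫ (0 : Z ⊗ Z ⟶ Z) ▷ Z = 0 := by simp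
      rw [this]; simp)
    (hZ.eq_of_tgt _ _) (fun f => by simp)

/-- The action of the zero algebra on a bimodule is a map out of a zero object, yet by separability
it has a section. So every bimodule over it is zero. -/
theorem isZeroObject_zeroAlg {Z : T} (hZ : Limits.IsZero Z) :
    IsZeroObject (B := SSFA T) (zeroAlg hZ) := by
  have key : ∀ M : DaggerBimod (zeroAlg hZ) (zeroAlg hZ), 𝟙 M.X = 0 := fun M => by
    have h1 := M.left_sep
    have h2 : M.actLeft = 0 := by
      have : 𝟙 (Z ⊗ M.X) = 0 := by
        rw [← id_whiskerRight, hZ.eq_of_src (𝟙 Z) 0, MonoidalPreadditive.zero_whiskerRight]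
      have h3 : (𝟙 (Z ⊗ M.X)) ≫ M.actLeft = M.actLeft := Category.id_comp _
      rw [← h3, this, Limits.zero_comp]
    rw [← h1, h2, Limits.comp_zero]
  refine (equiv_punit_iff_unique _).2 ⟨⟨regular _⟩, fun M N => ⟨⟨⟨(0 : (M : DaggerBimod _ _) ⟶ N)⟩, fun f => ?_⟩⟩⟩
  exact (isZero_of_id (key M)).eq_of_src _ _

section Sum
variable (A B : SSFA T) {Z : T} (i : A.X ⟶ Z) (j : B.X ⟶ Z)

/-- The multiplication of a direct sum of algebras. -/
def sumMul : Z ⊗ Z ⟶ Z := (i† ⊗ₘ i†) ≫ μ[A.X] ≫ i + (j† ⊗ₘ j†) ≫ μ[B.X] ≫ j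

/-- The unit of a direct sum of algebras. -/
def sumOne : 𝟙_ T ⟶ Z := η[A.X] ≫ i + η[B.X] ≫ j

theorem dag_tensorHom {X Y X' Y' : T} (f : X ⟶ Y) (g : X' ⟶ Y') : (f ⊗ₘ g)† = f† ⊗ₘ g† := by
  rw [MonoidalCategory.tensorHom_def, MonoidalCategory.tensorHom_def']
  simp

theorem zero_tensorHom {X Y X' Y' : T} (g : X' ⟶ Y') : ((0 : X ⟶ Y) ⊗ₘ g) = 0 := by
  rw [MonoidalCategory.tensorHom_def]; simp

theorem tensorHom_zero {X Y X' Y' : T} (f : X ⟶ Y) : (f ⊗ₘ (0 : X' ⟶ Y')) = 0 := by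
  rw [MonoidalCategory.tensorHom_def]; simp

theorem sumMul_left (hi : i ≫ i† = 𝟙 _) (hji : j ≫ i† = 0) :
    sumMul A B i j ≫ i† = (i† ⊗ₘ i†) ≫ μ[A.X] := by
  simp [sumMul, hi, hji]

theorem sumMul_right (hj : j ≫ j† = 𝟙 _) (hij : i ≫ j† = 0) :
    sumMul A B i j ≫ j† = (j† ⊗ₘ j†) ≫ μ[B.X] := by
  simp [sumMul, hj, hij]

theorem left_sumMul (hi : i ≫ i† = 𝟙 _) (hij : i ≫ j† = 0) :
    (i ⊗ₘ i) ≫ sumMul A B i j = μ[A.X] ≫ i := by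
  rw [sumMul, Preadditive.comp_add, tensorHom_comp_tensorHom_assoc, tensorHom_comp_tensorHom_assoc,
    hi, hij, zero_tensorHom, Limits.zero_comp, add_zero]
  simp

theorem sumMul_comm : sumMul A B i j = sumMul B A j i := add_comm _ _

theorem sumMul_dag : (sumMul A B i j)† =
    i† ≫ μ[A.X]† ≫ (i ⊗ₘ i) + j† ≫ μ[B.X]† ≫ (j ⊗ₘ j) := by
  simp [sumMul, CStarCategory.dag_add, dag_tensorHom]

theorem ext_of_sum {W : T} {f g : W ⟶ Z} (h : i† ≫ i + j† ≫ j = 𝟙 Z) (h₁ : f ≫ i† = g ≫ i†)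
    (h₂ : f ≫ j† = g ≫ j†) : f = g := by
  rw [← Category.comp_id f, ← Category.comp_id g, ← h, Preadditive.comp_add, Preadditive.comp_add,
    reassoc_of% h₁, reassoc_of% h₂]

/-- This and the next two lemmas verify the algebra axioms after composition with an algebra
homomorphism `φ`. For a direct sum the two projections are jointly monic homomorphisms, so the
axioms follow. -/
theorem one_mul_of_hom {W : T} {m : W ⊗ W ⟶ W} {u : 𝟙_ T ⟶ W} {φ : W ⟶ A.X}
    (hm : m ≫ φ = (φ ⊗ₘ φ) ≫ μ[A.X]) (hu : u ≫ φ = η[A.X]) :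
    (u ▷ W ≫ m) ≫ φ = (λ_ W).hom ≫ φ := by
  rw [Category.assoc, hm, MonoidalCategory.tensorHom_def, Category.assoc, ← comp_whiskerRight_assoc,
    hu, ← whisker_exchange_assoc, MonObj.one_mul, leftUnitor_naturality]

theorem mul_one_of_hom {W : T} {m : W ⊗ W ⟶ W} {u : 𝟙_ T ⟶ W} {φ : W ⟶ A.X}
    (hm : m ≫ φ = (φ ⊗ₘ φ) ≫ μ[A.X]) (hu : u ≫ φ = η[A.X]) :
    (W ◁ u ≫ m) ≫ φ = (ρ_ W).hom ≫ φ := by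
  rw [Category.assoc, hm, MonoidalCategory.tensorHom_def', Category.assoc, ← whiskerLeft_comp_assoc,
    hu, whisker_exchange_assoc, MonObj.mul_one, rightUnitor_naturality]

theorem mul_assoc_of_hom {W : T} {m : W ⊗ W ⟶ W} {φ : W ⟶ A.X}
    (hm : m ≫ φ = (φ ⊗ₘ φ) ≫ μ[A.X]) :
    (m ▷ W ≫ m) ≫ φ = ((α_ W W W).hom ≫ W ◁ m ≫ m) ≫ φ := by
  have h1 : m ▷ W ≫ (φ ⊗ₘ φ) = ((φ ⊗ₘ φ) ⊗ₘ φ) ≫ μ[A.X] ▷ A.X := by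
    rw [MonoidalCategory.tensorHom_def φ φ, ← comp_whiskerRight_assoc, hm, comp_whiskerRight,
      Category.assoc, ← whisker_exchange, ← MonoidalCategory.tensorHom_def φ φ,
      MonoidalCategory.tensorHom_def (φ ⊗ₘ φ) φ, Category.assoc]
  have h2 : W ◁ m ≫ (φ ⊗ₘ φ) = (φ ⊗ₘ φ ⊗ₘ φ) ≫ A.X ◁ μ[A.X] := by
    rw [MonoidalCategory.tensorHom_def' φ φ, ← whiskerLeft_comp_assoc, hm, whiskerLeft_comp,
      Category.assoc, whisker_exchange, ← MonoidalCategory.tensorHom_def' φ φ,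
      MonoidalCategory.tensorHom_def' φ (φ ⊗ₘ φ), Category.assoc]
  simp only [Category.assoc, hm]
  rw [reassoc_of% h1, reassoc_of% h2, MonObj.mul_assoc, associator_naturality_assoc]

/-- One half of the terms in the Frobenius equation for a direct sum. -/
theorem sum_frob_aux (hi : i ≫ i† = 𝟙 _) (hij : i ≫ j† = 0) :
    Z ◁ (i† ≫ μ[A.X]† ≫ (i ⊗ₘ i)) ≫ (α_ Z Z Z).inv ≫ (sumMul A B i j) ▷ Z =
      (i† ⊗ₘ i†) ≫ μ[A.X] ≫ μ[A.X]† ≫ (i ⊗ₘ i) := by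
  -- Multiplying by an element of one summand only sees the component of the other factor in that
  -- summand.
  have h2 : Z ◁ i ≫ sumMul A B i j = i† ▷ A.X ≫ μ[A.X] ≫ i := by
    rw [sumMul, Preadditive.comp_add, MonoidalCategory.tensorHom_def', MonoidalCategory.tensorHom_def',
      Category.assoc, Category.assoc, ← whiskerLeft_comp_assoc, ← whiskerLeft_comp_assoc, hi, hij]
    simp
  calc _ = Z ◁ (i† ≫ μ[A.X]†) ≫ (α_ Z _ _).inv ≫ (Z ◁ i) ▷ A.X ≫ (sumMul A B i j) ▷ A.X ≫ Z ◁ i := by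
        rw [← whisker_exchange, MonoidalCategory.tensorHom_def]
        monoidal
    _ = Z ◁ i† ≫ (Z ◁ μ[A.X]† ≫ i† ▷ (A.X ⊗ A.X)) ≫ (α_ _ _ _).inv ≫ μ[A.X] ▷ A.X ≫ (i ▷ A.X ≫ Z ◁ i) := by
        rw [← comp_whiskerRight_assoc, h2]
        monoidal
    _ = Z ◁ i† ≫ i† ▷ A.X ≫ (A.X ◁ μ[A.X]† ≫ (α_ _ _ _).inv ≫ μ[A.X] ▷ A.X) ≫ (i ▷ A.X ≫ Z ◁ i) := by
        rw [whisker_exchange]; simp only [Category.assoc]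
    _ = _ := by
        rw [A.frob_left, MonoidalCategory.tensorHom_def' i† i†, MonoidalCategory.tensorHom_def i i]
        simp only [Category.assoc]

theorem sumOne_sumMul_dag (hi : i ≫ i† = 𝟙 _) (hj : j ≫ j† = 𝟙 _) (hij : i ≫ j† = 0)
    (hji : j ≫ i† = 0) : sumOne A B i j ≫ (sumMul A B i j)† =
      η[A.X] ≫ μ[A.X]† ≫ (i ⊗ₘ i) + η[B.X] ≫ μ[B.X]† ≫ (j ⊗ₘ j) := by
  simp [sumOne, sumMul_dag, reassoc_of% hi, reassoc_of% hj, reassoc_of% hij, reassoc_of% hji]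

theorem sum_cup (hi : i ≫ i† = 𝟙 _) (hj : j ≫ j† = 𝟙 _) (hij : i ≫ j† = 0) (hji : j ≫ i† = 0)
    (F : Z ⊗ Z ⟶ Z ⊗ Z) (hF : (i ⊗ₘ i) ≫ F ≫ (j† ⊗ₘ j†) = 0)
    (hF' : (j ⊗ₘ j) ≫ F ≫ (i† ⊗ₘ i†) = 0) :
    sumOne A B i j ≫ (sumMul A B i j)† ≫ F ≫ sumMul A B i j ≫ (sumOne A B i j)† =
      η[A.X] ≫ μ[A.X]† ≫ ((i ⊗ₘ i) ≫ F ≫ (i† ⊗ₘ i†)) ≫ μ[A.X] ≫ η[A.X]† +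
      η[B.X] ≫ μ[B.X]† ≫ ((j ⊗ₘ j) ≫ F ≫ (j† ⊗ₘ j†)) ≫ μ[B.X] ≫ η[B.X]† := by
  have h1 := sumOne_sumMul_dag A B i j hi hj hij hji
  have h2 := congrArg CStarCategory.dag h1
  simp only [CStarCategory.dag_comp, CStarCategory.dag_add, CStarCategory.dag_dag, dag_tensorHom,
    Category.assoc] at h2
  rw [h2, reassoc_of% h1]
  simp only [Preadditive.comp_add, Preadditive.add_comp, Category.assoc]
  rw [reassoc_of% hF, reassoc_of% hF']
  simp

/-- The direct sum of two separable standard Frobenius algebras. -/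
abbrev sum (hi : i ≫ i† = 𝟙 _) (hj : j ≫ j† = 𝟙 _) (hij : i ≫ j† = 0) (hji : j ≫ i† = 0)
    (h : i† ≫ i + j† ≫ j = 𝟙 Z) : SSFA T :=
  have hm := sumMul_left A B i j hi hji
  have hm' := sumMul_right A B i j hj hij
  have hu : sumOne A B i j ≫ i† = η[A.X] := by simp [sumOne, hi, hji]
  have hu' : sumOne A B i j ≫ j† = η[B.X] := by simp [sumOne, hj, hij]
  ofMul Z (sumMul A B i j) (sumOne A B i j)
    (ext_of_sum A B i j h (one_mul_of_hom A hm hu) (one_mul_of_hom B hm' hu'))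
    (ext_of_sum A B i j h (mul_one_of_hom A hm hu) (mul_one_of_hom B hm' hu'))
    (ext_of_sum A B i j h (mul_assoc_of_hom A hm) (mul_assoc_of_hom B hm'))
    (by
      have h1 := sum_frob_aux A B i j hi hij
      have h2 := sum_frob_aux B A j i hj hji
      rw [← sumMul_comm] at h2
      rw [sumMul_dag, MonoidalPreadditive.whiskerLeft_add, Preadditive.add_comp, h1, h2,
        Preadditive.comp_add, reassoc_of% hm, reassoc_of% hm'])
    (by
      have h1 := left_sumMul A B i j hi hij
      have h2 := left_sumMul B A j i hj hji
      rw [← sumMul_comm] at h2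
      rw [sumMul_dag, Preadditive.add_comp, ← h]
      simp only [Category.assoc]
      rw [h1, h2, reassoc_of% A.separable, reassoc_of% B.separable])
    -- The cup of the sum is the sum of the two cups, so only the diagonal blocks of `f` contribute,
    -- and standardness is that of each summand.
    (fun f => by
      have e1 : ∀ {U V : T} (a : U ⟶ Z) (b : Z ⟶ V), (a ⊗ₘ a) ≫ Z ◁ f ≫ (b ⊗ₘ b) =
          ((a ≫ b) ⊗ₘ (a ≫ f ≫ b)) := fun a b => by
        rw [← id_tensorHom, tensorHom_comp_tensorHom, tensorHom_comp_tensorHom, Category.id_comp]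
      have e2 : ∀ {U V : T} (a : U ⟶ Z) (b : Z ⟶ V), (a ⊗ₘ a) ≫ f ▷ Z ≫ (b ⊗ₘ b) =
          ((a ≫ f ≫ b) ⊗ₘ (a ≫ b)) := fun a b => by
        rw [← tensorHom_id, tensorHom_comp_tensorHom, tensorHom_comp_tensorHom, Category.id_comp]
      rw [sum_cup A B i j hi hj hij hji (Z ◁ f) (by rw [e1, hij, zero_tensorHom])
          (by rw [e1, hji, zero_tensorHom]),
        sum_cup A B i j hi hj hij hji (f ▷ Z) (by rw [e2, hij, tensorHom_zero])
          (by rw [e2, hji, tensorHom_zero]),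
        CStarCategory.endTrace_add, CStarCategory.endTrace_add, e1, e1, e2, e2, hi, hj, id_tensorHom,
        id_tensorHom, tensorHom_id, tensorHom_id, A.isStandardCup, B.isStandardCup])

end Sum
end SSFA
end

/-! ### Corners, direct sums of objects, and decomposition into simple objects -/

section
open MonoidalCategory MonObj
variable {T : Type u} [Category.{v} T] [MonoidalCategory T] [RigidCStarTensorCategory T]

open DaggerBimod

namespace SSFA

section Corner
variable (R : SSFA T) (p : regular R ⟶ regular R) {V : T} (i : V ⟶ R.X)

/-- The multiplication of the corner of an algebra at a central projection. -/
def cornerMul : V ⊗ V ⟶ V := (i ⊗ₘ i) ≫ μ[R.X] ≫ i†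

variable {R p i} (hi : i ≫ i† = 𝟙 V) (hp : i† ≫ i = p.hom)

theorem central_left (z : regular R ⟶ regular R) : μ[R.X] ≫ z.hom = z.hom ▷ R.X ≫ μ[R.X] :=
  z.right_act_hom

theorem central_right (z : regular R ⟶ regular R) : μ[R.X] ≫ z.hom = R.X ◁ z.hom ≫ μ[R.X] :=
  z.left_act_hom

theorem comp_proj (hi : i ≫ i† = 𝟙 V) (hp : i† ≫ i = p.hom) : i ≫ p.hom = i := by
  rw [← hp, reassoc_of% hi]

theorem proj_comp (hi : i ≫ i† = 𝟙 V) (hp : i† ≫ i = p.hom) : p.hom ≫ i† = i† := by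
  rw [← hp, Category.assoc, hi, Category.comp_id]

/-- Since the projection is central, a product whose first factor lies in the corner stays in the
corner. -/
theorem tensor_mul_proj (hi : i ≫ i† = 𝟙 V) (hp : i† ≫ i = p.hom) {W : T} (f : W ⟶ R.X) :
    (i ⊗ₘ f) ≫ μ[R.X] ≫ p.hom = (i ⊗ₘ f) ≫ μ[R.X] := by
  rw [central_left, MonoidalCategory.tensorHom_def, Category.assoc, whisker_exchange_assoc,
    ← comp_whiskerRight_assoc, comp_proj hi hp, Category.assoc]

theorem cornerMul_comp (hi : i ≫ i† = 𝟙 V) (hp : i† ≫ i = p.hom) :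
    cornerMul R i ≫ i = (i ⊗ₘ i) ≫ μ[R.X] := by
  rw [cornerMul, Category.assoc, Category.assoc, hp, tensor_mul_proj hi hp]

theorem mul_corner (hi : i ≫ i† = 𝟙 V) (hp : i† ≫ i = p.hom) :
    μ[R.X] ≫ i† = (i† ⊗ₘ i†) ≫ cornerMul R i := by
  rw [cornerMul, tensorHom_comp_tensorHom_assoc, hp, MonoidalCategory.tensorHom_def, Category.assoc,
    ← reassoc_of% (central_right p), ← reassoc_of% (central_left p), proj_comp hi hp,
    proj_comp hi hp]

theorem cornerMul_dag : (cornerMul R i)† = i ≫ μ[R.X]† ≫ (i† ⊗ₘ i†) := by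
  simp [cornerMul, dag_tensorHom]

theorem ext_of_isometry {X Y : T} {i : X ⟶ Y} (hi : i ≫ i† = 𝟙 X) {W : T} {f g : W ⟶ X}
    (h : f ≫ i = g ≫ i) : f = g := by
  rw [← Category.comp_id f, ← Category.comp_id g, ← hi, reassoc_of% h]

theorem proj_dag (hp : i† ≫ i = p.hom) : p.hom† = p.hom := by
  rw [← hp]; simp

/-- The cup of a corner. -/
theorem one_cornerMul_dag (hi : i ≫ i† = 𝟙 V) (hp : i† ≫ i = p.hom) :
    (η[R.X] ≫ i†) ≫ (cornerMul R i)† = η[R.X] ≫ μ[R.X]† ≫ (i† ⊗ₘ i†) := by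
  have h := congrArg CStarCategory.dag (central_left p)
  simp only [CStarCategory.dag_comp, dag_wr, proj_dag hp] at h
  rw [cornerMul_dag, Category.assoc, reassoc_of% hp, reassoc_of% h, MonoidalCategory.tensorHom_def,
    ← comp_whiskerRight_assoc, proj_comp hi hp]

/-- The corner of a separable standard Frobenius algebra at a central projection. -/
abbrev corner (R : SSFA T) (p : regular R ⟶ regular R) {V : T} (i : V ⟶ R.X)
    (hi : i ≫ i† = 𝟙 V) (hp : i† ≫ i = p.hom) : SSFA T :=
  ofMul V (cornerMul R i) (η[R.X] ≫ i†)
    (by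
      apply ext_of_isometry hi
      rw [Category.assoc, cornerMul_comp hi hp, MonoidalCategory.tensorHom_def, Category.assoc,
        ← comp_whiskerRight_assoc, Category.assoc, hp, comp_whiskerRight_assoc,
        ← whisker_exchange_assoc, ← central_left, ← whisker_exchange_assoc, MonObj.one_mul_assoc,
        leftUnitor_naturality_assoc, comp_proj hi hp])
    (by
      apply ext_of_isometry hi
      rw [Category.assoc, cornerMul_comp hi hp, MonoidalCategory.tensorHom_def', Category.assoc,
        ← whiskerLeft_comp_assoc, Category.assoc, hp, whiskerLeft_comp_assoc,
        whisker_exchange_assoc, ← central_right, whisker_exchange_assoc, MonObj.mul_one_assoc,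
        rightUnitor_naturality_assoc, comp_proj hi hp])
    (by
      have hm := cornerMul_comp hi hp
      have h1 : cornerMul R i ▷ V ≫ (i ⊗ₘ i) = ((i ⊗ₘ i) ⊗ₘ i) ≫ μ[R.X] ▷ R.X := by
        rw [MonoidalCategory.tensorHom_def i i, ← comp_whiskerRight_assoc, hm, comp_whiskerRight,
          Category.assoc, ← whisker_exchange, ← MonoidalCategory.tensorHom_def i i,
          MonoidalCategory.tensorHom_def (i ⊗ₘ i) i, Category.assoc]
      have h2 : V ◁ cornerMul R i ≫ (i ⊗ₘ i) = (i ⊗ₘ i ⊗ₘ i) ≫ R.X ◁ μ[R.X] := by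
        rw [MonoidalCategory.tensorHom_def' i i, ← whiskerLeft_comp_assoc, hm, whiskerLeft_comp,
          Category.assoc, whisker_exchange, ← MonoidalCategory.tensorHom_def' i i,
          MonoidalCategory.tensorHom_def' i (i ⊗ₘ i), Category.assoc]
      apply ext_of_isometry hi
      simp only [Category.assoc, hm]
      rw [reassoc_of% h1, reassoc_of% h2, MonObj.mul_assoc, associator_naturality_assoc])
    (by
      have hm := cornerMul_comp hi hp
      have hd := congrArg CStarCategory.dag (mul_corner hi hp)
      simp only [CStarCategory.dag_comp, CStarCategory.dag_dag, dag_tensorHom] at hd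
      have h1 : cornerMul R i ▷ V ≫ (i ⊗ₘ i) = ((i ⊗ₘ i) ⊗ₘ i) ≫ μ[R.X] ▷ R.X := by
        rw [MonoidalCategory.tensorHom_def i i, ← comp_whiskerRight_assoc, hm, comp_whiskerRight,
          Category.assoc, ← whisker_exchange, ← MonoidalCategory.tensorHom_def i i,
          MonoidalCategory.tensorHom_def (i ⊗ₘ i) i, Category.assoc]
      have hii : (i ⊗ₘ i) ≫ (i ⊗ₘ i)† = 𝟙 _ := by
        rw [dag_tensorHom, tensorHom_comp_tensorHom, hi, id_tensorHom, whiskerLeft_id]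
      apply ext_of_isometry hii
      simp only [Category.assoc]
      rw [h1, ← hd, reassoc_of% hm, ← associator_inv_naturality_assoc,
        MonoidalCategory.tensorHom_def' i (i ⊗ₘ i), Category.assoc, ← whiskerLeft_comp_assoc, ← hd,
        whiskerLeft_comp_assoc, whisker_exchange_assoc, R.frob_left,
        MonoidalCategory.tensorHom_def' i i, Category.assoc])
    (by
      rw [cornerMul_dag, cornerMul]
      simp only [Category.assoc]
      rw [tensorHom_comp_tensorHom_assoc, hp, MonoidalCategory.tensorHom_def, Category.assoc,
        ← reassoc_of% (central_right p), ← reassoc_of% (central_left p), proj_comp hi hp,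
        proj_comp hi hp, reassoc_of% R.separable, hi])
    -- The cup of the corner is the compressed cup of `R`, so the claim becomes standardness of `R`
    -- for `i† ≫ f ≫ i`. The projection left over on the other wire slides through `μ†` by
    -- centrality and is absorbed.
    (fun f => by
      have h := one_cornerMul_dag hi hp
      have h2 := congrArg CStarCategory.dag h
      simp only [CStarCategory.dag_comp, CStarCategory.dag_dag, dag_tensorHom, Category.assoc] at h2
      have e1 : (i† ⊗ₘ i†) ≫ V ◁ f ≫ (i ⊗ₘ i) = p.hom ▷ R.X ≫ R.X ◁ (i† ≫ f ≫ i) := by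
        rw [← id_tensorHom, tensorHom_comp_tensorHom, tensorHom_comp_tensorHom, Category.id_comp, hp,
          MonoidalCategory.tensorHom_def]
      have e2 : (i† ⊗ₘ i†) ≫ f ▷ V ≫ (i ⊗ₘ i) = R.X ◁ p.hom ≫ (i† ≫ f ≫ i) ▷ R.X := by
        rw [← tensorHom_id, tensorHom_comp_tensorHom, tensorHom_comp_tensorHom, Category.id_comp, hp,
          MonoidalCategory.tensorHom_def']
      have d1 := congrArg CStarCategory.dag (central_left p)
      have d2 := congrArg CStarCategory.dag (central_right p)
      simp only [CStarCategory.dag_comp, dag_wr, dag_wl, proj_dag hp] at d1 d2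
      have h3 := R.isStandardCup (i† ≫ f ≫ i)
      simp only [CStarCategory.dag_comp, CStarCategory.dag_dag, Category.assoc] at h ⊢
      rw [reassoc_of% h, h2, reassoc_of% h, reassoc_of% e1, reassoc_of% e2, ← reassoc_of% d1,
        ← reassoc_of% d2, reassoc_of% d2, reassoc_of% d1, ← whiskerLeft_comp_assoc,
        ← comp_whiskerRight_assoc, ← Category.assoc p.hom, proj_comp hi hp]
      exact h3)

end Corner

end SSFA

namespace DaggerBimod
variable {A B C D : SSFA T}

/-- Restriction of the right action along an algebra homomorphism. -/
abbrev restrictRight (M : DaggerBimod A B) (φ : C.X ⟶ B.X) (hm : μ[C.X] ≫ φ = (φ ⊗ₘ φ) ≫ μ[B.X])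
    (hu : η[C.X] ≫ φ = η[B.X])
    (hc : B.X ◁ φ ≫ μ[B.X] ≫ η[B.X]† = φ† ▷ C.X ≫ μ[C.X] ≫ η[C.X]†) : DaggerBimod A C where
  X := M.X
  actLeft := M.actLeft
  one_actLeft := M.one_actLeft
  left_assoc := M.left_assoc
  actRight := M.X ◁ φ ≫ M.actRight
  actRight_one := by
    rw [← whiskerLeft_comp_assoc, hu, M.actRight_one]
  right_assoc := by
    rw [← whiskerLeft_comp_assoc, hm, whiskerLeft_comp_assoc, M.right_assoc,
      MonoidalCategory.tensorHom_def]
    simp only [comp_whiskerRight, Category.assoc]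
    rw [← whisker_exchange_assoc]
    simp
  middle_assoc := by
    rw [← whisker_exchange_assoc, M.middle_assoc]
    simp
  left_dag := M.left_dag
  right_dag := by
    conv_rhs => rw [← M.right_dag]
    -- Compatibility of `φ` with the caps, the `*`-homomorphism condition, is what keeps the
    -- restricted action a dagger action.
    have hc' : M.X ◁ B.X ◁ φ ≫ M.X ◁ frobCap B.X = M.X ◁ φ† ▷ C.X ≫ M.X ◁ frobCap C.X := by
      rw [frobCap, frobCap, ← whiskerLeft_comp, ← whiskerLeft_comp, hc]
    rw [whisker_exchange_assoc, CStarCategory.dag_comp, dag_wl]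
    simp only [comp_whiskerRight, Category.assoc]
    simp only [whisker_assoc, Category.assoc, Iso.inv_hom_id_assoc]
    rw [tensor_whiskerLeft]
    simp only [Category.assoc, Iso.inv_hom_id_assoc]
    rw [reassoc_of% hc']

/-- Restriction of the left action along an algebra homomorphism. -/
abbrev restrictLeft (M : DaggerBimod A B) (φ : C.X ⟶ A.X) (hm : μ[C.X] ≫ φ = (φ ⊗ₘ φ) ≫ μ[A.X])
    (hu : η[C.X] ≫ φ = η[A.X])
    (hc : φ ▷ A.X ≫ μ[A.X] ≫ η[A.X]† = C.X ◁ φ† ≫ μ[C.X] ≫ η[C.X]†) : DaggerBimod C B where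
  X := M.X
  actLeft := φ ▷ M.X ≫ M.actLeft
  one_actLeft := by
    rw [← comp_whiskerRight_assoc, hu, M.one_actLeft]
  left_assoc := by
    rw [← comp_whiskerRight_assoc, hm, comp_whiskerRight_assoc, M.left_assoc,
      MonoidalCategory.tensorHom_def']
    simp only [whiskerLeft_comp, Category.assoc]
    rw [whisker_exchange_assoc]
    simp
  actRight := M.actRight
  actRight_one := M.actRight_one
  right_assoc := M.right_assoc
  middle_assoc := by
    rw [whisker_exchange_assoc, comp_whiskerRight_assoc, M.middle_assoc]
    simp
  left_dag := by
    conv_rhs => rw [← M.left_dag]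
    have hc' : φ ▷ A.X ▷ M.X ≫ frobCap A.X ▷ M.X = (C.X ◁ φ†) ▷ M.X ≫ frobCap C.X ▷ M.X := by
      rw [frobCap, frobCap, ← comp_whiskerRight, ← comp_whiskerRight, hc]
    rw [← whisker_exchange_assoc, CStarCategory.dag_comp, dag_wr]
    simp only [whiskerLeft_comp, Category.assoc]
    rw [associator_inv_naturality_middle_assoc, ← reassoc_of% hc']
    simp
  right_dag := M.right_dag

/-- A homomorphism out of `M ⊗ N` that factors through `relIdem` isometrically. -/
theorem isIsometry_of_outer {M : DaggerBimod A B} {N : DaggerBimod B C} {L : DaggerBimod A C}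
    (g : outer M N ⟶ L) (h : g.hom ≫ g.hom† = relIdem M N) :
    IsIsometry (inclHom M N ≫ g) := by
  apply hom_ext
  change ((inclHom M N).hom ≫ g.hom) ≫ ((inclHom M N).hom ≫ g.hom)† = 𝟙 _
  rw [inclHom_hom, CStarCategory.dag_comp, Category.assoc, reassoc_of% h]
  simp

theorem isUnitary_of_outer {M : DaggerBimod A B} {N : DaggerBimod B C} {L : DaggerBimod A C}
    (g : outer M N ⟶ L) (h : g.hom ≫ g.hom† = relIdem M N) (h' : g.hom† ≫ g.hom = 𝟙 _) :
    IsUnitary (inclHom M N ≫ g) := by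
  refine ⟨isIsometry_of_outer g h, ?_⟩
  apply hom_ext
  change ((inclHom M N).hom ≫ g.hom)† ≫ ((inclHom M N).hom ≫ g.hom) = 𝟙 _
  rw [inclHom_hom, CStarCategory.dag_comp, Category.assoc, proj_incl_assoc, ← h, Category.assoc, h',
    Category.comp_id, h']

theorem sum_hom {κ : Type} (s : Finset κ) {M N : DaggerBimod A B} (f : κ → (M ⟶ N)) :
    (∑ k ∈ s, f k).hom = ∑ k ∈ s, (f k).hom :=
  map_sum (homLinear M N) f s

end DaggerBimod

/-- Orthogonal isometric inclusions of algebras that sum to the identity exhibit a direct sum. -/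
theorem isObjectDirectSum_of_isometries {κ : Type} [Fintype κ] (A : κ → SSFA T) (R : SSFA T)
    (i : ∀ k, (A k).X ⟶ R.X) (hi : ∀ k, i k ≫ (i k)† = 𝟙 _)
    (ho : ∀ k l, k ≠ l → i k ≫ (i l)† = 0) (h : ∑ k, (i k)† ≫ i k = 𝟙 R.X)
    (hm : ∀ k, μ[R.X] ≫ (i k)† = ((i k)† ⊗ₘ (i k)†) ≫ μ[(A k).X])
    (hu : ∀ k, η[R.X] ≫ (i k)† = η[(A k).X]) : IsObjectDirectSum (B := SSFA T) A R := by
  have hext : ∀ {W : T} {f g : W ⟶ R.X}, (∀ k, f ≫ (i k)† = g ≫ (i k)†) → f = g := by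
    intro W f g hfg
    rw [← Category.comp_id f, ← Category.comp_id g, ← h, Preadditive.comp_sum, Preadditive.comp_sum]
    exact Finset.sum_congr rfl fun k _ => by rw [reassoc_of% hfg k]
  have hu' : ∀ k, (η[(A k).X])† = i k ≫ (η[R.X])† := fun k => by rw [← hu]; simp
  have hmi : ∀ k, μ[(A k).X] ≫ i k = (i k ⊗ₘ i k) ≫ μ[R.X] := by
    intro k
    apply hext
    intro l
    rw [Category.assoc, Category.assoc, hm, tensorHom_comp_tensorHom_assoc]
    by_cases hkl : k = l
    · subst hkl
      rw [hi]; simp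
    · rw [ho k l hkl, SSFA.zero_tensorHom]; simp
  -- `e1` and `e2` express that `A k` is a two-sided ideal of `R`: a product with one factor in `A
  -- k` depends only on the `A k`-component of the other.
  have e1 : ∀ k, (i k)† ▷ (A k).X ≫ μ[(A k).X] ≫ i k = R.X ◁ i k ≫ μ[R.X] := by
    intro k
    apply hext
    intro l
    simp only [Category.assoc, hm, MonoidalCategory.tensorHom_def']
    by_cases hkl : k = l
    · subst hkl
      rw [hi, ← whiskerLeft_comp_assoc, hi]; simp
    · rw [ho k l hkl, ← whiskerLeft_comp_assoc, ho k l hkl]; simp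
  have e2 : ∀ k, (A k).X ◁ (i k)† ≫ μ[(A k).X] ≫ i k = i k ▷ R.X ≫ μ[R.X] := by
    intro k
    apply hext
    intro l
    simp only [Category.assoc, hm, MonoidalCategory.tensorHom_def]
    by_cases hkl : k = l
    · subst hkl
      rw [hi, ← comp_whiskerRight_assoc, hi]; simp
    · rw [ho k l hkl, ← comp_whiskerRight_assoc, ho k l hkl]; simp
  let inc : ∀ k, DaggerBimod (A k) R := fun k => restrictRight (regular (A k)) (i k)† (hm k) (hu k)
    (by
      rw [CStarCategory.dag_dag, hu', ← reassoc_of% e2])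
  let pr : ∀ k, DaggerBimod R (A k) := fun k => restrictLeft (regular (A k)) (i k)† (hm k) (hu k)
    (by
      rw [CStarCategory.dag_dag, hu', ← reassoc_of% e1])
  -- The idempotent contains the factor `i l ≫ (i k)†`. Hence it vanishes for `k ≠ l`, and for `k =
  -- l` it is `μ ≫ μ†`, whose splitting is `A k` by separability.
  have hrel : ∀ k l, relIdem (inc k) (pr l) = (A k).X ◁ ((μ[(A l).X])† ≫ (i l ≫ (i k)†) ▷ (A l).X) ≫
      (α_ _ _ _).inv ≫ μ[(A k).X] ▷ (A l).X := by
    intro k l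
    rw [relIdem_eq_left]
    change (A k).X ◁ ((i l)† ▷ (A l).X ≫ μ[(A l).X])† ≫ (α_ _ _ _).inv ≫
      ((A k).X ◁ (i k)† ≫ μ[(A k).X]) ▷ (A l).X = _
    simp
  have hrel' : ∀ k, relIdem (pr k) (inc k) = μ[(A k).X] ≫ (μ[(A k).X])† := fun k => by
    rw [relIdem_eq_left]
    exact (A k).frob_left
  refine ⟨inc, pr, fun k => ?_, fun k l hkl => ?_, ?_⟩
  · let g : outer (inc k) (pr k) ⟶ regular (A k) :=
      { hom := μ[(A k).X]
        left_act_hom := (actLeftHom (regular (A k))).left_act_hom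
        right_act_hom := (actRightHom (regular (A k))).right_act_hom }
    refine ⟨inclHom _ _ ≫ g, isUnitary_of_outer g ?_ (A k).separable⟩
    rw [hrel, hi, id_whiskerRight, Category.comp_id, (A k).frob_left]
  · refine isZero_of_id (M := relTensor (inc k) (pr l)) ?_
    have : relIdem (inc k) (pr l) = 0 := by
      rw [hrel, ho l k hkl.symm]; simp
    rw [← incl_proj, ← incl_idem_assoc, this]
    simp
  -- These induce the isometries from the tensor product of `A k` with itself over `A k`, which is
  -- `A k`, into `R`.
  · let g : ∀ k, outer (pr k) (inc k) ⟶ regular R := fun k =>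
      { hom := μ[(A k).X] ≫ i k
        left_act_hom := by
          change ((α_ _ _ _).inv ≫ ((i k)† ▷ (A k).X ≫ μ[(A k).X]) ▷ (A k).X) ≫ μ[(A k).X] ≫ i k =
            R.X ◁ (μ[(A k).X] ≫ i k) ≫ μ[R.X]
          rw [whiskerLeft_comp_assoc, ← e1, whisker_exchange_assoc, Category.assoc,
            comp_whiskerRight_assoc, MonObj.mul_assoc_assoc]
          simp
        right_act_hom := by
          change ((α_ _ _ _).hom ≫ (A k).X ◁ ((A k).X ◁ (i k)† ≫ μ[(A k).X])) ≫ μ[(A k).X] ≫ i k =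
            (μ[(A k).X] ≫ i k) ▷ R.X ≫ μ[R.X]
          rw [comp_whiskerRight_assoc, ← e2, ← whisker_exchange_assoc, MonObj.mul_assoc_assoc]
          simp }
    have hg : ∀ k, (g k).hom ≫ (g k).hom† = relIdem (pr k) (inc k) := fun k => by
      change (μ[(A k).X] ≫ i k) ≫ (μ[(A k).X] ≫ i k)† = _
      rw [hrel', CStarCategory.dag_comp, Category.assoc, reassoc_of% hi k]
    refine ⟨fun k => inclHom _ _ ≫ g k, fun k => isIsometry_of_outer (g k) (hg k), ?_⟩
    apply hom_ext
    refine (sum_hom _ _).trans (Eq.trans (Finset.sum_congr rfl fun k _ => ?_) h)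
    change ((inclHom _ _).hom ≫ (g k).hom)† ≫ (inclHom _ _).hom ≫ (g k).hom = _
    rw [inclHom_hom, CStarCategory.dag_comp, Category.assoc, proj_incl_assoc, hrel']
    change (μ[(A k).X] ≫ i k)† ≫ (μ[(A k).X] ≫ (μ[(A k).X])†) ≫ μ[(A k).X] ≫ i k = _
    have := (A k).separable
    simp [reassoc_of% this]

theorem SSFA.exists_directSum (r : Fin 2 → SSFA T) : ∃ R : SSFA T, IsObjectDirectSum r R := by
  obtain ⟨Z, i, hi, h⟩ :=
    (RigidCStarTensorCategory.semisimple (T := T)).exists_directSum fun k => (r k).X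
  have h' := h
  rw [Fin.sum_univ_two] at h
  have h0 : i 0 ≫ (i 0)† = 𝟙 _ := hi 0
  have h1 : i 1 ≫ (i 1)† = 𝟙 _ := hi 1
  have h01 := isometry_orthogonal h0 h1 h
  have h10 := isometry_orthogonal h1 h0 ((add_comm _ _).trans h)
  refine ⟨SSFA.sum (r 0) (r 1) (i 0) (i 1) h0 h1 h01 h10 h,
    isObjectDirectSum_of_isometries r _ i hi ?_ h' ?_ ?_⟩
  · simp [Fin.forall_fin_two, h01, h10]
  · rw [Fin.forall_fin_two]
    exact ⟨sumMul_left _ _ _ _ h0 h10, sumMul_right _ _ _ _ h1 h01⟩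
  · rw [Fin.forall_fin_two]
    constructor
    · change sumOne _ _ _ _ ≫ _ = _
      simp [sumOne, h0, h10]
    · change sumOne _ _ _ _ ≫ _ = _
      simp [sumOne, h1, h01]

/-- The endomorphism algebra of a regular bimodule is commutative. -/
theorem SSFA.regular_comm (R : SSFA T) (f g : regular R ⟶ regular R) : f ≫ g = g ≫ f := by
  apply hom_ext
  -- Bilinearity lets `f` and `g` act on different factors of a product, where they commute; `μ† ≫ μ
  -- = 𝟙` makes every element a product.
  have : (μ[R.X])† ≫ μ[R.X] ≫ f.hom ≫ g.hom = (μ[R.X])† ≫ μ[R.X] ≫ g.hom ≫ f.hom := by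
    rw [← Category.assoc (μ[R.X]), ← Category.assoc (μ[R.X]), central_left, central_right,
      Category.assoc, Category.assoc, central_right, central_left, whisker_exchange_assoc]
  rwa [reassoc_of% R.separable, reassoc_of% R.separable] at this

/-- The summands are the corners at the projections that span the endomorphisms of `regular R`. A
bilinear endomorphism of a corner extends by zero to `R`, is there a combination of the projections,
and so restricts to a scalar; orthogonality and the sum of the projections make the corners a direct
sum. -/
theorem SSFA.exists_decomposition (R : SSFA T) : ∃ (n : ℕ) (r : Fin n → SSFA T),
    (∀ k, IsSimpleObj (regular (r k))) ∧ IsObjectDirectSum r R := by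
  obtain ⟨n, p, hd, h0, hp, ho, h1, hs⟩ := CStarCategory.exists_projections R.regular_comm
  choose V i hi hip using fun k => (RigidCStarTensorCategory.semisimple (T := T)).exists_splitting
    (p k).hom (congrArg Bimod.Hom.hom (hd k)) (congrArg Bimod.Hom.hom (hp k))
  have hi : ∀ k, i k ≫ (i k)† = 𝟙 (V k) := hi
  have hipj : ∀ k l, k ≠ l → i k ≫ (p l).hom = 0 := fun k l hkl => by
    rw [← comp_proj (hi k) (hip k), Category.assoc]
    have : (p k).hom ≫ (p l).hom = 0 := congrArg Bimod.Hom.hom (ho k l hkl)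
    rw [this, Limits.comp_zero]
  refine ⟨n, fun k => corner R (p k) (i k) (hi k) (hip k), fun k => ?_,
    isObjectDirectSum_of_isometries _ R i hi (fun k l hkl => ?_) ?_ (fun k => ?_) (fun k => rfl)⟩
  · refine finrank_eq_one (𝟙 _) (fun h => h0 k ?_) fun f => ?_
    · have h : 𝟙 (V k) = 0 := congrArg Bimod.Hom.hom h
      apply hom_ext
      rw [← hip, ← Category.id_comp (i k), h]
      simp
    · have hl := f.left_act_hom
      have hr := f.right_act_hom
      change cornerMul R (i k) ≫ f.hom = V k ◁ f.hom ≫ cornerMul R (i k) at hl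
      change cornerMul R (i k) ≫ f.hom = f.hom ▷ V k ≫ cornerMul R (i k) at hr
      have hm := cornerMul_comp (hi k) (hip k)
      have hF : ((i k)† ≫ f.hom ≫ i k) ≫ (p k).hom = (i k)† ≫ f.hom ≫ i k := by
        rw [Category.assoc, Category.assoc, comp_proj (hi k) (hip k)]
      let F : regular R ⟶ regular R :=
        { hom := (i k)† ≫ f.hom ≫ i k
          left_act_hom := by
            change μ[R.X] ≫ (i k)† ≫ f.hom ≫ i k = R.X ◁ ((i k)† ≫ f.hom ≫ i k) ≫ μ[R.X]
            rw [← Category.assoc, mul_corner (hi k) (hip k), Category.assoc, reassoc_of% hl, hm,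
              ← id_tensorHom, tensorHom_comp_tensorHom_assoc, tensorHom_comp_tensorHom_assoc,
              Category.comp_id, hip, Category.assoc, MonoidalCategory.tensorHom_def',
              Category.assoc, ← central_left, central_right, ← whiskerLeft_comp_assoc, hF]
          right_act_hom := by
            change μ[R.X] ≫ (i k)† ≫ f.hom ≫ i k = ((i k)† ≫ f.hom ≫ i k) ▷ R.X ≫ μ[R.X]
            rw [← Category.assoc, mul_corner (hi k) (hip k), Category.assoc, reassoc_of% hr, hm,
              ← tensorHom_id, tensorHom_comp_tensorHom_assoc, tensorHom_comp_tensorHom_assoc,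
              Category.comp_id, hip, Category.assoc, MonoidalCategory.tensorHom_def,
              Category.assoc, ← central_right, central_left, ← comp_whiskerRight_assoc, hF] }
      obtain ⟨c, hc⟩ := hs F
      refine ⟨c k, ?_⟩
      apply hom_ext
      change c k • 𝟙 (V k) = f.hom
      have h2 : i k ≫ F.hom ≫ (i k)† = f.hom := by
        change i k ≫ ((i k)† ≫ f.hom ≫ i k) ≫ (i k)† = f.hom
        rw [Category.assoc, Category.assoc, hi, reassoc_of% hi k, Category.comp_id]
      rw [← h2, hc, sum_hom, Preadditive.sum_comp, Preadditive.comp_sum, Finset.sum_eq_single k]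
      · rw [smul_hom, Linear.smul_comp, Linear.comp_smul, ← Category.assoc,
          comp_proj (hi k) (hip k), hi]
      · intro l _ hl
        rw [smul_hom, Linear.smul_comp, Linear.comp_smul, ← Category.assoc, hipj k l hl.symm]
        simp
      · simp
  · rw [← proj_comp (hi l) (hip l), ← Category.assoc, hipj k l hkl, Limits.zero_comp]
  · rw [Finset.sum_congr rfl fun k _ => hip k, ← sum_hom, h1]
    rfl
  · exact mul_corner (hi k) (hip k)

end

/-! ### Adjoints of retracts and isometric embeddings in a C*-2-category -/

section
open Bicategory
variable {B : Type u} [Bicategory.{w, v} B] [CStarBicategory B] {r s : B}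

/-- A retract of a 1-morphism with a left adjoint has a left adjoint, if idempotents split. -/
theorem exists_leftAdjoint_of_retract (hss : IsSemisimpleCStar (s ⟶ r)) {X X' : r ⟶ s}
    (i : X ⟶ X') (p : X' ⟶ X) (hip : i ≫ p = 𝟙 X) {Y' : s ⟶ r} (d : Y' ⊣ X') :
    ∃ Y : s ⟶ r, Nonempty (Y ⊣ X) := by
  -- The mate of the idempotent `p ≫ i`. As `d` is an arbitrary duality, it need not be self-adjoint
  -- even when `p = i†`.
  let q := (Bicategory.conjugateEquiv d d).symm (p ≫ i)
  have hq : q ≫ q = q := by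
    rw [Bicategory.conjugateEquiv_symm_comp, Category.assoc, reassoc_of% hip]
  obtain ⟨Y, a, b, hab, hba⟩ := CStarCategory.exists_splitting_of_idem hss q hq
  have h1 : b ≫ q ≫ a = 𝟙 Y := by
    rw [← hab, Category.assoc, hba, Category.comp_id, hba]
  have h2 : Bicategory.conjugateEquiv d d q = p ≫ i := Equiv.apply_symm_apply _ _
  refine ⟨Y, ⟨{ unit := d.unit ≫ a ▷ X' ≫ Y ◁ p
                counit := X ◁ b ≫ i ▷ Y' ≫ d.counit
                left_triangle := ?_
                right_triangle := ?_ }⟩⟩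
  · have h3 := Bicategory.conjugateEquiv_symm_apply' d d (p ≫ i)
    change q = _ at h3
    calc _ = d.unit ▷ Y ≫ a ▷ X' ▷ Y ⊗≫ Y ◁ (p ▷ Y ≫ X ◁ b) ⊗≫ Y ◁ (i ▷ Y' ≫ d.counit) := by
          bicategory
      _ = d.unit ▷ Y ⊗≫ (a ▷ (X' ≫ Y) ≫ Y ◁ (X' ◁ b)) ⊗≫ Y ◁ ((p ≫ i) ▷ Y' ≫ d.counit) := by
          rw [← whisker_exchange]; bicategory
      _ = (d.unit ▷ Y ≫ (Y' ≫ X') ◁ b) ⊗≫ (a ▷ (X' ≫ Y') ≫ Y ◁ ((p ≫ i) ▷ Y' ≫ d.counit)) := by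
          rw [← whisker_exchange]; bicategory
      _ = 𝟙 _ ⊗≫ b ⊗≫ d.unit ▷ Y' ⊗≫ Y' ◁ ((p ≫ i) ▷ Y' ≫ d.counit) ⊗≫ a ⊗≫ 𝟙 _ := by
          rw [← whisker_exchange, ← whisker_exchange]; bicategory
      _ = 𝟙 _ ⊗≫ (b ≫ ((λ_ _).inv ≫ d.unit ▷ Y' ≫ (α_ _ _ _).hom ≫ Y' ◁ (p ≫ i) ▷ Y' ≫
            Y' ◁ d.counit ≫ (ρ_ _).hom) ≫ a) ⊗≫ 𝟙 _ := by
          bicategory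
      _ = _ := by
          rw [← h3, h1]; bicategory
  · have h3 := Bicategory.conjugateEquiv_apply' d d q
    rw [h2] at h3
    calc _ = X ◁ d.unit ⊗≫ X ◁ a ▷ X' ⊗≫ ((X ≫ Y) ◁ p ≫ (X ◁ b ≫ i ▷ Y' ≫ d.counit) ▷ X) := by
          bicategory
      _ = X ◁ d.unit ⊗≫ (X ◁ (a ≫ b) ≫ i ▷ Y') ▷ X' ⊗≫ d.counit ▷ X' ⊗≫ p ⊗≫ 𝟙 _ := by
          rw [whisker_exchange]; bicategory
      _ = (X ◁ d.unit ≫ i ▷ (Y' ≫ X')) ⊗≫ X' ◁ q ▷ X' ⊗≫ d.counit ▷ X' ⊗≫ p ⊗≫ 𝟙 _ := by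
          rw [hab, whisker_exchange]; bicategory
      _ = 𝟙 _ ⊗≫ i ⊗≫ ((ρ_ _).inv ≫ X' ◁ d.unit ≫ X' ◁ q ▷ X' ≫ (α_ _ _ _).inv ≫
            d.counit ▷ X' ≫ (λ_ _).hom) ⊗≫ p ⊗≫ 𝟙 _ := by
          rw [whisker_exchange]; bicategory
      _ = 𝟙 _ ⊗≫ (i ≫ p) ≫ (i ≫ p) ⊗≫ 𝟙 _ := by
          rw [← h3]; bicategory
      _ = _ := by
          rw [hip]; bicategory

theorem isIsometry_comp {C : Type u} [Category.{v} C] [CStarCategory C] {X Y Z : C} {f : X ⟶ Y}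
    {g : Y ⟶ Z} (hf : IsIsometry f) (hg : IsIsometry g) : IsIsometry (f ≫ g) := by
  have hf : f ≫ f† = 𝟙 X := hf
  have hg : g ≫ g† = 𝟙 Y := hg
  change (f ≫ g) ≫ (f ≫ g)† = 𝟙 X
  rw [CStarCategory.dag_comp, Category.assoc, reassoc_of% hg, hf]

/-- If `𝟙 r` embeds isometrically in `L ≫ L'` then every `X` does so in `L ≫ L' ≫ X`. -/
theorem exists_isometry_left {r t : B} {L : r ⟶ t} {L' : t ⟶ r} {j : 𝟙 r ⟶ L ≫ L'}
    (hj : IsIsometry j) {s : B} (X : r ⟶ s) : ∃ i : X ⟶ L ≫ (L' ≫ X), IsIsometry i := by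
  have hj : j ≫ j† = 𝟙 _ := hj
  refine ⟨(λ_ X).inv ≫ j ▷ X ≫ (α_ _ _ _).hom, ?_⟩
  have h1 : ((λ_ X).inv)† = (λ_ X).hom := by
    rw [← CStarBicategory.dag_leftUnitor, CStarCategory.dag_dag]
  change ((λ_ X).inv ≫ j ▷ X ≫ (α_ _ _ _).hom) ≫ ((λ_ X).inv ≫ j ▷ X ≫ (α_ _ _ _).hom)† = _
  simp only [CStarCategory.dag_comp, CStarBicategory.dag_associator, h1,
    CStarBicategory.dag_whiskerRight, Category.assoc, Iso.hom_inv_id_assoc]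
  rw [← Bicategory.comp_whiskerRight_assoc, hj]
  simp

theorem exists_isometry_right {r t : B} {L : r ⟶ t} {L' : t ⟶ r} {j : 𝟙 r ⟶ L ≫ L'}
    (hj : IsIsometry j) {s : B} (X : s ⟶ r) : ∃ i : X ⟶ (X ≫ L) ≫ L', IsIsometry i := by
  have hj : j ≫ j† = 𝟙 _ := hj
  refine ⟨(ρ_ X).inv ≫ X ◁ j ≫ (α_ _ _ _).inv, ?_⟩
  have h1 : ((ρ_ X).inv)† = (ρ_ X).hom := by
    rw [← CStarBicategory.dag_rightUnitor, CStarCategory.dag_dag]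
  have h2 : ((α_ X L L').inv)† = (α_ X L L').hom := by
    rw [← CStarBicategory.dag_associator, CStarCategory.dag_dag]
  change ((ρ_ X).inv ≫ X ◁ j ≫ (α_ _ _ _).inv) ≫ ((ρ_ X).inv ≫ X ◁ j ≫ (α_ _ _ _).inv)† = _
  simp only [CStarCategory.dag_comp, h1, h2,
    CStarBicategory.dag_whiskerLeft, Category.assoc, Iso.inv_hom_id_assoc]
  rw [← Bicategory.whiskerLeft_comp_assoc, hj]
  simp

end

section
open Bicategory
variable {B : Type u} [Bicategory.{w, v} B] {a b : B}

/-- An adjunction from triangle identities with explicit associators and unitors. -/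
abbrev adjunctionMk {f : a ⟶ b} {g : b ⟶ a} (unit : 𝟙 a ⟶ f ≫ g) (counit : g ≫ f ⟶ 𝟙 b)
    (h : unit ▷ f ≫ (α_ f g f).hom ≫ f ◁ counit ≫ (ρ_ f).hom = (λ_ f).hom)
    (h' : g ◁ unit ≫ (α_ g f g).inv ≫ counit ▷ g ≫ (λ_ g).hom = (ρ_ g).hom) : f ⊣ g where
  unit := unit
  counit := counit
  left_triangle := by
    rw [← h]
    simp only [leftZigzag]
    bicategory
  right_triangle := by
    rw [← h']
    simp only [rightZigzag]
    bicategory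

end

/-! ### Rigidity: adjunctions between regular modules -/

section
open MonoidalCategory MonObj DaggerBimod
variable {T : Type u} [Category.{v} T] [MonoidalCategory T] [RigidCStarTensorCategory T]

section
variable {A B : SSFA T} (X : DaggerBimod A B) (Y : DaggerBimod B A)
  (c : regular B ⟶ outer Y X) (e : outer X Y ⟶ regular A)

/-- An adjunction of bimodules from morphisms for the outer actions. -/
noncomputable abbrev adjunctionOfOuter (he : relIdem X Y ≫ e.hom = e.hom)
    (h₁ : c.hom ▷ Y.X ≫ (α_ Y.X X.X Y.X).hom ≫ Y.X ◁ e.hom ≫ Y.actRight = Y.actLeft)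
    (h₂ : X.X ◁ c.hom ≫ (α_ X.X Y.X X.X).inv ≫ e.hom ▷ X.X ≫ X.actLeft = X.actRight) :
    Bicategory.Adjunction (B := SSFA T) Y X :=
  adjunctionMk (B := SSFA T) (c ≫ projHom Y X) (inclHom X Y ≫ e)
    (by
      apply hom_ext
      change (relWhiskerRight (c ≫ projHom Y X) Y).hom ≫ (relAssocHom Y X Y).hom ≫
        (relWhiskerLeft Y (inclHom X Y ≫ e)).hom ≫ (relRightUnitorHom Y).hom =
          (relLeftUnitorHom Y).hom
      rw [← cancel_epi (relProj (regular B) Y), proj_relWhiskerRight_assoc, comp_hom, projHom_hom,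
        comp_whiskerRight_assoc, proj_assoc_assoc, proj_relWhiskerLeft_assoc, proj_rightUnitor,
        proj_leftUnitor, comp_hom, inclHom_hom, ← whiskerLeft_comp_assoc, proj_incl_assoc, he, h₁])
    (by
      apply hom_ext
      change (relWhiskerLeft X (c ≫ projHom Y X)).hom ≫ (relAssocHom X Y X).hom† ≫
        (relWhiskerRight (inclHom X Y ≫ e) X).hom ≫ (relLeftUnitorHom X).hom =
          (relRightUnitorHom X).hom
      rw [← cancel_epi (relProj X (regular B)), proj_relWhiskerLeft_assoc, comp_hom, projHom_hom,
        whiskerLeft_comp_assoc, proj_assoc_dag_assoc, proj_relWhiskerRight_assoc, proj_leftUnitor,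
        proj_rightUnitor, comp_hom, inclHom_hom, ← comp_whiskerRight_assoc, proj_incl_assoc, he, h₂])

end

variable (T) in
/-- The tensor unit as a separable standard Frobenius algebra. -/
abbrev SSFA.unitAlg : SSFA T :=
  ofMul (𝟙_ T) (λ_ (𝟙_ T)).hom (𝟙 _) (by simp) (by simp [unitors_equal]) (by monoidal)
    (by simp; monoidal) (by simp) (fun f => by
      have : 𝟙_ T ◁ f = f ▷ 𝟙_ T := by
        rw [← cancel_mono (λ_ (𝟙_ T)).hom, leftUnitor_naturality]
        rw [unitors_equal, rightUnitor_naturality]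
      rw [this])

open SSFA

theorem actLeft_unitAlg {B : SSFA T} (M : DaggerBimod (unitAlg T) B) : M.actLeft = (λ_ M.X).hom := by
  have := M.one_actLeft
  rwa [show η[(unitAlg T).X] = 𝟙 _ from rfl, id_whiskerRight, Category.id_comp] at this

theorem actRight_unitAlg {B : SSFA T} (M : DaggerBimod B (unitAlg T)) :
    M.actRight = (ρ_ M.X).hom := by
  have := M.actRight_one
  rwa [show η[(unitAlg T).X] = 𝟙 _ from rfl, whiskerLeft_id, Category.id_comp] at this

theorem relIdem_unitAlg {A B : SSFA T} (M : DaggerBimod A (unitAlg T))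
    (N : DaggerBimod (unitAlg T) B) : relIdem M N = 𝟙 _ := by
  rw [relIdem_eq_left, actLeft_unitAlg, actRight_unitAlg]
  simp

/-- An object of `T` as a bimodule over the tensor unit. -/
abbrev trivBimod (X : T) : DaggerBimod (unitAlg T) (unitAlg T) where
  X := X
  actLeft := (λ_ X).hom
  one_actLeft := by
    change 𝟙 _ ▷ X ≫ _ = _
    simp
  left_assoc := by
    change (λ_ _).hom ▷ X ≫ _ = _
    simp
  actRight := (ρ_ X).hom
  actRight_one := by
    change X ◁ 𝟙 _ ≫ _ = _
    simp
  right_assoc := by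
    change X ◁ (λ_ _).hom ≫ _ = _
    monoidal
  middle_assoc := by simp
  left_dag := by
    change 𝟙_ T ◁ ((λ_ X).hom)† ≫ (α_ _ _ _).inv ≫ ((λ_ (𝟙_ T)).hom ≫ (𝟙 (𝟙_ T))†) ▷ X ≫ (λ_ X).hom = _
    simp
  right_dag := by
    change ((ρ_ X).hom)† ▷ 𝟙_ T ≫ (α_ _ _ _).hom ≫ X ◁ ((λ_ (𝟙_ T)).hom ≫ (𝟙 (𝟙_ T))†) ≫ (ρ_ X).hom = _
    simp

/-- The algebra `A` as an `A`-`𝟙_ T`-bimodule. -/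
abbrev leftReg (A : SSFA T) : DaggerBimod A (unitAlg T) :=
  restrictRight (regular A) η[A.X]
    (by
      change (λ_ (𝟙_ T)).hom ≫ _ = _
      rw [MonoidalCategory.tensorHom_def', Category.assoc, MonObj.one_mul, leftUnitor_naturality])
    (Category.id_comp _)
    (by
      change _ = (η[A.X])† ▷ 𝟙_ T ≫ (λ_ (𝟙_ T)).hom ≫ (𝟙 (𝟙_ T))†
      rw [MonObj.mul_one_assoc, dag_id, Category.comp_id, unitors_equal, rightUnitor_naturality])

/-- The algebra `A` as a `𝟙_ T`-`A`-bimodule. -/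
abbrev rightReg (A : SSFA T) : DaggerBimod (unitAlg T) A :=
  restrictLeft (regular A) η[A.X]
    (by
      change (λ_ (𝟙_ T)).hom ≫ _ = _
      rw [MonoidalCategory.tensorHom_def', Category.assoc, MonObj.one_mul, leftUnitor_naturality])
    (Category.id_comp _)
    (by
      change _ = 𝟙_ T ◁ (η[A.X])† ≫ (λ_ (𝟙_ T)).hom ≫ (𝟙 (𝟙_ T))†
      rw [MonObj.one_mul_assoc, dag_id, Category.comp_id, leftUnitor_naturality])

/-- A morphism of `T` as a homomorphism of bimodules over the tensor unit. -/
abbrev homOfUnitAlg {M N : DaggerBimod (unitAlg T) (unitAlg T)} (f : M.X ⟶ N.X) : M ⟶ N where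
  hom := f
  left_act_hom := by
    rw [actLeft_unitAlg, actLeft_unitAlg]
    exact (leftUnitor_naturality f).symm
  right_act_hom := by
    rw [actRight_unitAlg, actRight_unitAlg]
    exact (rightUnitor_naturality f).symm

/-- The multiplication as a homomorphism of bimodules. -/
abbrev mulHom (A : SSFA T) : outer (leftReg A) (rightReg A) ⟶ regular A where
  hom := μ[A.X]
  left_act_hom := (actLeftHom (regular A)).left_act_hom
  right_act_hom := (actRightHom (regular A)).right_act_hom

theorem leftReg_actRight (A : SSFA T) : (leftReg A).actRight = (ρ_ A.X).hom :=
  actRight_unitAlg (leftReg A)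

theorem rightReg_actLeft (A : SSFA T) : (rightReg A).actLeft = (λ_ A.X).hom :=
  actLeft_unitAlg (rightReg A)

/-- The adjunction between the two regular modules whose counit is the multiplication. -/
noncomputable abbrev adjunctionMul (A : SSFA T) :
    Bicategory.Adjunction (B := SSFA T) (rightReg A) (leftReg A) :=
  adjunctionOfOuter (leftReg A) (rightReg A)
    (homOfUnitAlg (M := regular (unitAlg T)) (N := outer (rightReg A) (leftReg A)) (frobCup A.X))
    (mulHom A)
    (by rw [relIdem_unitAlg, Category.id_comp])
    (by
      change frobCup A.X ▷ A.X ≫ (α_ _ _ _).hom ≫ A.X ◁ μ[A.X] ≫ μ[A.X] = (rightReg A).actLeft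
      have := A.cup_right
      rw [rightReg_actLeft, reassoc_of% this, A.separable, Category.comp_id])
    (by
      change A.X ◁ frobCup A.X ≫ (α_ _ _ _).inv ≫ μ[A.X] ▷ A.X ≫ μ[A.X] = (leftReg A).actRight
      have := A.cup_left
      rw [leftReg_actRight, reassoc_of% this, A.separable, Category.comp_id])

/-- The adjunction between the two regular modules whose unit is the comultiplication. -/
noncomputable abbrev adjunctionComul (A : SSFA T) :
    Bicategory.Adjunction (B := SSFA T) (leftReg A) (rightReg A) :=
  adjunctionOfOuter (rightReg A) (leftReg A) (dagHom (mulHom A))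
    (homOfUnitAlg (M := outer (rightReg A) (leftReg A)) (N := regular (unitAlg T)) (frobCap A.X))
    (by
      have : relIdem (rightReg A) (leftReg A) = μ[A.X] ≫ (μ[A.X])† := by
        rw [relIdem_eq_left]
        exact A.frob_left
      change relIdem (rightReg A) (leftReg A) ≫ frobCap A.X = frobCap A.X
      rw [this, frobCap, Category.assoc, reassoc_of% A.separable])
    (by
      change (μ[A.X])† ▷ A.X ≫ (α_ _ _ _).hom ≫ A.X ◁ (μ[A.X] ≫ (η[A.X])†) ≫ (leftReg A).actRight =
        μ[A.X]
      have := A.frob_right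
      rw [leftReg_actRight, whiskerLeft_comp, Category.assoc, reassoc_of% this, A.counit_right,
        Category.comp_id])
    (by
      change A.X ◁ (μ[A.X])† ≫ (α_ _ _ _).inv ≫ (μ[A.X] ≫ (η[A.X])†) ▷ A.X ≫ (rightReg A).actLeft =
        μ[A.X]
      have := A.frob_left
      rw [rightReg_actLeft, comp_whiskerRight, Category.assoc, reassoc_of% this, A.counit_left,
        Category.comp_id])

/-- The adjunction of bimodules over the tensor unit given by a duality in `T`. -/
noncomputable abbrev adjunctionOfPairing (P : DaggerBimod (unitAlg T) (unitAlg T)) (Y : T)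
    [ExactPairing Y P.X] : Bicategory.Adjunction (B := SSFA T) (trivBimod Y) P :=
  adjunctionOfOuter P (trivBimod Y)
    (homOfUnitAlg (M := regular (unitAlg T)) (N := outer (trivBimod Y) P) (η_ Y P.X))
    (homOfUnitAlg (M := outer P (trivBimod Y)) (N := regular (unitAlg T)) (ε_ Y P.X))
    (by rw [relIdem_unitAlg, Category.id_comp])
    (by
      have := ExactPairing.evaluation_coevaluation Y P.X
      change η_ Y P.X ▷ Y ≫ (α_ _ _ _).hom ≫ Y ◁ ε_ Y P.X ≫ (ρ_ Y).hom = (λ_ Y).hom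
      rw [reassoc_of% this]; simp)
    (by
      have := ExactPairing.coevaluation_evaluation Y P.X
      rw [actLeft_unitAlg, actRight_unitAlg]
      change P.X ◁ η_ Y P.X ≫ (α_ _ _ _).inv ≫ ε_ Y P.X ▷ P.X ≫ (λ_ P.X).hom = (ρ_ P.X).hom
      rw [reassoc_of% this]; simp)

/-- The regular bimodule embeds isometrically in the free bimodule. -/
theorem exists_isometry_regular (A : SSFA T) :
    ∃ j : 𝟙 A ⟶ Bicategory.toCategoryStruct.comp (leftReg A) (rightReg A), IsIsometry j := by
  refine ⟨(dagHom (mulHom A) ≫ projHom (leftReg A) (rightReg A) :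
    regular A ⟶ relTensor (leftReg A) (rightReg A)), hom_ext ?_⟩
  change ((μ[A.X])† ≫ relProj (leftReg A) (rightReg A)) ≫
    ((μ[A.X])† ≫ relProj (leftReg A) (rightReg A))† = 𝟙 A.X
  rw [CStarCategory.dag_comp, CStarCategory.dag_dag, CStarCategory.dag_dag, Category.assoc,
    proj_incl_assoc, relIdem_unitAlg, Category.id_comp, A.separable]

/-- The isometry `μ†` embeds the identities of `A` and `B` in free bimodules, so `M` is a retract of
a composite of `leftReg A`, a bimodule `P` over the tensor unit, and `rightReg B`. The outer two
have left adjoints by `adjunctionMul` and `adjunctionComul`; `P` has one because its underlying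
object has a dual in `T`. -/
theorem exists_leftAdjoint {A B : SSFA T} (M : A ⟶ B) :
    ∃ Y : B ⟶ A, Nonempty (Bicategory.Adjunction Y M) := by
  obtain ⟨j, hj⟩ := exists_isometry_regular A
  obtain ⟨k, hk⟩ := exists_isometry_regular B
  obtain ⟨i₁, hi₁⟩ := exists_isometry_right hk M
  obtain ⟨i₂, hi₂⟩ := exists_isometry_left hj
    (Bicategory.toCategoryStruct.comp M (show B ⟶ unitAlg T from leftReg B))
  have hi₃ : IsIsometry (Bicategory.whiskerRight i₂ (show unitAlg T ⟶ B from rightReg B)) := by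
    have h : i₂ ≫ i₂† = 𝟙 _ := hi₂
    unfold IsIsometry
    rw [CStarBicategory.dag_whiskerRight, ← Bicategory.comp_whiskerRight, h,
      Bicategory.id_whiskerRight]
  have hi : _ ≫ _ = 𝟙 _ := isIsometry_comp hi₁ hi₃
  let P : unitAlg T ⟶ unitAlg T := (show unitAlg T ⟶ A from rightReg A) ≫ M ≫
    (show B ⟶ unitAlg T from leftReg B)
  obtain ⟨Y, ⟨hY⟩⟩ := RigidCStarTensorCategory.exists_dual (DaggerBimod.toBimod P).X
  have d₁ := adjunctionOfPairing P Y
  have d₂ := (d₁.comp (adjunctionMul A))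
  have d₃ := ((adjunctionComul B).comp d₂)
  exact exists_leftAdjoint_of_retract (DaggerBimod.isSemisimple B A) _ _ hi d₃

end

section
variable {C : Type u} [Category.{v} C] [CStarCategory C]

instance {X Y : C} (f : X ⟶ Y) [IsIso f] : IsIso f† :=
  ⟨(inv f)†, by rw [← CStarCategory.dag_comp, IsIso.inv_hom_id, dag_id],
    by rw [← CStarCategory.dag_comp, IsIso.hom_inv_id, dag_id]⟩

theorem dag_inv {X Y : C} (f : X ⟶ Y) [IsIso f] : (inv f)† = inv (f†) := by
  apply IsIso.eq_inv_of_hom_inv_id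
  rw [← CStarCategory.dag_comp, IsIso.inv_hom_id, dag_id]

end

/-! ### Twists of separable Frobenius algebras -/

section
open MonoidalCategory MonObj

section
variable {T : Type u} [Category.{v} T] [MonoidalCategory T]

/-- `k` commutes with left and right multiplications. -/
structure IsCentral {P : T} (m : P ⊗ P ⟶ P) (k : P ⟶ P) : Prop where
  left : m ≫ k = k ▷ P ≫ m
  right : m ≫ k = P ◁ k ≫ m

variable {P : T} {m : P ⊗ P ⟶ P} {u : 𝟙_ T ⟶ P}

/-- Left linear and right linear endomorphisms commute. -/
theorem comm_of_linear (h : P ◁ u ≫ m = (ρ_ P).hom) {G k : P ⟶ P} (hG : m ≫ G = P ◁ G ≫ m)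
    (hk : m ≫ k = k ▷ P ≫ m) : G ≫ k = k ≫ G := by
  -- A left linear endomorphism is right multiplication by its value on the unit.
  have e : G = (ρ_ P).inv ≫ P ◁ (u ≫ G) ≫ m := by
    rw [whiskerLeft_comp, Category.assoc, ← hG, reassoc_of% h, Iso.inv_hom_id_assoc]
  calc G ≫ k = (ρ_ P).inv ≫ P ◁ (u ≫ G) ≫ k ▷ P ≫ m := by
        conv_lhs => rw [e]
        rw [Category.assoc, Category.assoc, hk]
    _ = k ≫ (ρ_ P).inv ≫ P ◁ (u ≫ G) ≫ m := by
        rw [whisker_exchange_assoc]; simp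
    _ = k ≫ G := by rw [← e]

theorem IsCentral.inv {k : P ⟶ P} [IsIso k] (h : IsCentral m k) : IsCentral m (CategoryTheory.inv k) where
  left := by
    rw [← cancel_mono k, Category.assoc, Category.assoc, h.left, ← comp_whiskerRight_assoc]
    simp
  right := by
    rw [← cancel_mono k, Category.assoc, Category.assoc, h.right, ← whiskerLeft_comp_assoc]
    simp

end

section
variable {T : Type u} [Category.{v} T] [MonoidalCategory T] [CStarTensorCategory T]

/-- A separable Frobenius algebra, not necessarily standard. -/
structure IsFrobAlg {P : T} (m : P ⊗ P ⟶ P) (u : 𝟙_ T ⟶ P) : Prop where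
  one_mul : u ▷ P ≫ m = (λ_ P).hom
  mul_one : P ◁ u ≫ m = (ρ_ P).hom
  mul_assoc : m ▷ P ≫ m = (α_ P P P).hom ≫ P ◁ m ≫ m
  frob_left : P ◁ m† ≫ (α_ P P P).inv ≫ m ▷ P = m ≫ m†
  frob_right : m† ▷ P ≫ (α_ P P P).hom ≫ P ◁ m = m ≫ m†
  sep : m† ≫ m = 𝟙 P

/-- `G` is the right and `G'` the left multiplication by a self-adjoint element of the algebra. -/
structure IsMulPair {P : T} (m : P ⊗ P ⟶ P) (u : 𝟙_ T ⟶ P) (G G' : P ⟶ P) : Prop where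
  bal : G ▷ P ≫ m = P ◁ G' ≫ m
  right : m ≫ G = P ◁ G ≫ m
  left : m ≫ G' = G' ▷ P ≫ m
  one : u ≫ G = u ≫ G'
  dag_right : G† = G
  dag_left : G'† = G'

variable {P : T} {m : P ⊗ P ⟶ P} {u : 𝟙_ T ⟶ P}

theorem IsMulPair.inv {G G' : P ⟶ P} [IsIso G] [IsIso G'] (hm : P ◁ u ≫ m = (ρ_ P).hom)
    (h : IsMulPair m u G G') : IsMulPair m u (CategoryTheory.inv G) (CategoryTheory.inv G') where
  bal := by
    have h1 : CategoryTheory.inv G ▷ P ≫ G ▷ P ≫ m = m := by rw [← comp_whiskerRight_assoc]; simp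
    have h2 : P ◁ CategoryTheory.inv G' ≫ P ◁ G' ≫ m = m := by rw [← whiskerLeft_comp_assoc]; simp
    conv_lhs => rw [← h2, ← h.bal, ← whisker_exchange_assoc, h1]
  right := by
    rw [← cancel_mono G, Category.assoc, Category.assoc, h.right, ← whiskerLeft_comp_assoc]
    simp
  left := by
    rw [← cancel_mono G', Category.assoc, Category.assoc, h.left, ← comp_whiskerRight_assoc]
    simp
  one := by
    have hc := comm_of_linear hm h.right h.left
    rw [← cancel_mono G, ← cancel_mono G', Category.assoc, Category.assoc, IsIso.inv_hom_id_assoc,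
      Category.assoc, Category.assoc, hc, IsIso.inv_hom_id_assoc, h.one]
  dag_right := by rw [dag_inv]; simp [h.dag_right]
  dag_left := by rw [dag_inv]; simp [h.dag_left]

/-- The multiplication twisted by an element and a central endomorphism. -/
def twistMul (m : P ⊗ P ⟶ P) (G k : P ⟶ P) : P ⊗ P ⟶ P := G ▷ P ≫ m ≫ k

/-- The unit of the twisted multiplication. -/
noncomputable def twistOne (u : 𝟙_ T ⟶ P) (G k : P ⟶ P) [IsIso G] [IsIso k] : 𝟙_ T ⟶ P :=
  u ≫ inv G ≫ inv k

section Twist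
variable {G G' k : P ⟶ P}

theorem twistMul_eq (h : IsMulPair m u G G') : twistMul m G k = P ◁ G' ≫ m ≫ k := by
  rw [twistMul, ← Category.assoc, h.bal, Category.assoc]

theorem twistMul_dag (h : IsMulPair m u G G') (hk : k† = k) :
    (twistMul m G k)† = k ≫ m† ≫ G ▷ P := by
  simp [twistMul, hk, h.dag_right]

theorem twistMul_dag' (h : IsMulPair m u G G') (hk : k† = k) :
    (twistMul m G k)† = k ≫ m† ≫ P ◁ G' := by
  rw [twistMul_eq h]
  simp [hk, h.dag_left]

/-- `x ∘ (y · z) = (x ∘ y) · z` for the twisted multiplication `·`. -/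
theorem mul_twistMul (hf : IsFrobAlg m u) (h : IsMulPair m u G G') (hk : IsCentral m k) :
    m ▷ P ≫ twistMul m G k = (α_ P P P).hom ≫ P ◁ twistMul m G k ≫ m := by
  have e : P ◁ m ≫ P ◁ k ≫ m = P ◁ m ≫ m ≫ k := by rw [hk.right]
  rw [twistMul, ← comp_whiskerRight_assoc, h.right, comp_whiskerRight_assoc,
    reassoc_of% hf.mul_assoc, whiskerLeft_comp, whiskerLeft_comp, Category.assoc, Category.assoc, e]
  simp

theorem twistMul_mul (hf : IsFrobAlg m u) (hk : IsCentral m k) :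
    twistMul m G k ▷ P ≫ m = (α_ P P P).hom ≫ P ◁ m ≫ twistMul m G k := by
  rw [twistMul, comp_whiskerRight, comp_whiskerRight, Category.assoc, Category.assoc, ← hk.left,
    reassoc_of% hf.mul_assoc, whisker_exchange_assoc]
  simp

/-- Centrality for the original and for the twisted multiplication agree. -/
theorem IsCentral.twist (hf : IsFrobAlg m u) (h : IsMulPair m u G G') (hk : IsCentral m k)
    {n : P ⟶ P} (hn : IsCentral m n) : IsCentral (twistMul m G k) n where
  left := by
    have h1 := comm_of_linear hf.mul_one hk.right hn.left
    have h2 := comm_of_linear hf.mul_one h.right hn.left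
    rw [twistMul, Category.assoc, Category.assoc, h1, reassoc_of% hn.left,
      ← comp_whiskerRight_assoc, h2, comp_whiskerRight_assoc]
  right := by
    have h1 := comm_of_linear hf.mul_one hk.right hn.left
    rw [twistMul, Category.assoc, Category.assoc, h1, reassoc_of% hn.right,
      ← whisker_exchange_assoc]

variable [IsIso G] [IsIso k]

/-- Inserting a fixed element between the factors and applying a central map keeps associativity and
the Frobenius equation; invertibility corrects the unit. Separability is not automatic: it is
exactly the equation `hs`, which the choice of `k` has to achieve. -/
theorem isFrobAlg_twist (hf : IsFrobAlg m u) (h : IsMulPair m u G G') (hk : IsCentral m k)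
    (hkd : k† = k) (hs : k ≫ m† ≫ G ▷ P ≫ G ▷ P ≫ m ≫ k = 𝟙 P) :
    IsFrobAlg (twistMul m G k) (twistOne u G k) := by
  have hGk := comm_of_linear hf.mul_one h.right hk.left
  have hGG := comm_of_linear hf.mul_one h.right h.left
  have hkG := comm_of_linear hf.mul_one hk.right h.left
  have hfl : P ◁ (twistMul m G k)† ≫ (α_ P P P).inv ≫ (twistMul m G k) ▷ P =
      twistMul m G k ≫ (twistMul m G k)† := by
    have hd := congrArg CStarCategory.dag hk.left
    simp only [CStarCategory.dag_comp, dag_wr, hkd] at hd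
    calc _ = P ◁ k ≫ P ◁ m† ≫ (α_ P P P).inv ≫ (G ▷ P ≫ P ◁ G ≫ m) ▷ P ≫ k ▷ P := by
          rw [twistMul_dag h hkd, twistMul, ← whisker_exchange_assoc]
          monoidal
      _ = P ◁ k ≫ (P ◁ m† ≫ G ▷ (P ⊗ P)) ≫ (α_ P P P).inv ≫ m ▷ P ≫ G ▷ P ≫ k ▷ P := by
          rw [← h.right]; monoidal
      _ = P ◁ k ≫ G ▷ P ≫ m ≫ m† ≫ G ▷ P ≫ k ▷ P := by
          rw [whisker_exchange, Category.assoc, reassoc_of% hf.frob_left]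
      _ = _ := by
          rw [twistMul_dag h hkd, twistMul, whisker_exchange_assoc, ← reassoc_of% hk.right,
            ← comp_whiskerRight, hGk, comp_whiskerRight, ← reassoc_of% hd]
          simp
  refine ⟨?_, ?_, ?_, hfl, ?_, ?_⟩
  · rw [twistMul, twistOne, hk.left, ← comp_whiskerRight_assoc, ← comp_whiskerRight_assoc]
    have : (u ≫ inv G ≫ inv k) ≫ G ≫ k = u := by
      rw [hGk]; simp only [Category.assoc, IsIso.inv_hom_id_assoc, IsIso.inv_hom_id, Category.comp_id]
    rw [Category.assoc, this, hf.one_mul]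
  · rw [twistMul_eq h, twistOne, hk.right, ← whiskerLeft_comp_assoc, ← whiskerLeft_comp_assoc]
    have h1 : inv G ≫ G' = G' ≫ inv G := by
      rw [IsIso.inv_comp_eq, ← Category.assoc, hGG, Category.assoc, IsIso.hom_inv_id,
        Category.comp_id]
    have : (u ≫ inv G ≫ inv k) ≫ G' ≫ k = u := by
      rw [← hkG]; simp only [Category.assoc, IsIso.inv_hom_id_assoc]
      rw [h1, ← Category.assoc, ← h.one]
      simp
    rw [Category.assoc, this, hf.mul_one]
  · have e := mul_twistMul hf h hk
    calc _ = G ▷ P ▷ P ≫ m ▷ P ≫ k ▷ P ≫ G ▷ P ≫ m ≫ k := by simp [twistMul]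
      _ = G ▷ P ▷ P ≫ (m ▷ P ≫ twistMul m G k) ≫ k := by
          rw [← comp_whiskerRight_assoc k G, ← hGk, comp_whiskerRight_assoc,
            ← reassoc_of% hk.left]
          simp [twistMul]
      _ = (α_ P P P).hom ≫ G ▷ (P ⊗ P) ≫ P ◁ twistMul m G k ≫ m ≫ k := by
          rw [e]
          simp
      _ = _ := by
          rw [← whisker_exchange_assoc]
          rfl
  · have := congrArg CStarCategory.dag hfl
    simpa using this
  · rw [twistMul_dag h hkd, twistMul]
    simpa using hs

/-- The factor `k` drops out of the cup, so standardness of the twist does not depend on the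
normalization. This form leaves the quotient of the two multiplications on the right wire; the next
one leaves the inverse quotient on the left wire. -/
theorem twistOne_twistMul_dag [IsIso G'] (hf : IsFrobAlg m u) (h : IsMulPair m u G G')
    (hk : k† = k) :
    twistOne u G k ≫ (twistMul m G k)† = u ≫ m† ≫ P ◁ (inv G ≫ G') := by
  have h1 := congrArg CStarCategory.dag (h.inv hf.mul_one).right
  simp only [CStarCategory.dag_comp, dag_wl, (h.inv hf.mul_one).dag_right] at h1
  rw [twistMul_dag' h hk, twistOne]
  simp [reassoc_of% h1]

theorem twistOne_twistMul_dag' [IsIso G'] (hf : IsFrobAlg m u) (h : IsMulPair m u G G')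
    (hk : k† = k) :
    twistOne u G k ≫ (twistMul m G k)† = u ≫ m† ≫ (inv G' ≫ G) ▷ P := by
  have h1 := congrArg CStarCategory.dag (h.inv hf.mul_one).left
  simp only [CStarCategory.dag_comp, dag_wr, (h.inv hf.mul_one).dag_left] at h1
  rw [twistMul_dag h hk, twistOne, ← Category.assoc u, (h.inv hf.mul_one).one]
  simp [reassoc_of% h1]

/-- The original `m` is recovered from its twist by composing with `k⁻¹` and with `G⁻¹` on the left
or `G'⁻¹` on the right wire. Using the wire on which the central map does not act gives each half.
-/
theorem IsCentral.of_twist [IsIso G'] (hs : IsFrobAlg (twistMul m G k) (twistOne u G k))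
    (hf : IsFrobAlg m u) (h : IsMulPair m u G G') (hk : IsCentral m k)
    {n : P ⟶ P} (hn : IsCentral (twistMul m G k) n) : IsCentral m n where
  left := by
    have h1 := comm_of_linear hs.mul_one (hk.twist hf h hk).inv.right hn.left
    have e : m = P ◁ CategoryTheory.inv G' ≫ twistMul m G k ≫ CategoryTheory.inv k := by
      rw [twistMul_eq h]
      simp
    conv_lhs => rw [e]
    conv_rhs => rw [e]
    rw [Category.assoc, Category.assoc, h1, reassoc_of% hn.left, whisker_exchange_assoc]
  right := by
    have h1 := comm_of_linear hs.mul_one (hk.twist hf h hk).inv.right hn.left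
    have e : m = CategoryTheory.inv G ▷ P ≫ twistMul m G k ≫ CategoryTheory.inv k := by simp [twistMul]
    conv_lhs => rw [e]
    conv_rhs => rw [e]
    rw [Category.assoc, Category.assoc, h1, reassoc_of% hn.right, whisker_exchange_assoc]

end Twist

/-- If `x ≫ f ≫ f† = 0` then `x ≫ f = 0` by the C*-identity, and `x = 0` since `f` has a right
inverse. By finite dimension `x ↦ x ≫ f ≫ f†` is then surjective, which yields a one-sided inverse;
it is self-adjoint, hence two-sided. -/
theorem isIso_comp_dag {X Y : T} [FiniteDimensional ℂ (X ⟶ X)] (f : X ⟶ Y) (g : Y ⟶ X)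
    (h : f ≫ g = 𝟙 X) : IsIso (f ≫ f†) := by
  have hinj : Function.Injective (Linear.rightComp ℂ X (f ≫ f†)) := by
    rw [← LinearMap.ker_eq_bot, LinearMap.ker_eq_bot']
    intro x hx
    have hx : x ≫ f ≫ f† = 0 := hx
    have h1 : ‖x ≫ f‖ ^ 2 = 0 := by
      rw [← CStarCategory.norm_comp_dag, CStarCategory.dag_comp, Category.assoc, reassoc_of% hx,
        Limits.zero_comp]
      exact ((CStarCategory.normCore X X).norm_eq_zero_iff 0).2 rfl
    have h2 : x ≫ f = 0 :=
      ((CStarCategory.normCore X Y).norm_eq_zero_iff _).1 (pow_eq_zero_iff two_ne_zero |>.1 h1)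
    rw [← Category.comp_id x, ← h, reassoc_of% h2, Limits.zero_comp]
  obtain ⟨y, hy⟩ := (LinearMap.injective_iff_surjective.1 hinj) (𝟙 X)
  have hy : y ≫ f ≫ f† = 𝟙 X := hy
  have hy' := congrArg CStarCategory.dag hy
  simp only [CStarCategory.dag_comp, CStarCategory.dag_dag, dag_id, Category.assoc] at hy'
  have : y = y† := by
    calc y = y ≫ f ≫ f† ≫ y† := by rw [hy', Category.comp_id]
      _ = y† := by rw [← Category.assoc f, ← Category.assoc y, hy, Category.id_comp]
  exact ⟨y, by rw [this, Category.assoc, hy'], hy⟩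

/-- The normalization of a twist. -/
theorem exists_normalization [FiniteDimensional ℂ (P ⟶ P)] (hf : IsFrobAlg m u) {G G' : P ⟶ P}
    [IsIso G] (h : IsMulPair m u G G') :
    ∃ k : P ⟶ P, IsIso k ∧ k† = k ∧ IsCentral m k ∧ k ≫ m† ≫ G ▷ P ≫ G ▷ P ≫ m ≫ k = 𝟙 P := by
  -- `f ≫ f†` is the defect of separability of the uncorrected twist; `k` is its inverse square
  -- root.
  let f := m† ≫ G ▷ P
  have hz : f ≫ f† = m† ≫ G ▷ P ≫ G ▷ P ≫ m := by simp [f, h.dag_right]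
  have hz' : f ≫ f† = m† ≫ P ◁ G' ≫ P ◁ G' ≫ m := by
    rw [hz, h.bal, ← whisker_exchange_assoc, h.bal]
  have := isIso_comp_dag f (inv G ▷ P ≫ m) (by simp [f, hf.sep])
  obtain ⟨k, hk, hkk, hmem⟩ := CStarCategory.exists_invSqrt_mem_adjoin f
  -- The expression with `G'` on the right wire gives one half of centrality and that with `G` on
  -- the left wire the other, each through the Frobenius equation.
  have hzc : IsCentral m (f ≫ f†) := by
    constructor
    · rw [hz', ← reassoc_of% hf.frob_right, ← whiskerLeft_comp_assoc, h.left,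
        ← whiskerLeft_comp_assoc, Category.assoc, h.left, comp_whiskerRight, comp_whiskerRight,
        comp_whiskerRight, Category.assoc, Category.assoc, Category.assoc, hf.mul_assoc]
      simp
    · rw [hz, ← reassoc_of% hf.frob_left, ← comp_whiskerRight_assoc, h.right,
        ← comp_whiskerRight_assoc, Category.assoc, h.right, whiskerLeft_comp, whiskerLeft_comp,
        whiskerLeft_comp, Category.assoc, Category.assoc, Category.assoc]
      simp only [comp_whiskerRight, Category.assoc, hf.mul_assoc]
      simp
  -- Central endomorphisms form a subalgebra, so it contains the inverse square root together with
  -- `f ≫ f†`.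
  let S : Subalgebra ℂ (End P) :=
    { carrier := {k | IsCentral m k}
      mul_mem' := fun {a b} ha hb => by
        constructor
        · change m ≫ (show P ⟶ P from b) ≫ (show P ⟶ P from a) =
            ((show P ⟶ P from b) ≫ (show P ⟶ P from a)) ▷ P ≫ m
          rw [reassoc_of% hb.left, ha.left]; simp
        · change m ≫ (show P ⟶ P from b) ≫ (show P ⟶ P from a) =
            P ◁ ((show P ⟶ P from b) ≫ (show P ⟶ P from a)) ≫ m
          rw [reassoc_of% hb.right, ha.right]; simp
      add_mem' := fun {a b} ha hb => by
        constructor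
        · change m ≫ ((show P ⟶ P from a) + (show P ⟶ P from b)) =
            ((show P ⟶ P from a) + (show P ⟶ P from b)) ▷ P ≫ m
          rw [Preadditive.comp_add, ha.left, hb.left]; simp
        · change m ≫ ((show P ⟶ P from a) + (show P ⟶ P from b)) =
            P ◁ ((show P ⟶ P from a) + (show P ⟶ P from b)) ≫ m
          rw [Preadditive.comp_add, ha.right, hb.right]; simp
      algebraMap_mem' := fun c => by
        rw [Algebra.algebraMap_eq_smul_one]
        constructor
        · change m ≫ (c • 𝟙 P) = (c • 𝟙 P) ▷ P ≫ m
          simp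
        · change m ≫ (c • 𝟙 P) = P ◁ (c • 𝟙 P) ≫ m
          simp }
  have hkc : IsCentral m k := (Algebra.adjoin_le (S := S) (Set.singleton_subset_iff.2 hzc)) hmem
  have hkz := comm_of_linear hf.mul_one hzc.right hkc.left
  have hkf : k ≫ (f ≫ f†) ≫ k = 𝟙 P := by rw [hkz, ← hkk]
  refine ⟨k, ⟨(f ≫ f†) ≫ k, hkf, ?_⟩, hk, hkc, ?_⟩
  · rw [hkz, Category.assoc, hkz, hkk]
  · rw [hz] at hkf
    simpa using hkf

end
end

/-! ### Algebras in a category of bimodules, described in `T` -/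

section
open MonoidalCategory MonObj DaggerBimod
variable {T : Type u} [Category.{v} T] [MonoidalCategory T] [RigidCStarTensorCategory T]

section
variable {R : SSFA T} {P : DaggerBimod R R}

/-- A separable standard Frobenius algebra in the category of `R`-`R`-bimodules, in terms of
morphisms for the outer actions. -/
structure IsRelAlg (m : outer P P ⟶ P) (u : regular R ⟶ P) : Prop where
  idem : relIdem P P ≫ m.hom = m.hom
  one_left : u.hom ▷ P.X ≫ m.hom = P.actLeft
  one_right : P.X ◁ u.hom ≫ m.hom = P.actRight
  mul_assoc : m.hom ▷ P.X ≫ m.hom = (α_ P.X P.X P.X).hom ≫ P.X ◁ m.hom ≫ m.hom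
  frob : P.X ◁ m.hom† ≫ (α_ P.X P.X P.X).inv ≫ m.hom ▷ P.X = m.hom ≫ m.hom†
  sep : m.hom† ≫ m.hom = 𝟙 P.X
  std (f : P ⟶ P) : endTrace (regular R) (u ≫ m† ≫ outerWhiskerLeft P f ≫ m ≫ u†) =
    endTrace (regular R) (u ≫ m† ≫ outerWhiskerRight f P ≫ m ≫ u†)

end

section
variable {R : SSFA T} (S : SSFA (R ⟶ R))

/-- The underlying bimodule. -/
abbrev relBimod : DaggerBimod R R := S.X

/-- The multiplication `relTensor P P ⟶ P`. -/
abbrev relMul : relTensor (relBimod S) (relBimod S) ⟶ (relBimod S) := μ[S.X]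

/-- The multiplication as a morphism for the outer actions. -/
noncomputable def outerMul : outer (relBimod S) (relBimod S) ⟶ (relBimod S) :=
  projHom (relBimod S) (relBimod S) ≫ (relMul S)

/-- The unit as a bimodule homomorphism. -/
abbrev outerOne : regular R ⟶ (relBimod S) := η[S.X]

theorem outerMul_hom : (outerMul S).hom = relProj (relBimod S) (relBimod S) ≫ (relMul S).hom := rfl

theorem outerMul_dag_hom :
    (outerMul S).hom† = (relMul S).hom† ≫ relIncl (relBimod S) (relBimod S) := by
  rw [outerMul_hom, CStarCategory.dag_comp, CStarCategory.dag_dag]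

theorem relWhiskerRight_incl {A B C : SSFA T} {M M' : DaggerBimod A B} (f : M ⟶ M')
    (N : DaggerBimod B C) : (relWhiskerRight f N).hom ≫ relIncl M' N = relIncl M N ≫ f.hom ▷ N.X := by
  simp only [relWhiskerRight, comp_hom, inclHom_hom, projHom_hom, outerWhiskerRight_hom,
    Category.assoc, proj_incl]
  rw [← relIdem_natural_left M N f.hom f.right_act_hom, incl_idem_assoc]

theorem relMul_assoc : (relWhiskerRight (relMul S) (relBimod S)) ≫ (relMul S) =
    relAssocHom (relBimod S) (relBimod S) (relBimod S) ≫ relWhiskerLeft (relBimod S) (relMul S) ≫ (relMul S) :=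
  MonObj.mul_assoc S.X

theorem relMul_frob : relWhiskerLeft (relBimod S) (((relMul S)†)) ≫
    (relAssocHom (relBimod S) (relBimod S) (relBimod S))† ≫ relWhiskerRight (relMul S) (relBimod S) =
      (relMul S) ≫ ((relMul S)†) :=
  S.frob_left

/-- The projections onto relative tensor products are split epimorphisms natural in both variables.
Composing an equation between 2-morphisms with them turns it into one between morphisms for the
outer actions. -/
theorem isRelAlg : IsRelAlg (outerMul S) (outerOne S) where
  idem := by rw [outerMul_hom, idem_proj_assoc]
  one_left := by
    have h : relWhiskerRight (outerOne S) (relBimod S) ≫ (relMul S) = relLeftUnitorHom (relBimod S) :=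
      MonObj.one_mul S.X
    have h := congrArg (fun t => relProj _ _ ≫ Bimod.Hom.hom t) h
    simp only [comp_hom, proj_relWhiskerRight_assoc, proj_leftUnitor] at h
    exact h
  one_right := by
    have h : relWhiskerLeft (relBimod S) (outerOne S) ≫ (relMul S) = relRightUnitorHom (relBimod S) :=
      MonObj.mul_one S.X
    have h := congrArg (fun t => relProj _ _ ≫ Bimod.Hom.hom t) h
    simp only [comp_hom, proj_relWhiskerLeft_assoc, proj_rightUnitor] at h
    exact h
  mul_assoc := by
    have h := congrArg (fun t => relProj _ _ ▷ _ ≫ relProj _ _ ≫ Bimod.Hom.hom t) (relMul_assoc S)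
    simp only [comp_hom, proj_relWhiskerRight_assoc, proj_assoc_assoc,
      proj_relWhiskerLeft_assoc] at h
    rw [outerMul_hom]
    simpa using h
  frob := by
    have h := congrArg (fun t => relProj _ _ ≫ Bimod.Hom.hom t ≫ relIncl _ _) (relMul_frob S)
    simp only [comp_hom, Category.assoc, dag_hom, relWhiskerRight_incl] at h
    have h1 : (relBimod S).X ◁ (relMul S).hom† ≫ relProj _ _ ≫
        (relAssocHom (relBimod S) (relBimod S) (relBimod S)).hom† ≫ relIncl _ _ ≫
          (relMul S).hom ▷ (relBimod S).X = (relBimod S).X ◁ (outerMul S).hom† ≫ (α_ _ _ _).inv ≫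
            (outerMul S).hom ▷ (relBimod S).X ≫ relIdem (relBimod S) (relBimod S) := by
      have e := proj_assoc_dag (relBimod S) (relBimod S) (relBimod S)
      have e' := congrArg (fun t => (relBimod S).X ◁ relIncl (relBimod S) (relBimod S) ≫ t) e
      simp only [← whiskerLeft_comp_assoc, incl_proj, whiskerLeft_id, Category.id_comp] at e'
      rw [outerMul_dag_hom, outerMul_hom, reassoc_of% e', whiskerLeft_comp, comp_whiskerRight,
        proj_incl_assoc, relIdem_natural_left _ _ _ (relMul S).right_act_hom]
      simp only [Category.assoc]
    have h2 : (outerMul S).hom† ≫ relIdem (relBimod S) (relBimod S) = (outerMul S).hom† := by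
      rw [outerMul_dag_hom, Category.assoc, incl_idem]
    have hr : (outerMul S).hom ≫ (outerMul S).hom† = relProj _ _ ≫ (relMul S).hom ≫
        (relMul S).hom† ≫ relIncl _ _ := by
      rw [outerMul_dag_hom, outerMul_hom, Category.assoc]
    rw [proj_relWhiskerLeft_assoc, dag_hom, h1, ← hr] at h
    rw [← h]
    -- What remains is a superfluous `relIdem` on the right: it slides back past the multiplication
    -- onto the other factors, where the adjoint of the multiplication absorbs it.
    rw [← relIdem_natural_left (outer _ _) _ _ (outerMul S).right_act_hom, relIdem_outer_left]
    simp only [Category.assoc, Iso.inv_hom_id_assoc]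
    rw [← whiskerLeft_comp_assoc, h2]
  sep := by
    have h : ((relMul S)†) ≫ (relMul S) = 𝟙 _ := S.separable
    have h := congrArg Bimod.Hom.hom h
    rw [outerMul_dag_hom, outerMul_hom, Category.assoc, incl_proj_assoc]
    exact h
  std f := by
    have h := S.isStandardCup f
    have e1 : (outerMul S)† ≫ outerWhiskerLeft (relBimod S) f ≫ (outerMul S) =
        ((relMul S)†) ≫ relWhiskerLeft (relBimod S) f ≫ (relMul S) := by
      apply hom_ext
      simp only [outerMul, comp_hom, dag_hom, CStarCategory.dag_comp, projHom_hom, CStarCategory.dag_dag,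
        outerWhiskerLeft_hom, Category.assoc]
      rw [← proj_relWhiskerLeft_assoc, incl_proj_assoc]
    have e2 : (outerMul S)† ≫ outerWhiskerRight f (relBimod S) ≫ (outerMul S) =
        ((relMul S)†) ≫ relWhiskerRight f (relBimod S) ≫ (relMul S) := by
      apply hom_ext
      simp only [outerMul, comp_hom, dag_hom, CStarCategory.dag_comp, projHom_hom, CStarCategory.dag_dag,
        outerWhiskerRight_hom, Category.assoc]
      rw [← proj_relWhiskerRight_assoc, incl_proj_assoc]
    rw [reassoc_of% e1, reassoc_of% e2]
    exact h

end
end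

/-! ### Averaging over the actions, and the action of the center -/

section
open MonoidalCategory MonObj DaggerBimod

namespace DaggerBimod

section
variable {T : Type u} [Category.{v} T] [MonoidalCategory T] [RigidCStarTensorCategory T]
variable {A B C D : SSFA T} {M N L : DaggerBimod A B}

/-- The average of a morphism of `T` over the left action. -/
def avgLeft (M N : DaggerBimod A B) (F : M.X ⟶ N.X) : M.X ⟶ N.X :=
  M.actLeft† ≫ A.X ◁ F ≫ N.actLeft

/-- The average of a morphism of `T` over the right action. -/
def avgRight (M N : DaggerBimod A B) (F : M.X ⟶ N.X) : M.X ⟶ N.X :=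
  M.actRight† ≫ F ▷ B.X ≫ N.actRight

/-- By the Frobenius property of the action, an algebra element acting before the average can be
passed through it to act afterwards, as for averages over a finite group. -/
theorem actLeft_avgLeft (F : M.X ⟶ N.X) :
    M.actLeft ≫ avgLeft M N F = A.X ◁ avgLeft M N F ≫ N.actLeft := by
  have h := M.left_frob'
  rw [avgLeft, reassoc_of% h, ← whisker_exchange_assoc, N.left_assoc]
  simp

theorem actRight_avgRight (F : M.X ⟶ N.X) :
    M.actRight ≫ avgRight M N F = avgRight M N F ▷ B.X ≫ N.actRight := by
  have h := M.right_frob'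
  rw [avgRight, reassoc_of% h, whisker_exchange_assoc, N.right_assoc]
  simp

theorem dag_actLeft_comp (f : M ⟶ N) : M.actLeft† ≫ A.X ◁ f.hom = f.hom ≫ N.actLeft† := by
  apply dag_inj
  have h : N.actLeft ≫ f.hom† = A.X ◁ f.hom† ≫ M.actLeft := (f†).left_act_hom
  simpa using h.symm

theorem dag_actRight_comp (f : M ⟶ N) : M.actRight† ≫ f.hom ▷ B.X = f.hom ≫ N.actRight† := by
  apply dag_inj
  have h : N.actRight ≫ f.hom† = f.hom† ▷ B.X ≫ M.actRight := (f†).right_act_hom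
  simpa using h.symm

theorem avgLeft_comp_left (f : M ⟶ N) (F : N.X ⟶ L.X) :
    avgLeft M L (f.hom ≫ F) = f.hom ≫ avgLeft N L F := by
  have h := dag_actLeft_comp f
  rw [avgLeft, avgLeft, whiskerLeft_comp, Category.assoc, reassoc_of% h]

theorem avgLeft_comp_right (F : M.X ⟶ N.X) (f : N ⟶ L) :
    avgLeft M L (F ≫ f.hom) = avgLeft M N F ≫ f.hom := by
  rw [avgLeft, avgLeft, whiskerLeft_comp, Category.assoc, Category.assoc, Category.assoc,
    f.left_act_hom]

theorem avgRight_comp_left (f : M ⟶ N) (F : N.X ⟶ L.X) :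
    avgRight M L (f.hom ≫ F) = f.hom ≫ avgRight N L F := by
  have h := dag_actRight_comp f
  rw [avgRight, avgRight, comp_whiskerRight, Category.assoc, reassoc_of% h]

theorem avgRight_comp_right (F : M.X ⟶ N.X) (f : N ⟶ L) :
    avgRight M L (F ≫ f.hom) = avgRight M N F ≫ f.hom := by
  rw [avgRight, avgRight, comp_whiskerRight, Category.assoc, Category.assoc, Category.assoc,
    f.right_act_hom]

theorem avgRight_avgLeft (F : M.X ⟶ N.X) :
    avgRight M N (avgLeft M N F) = avgLeft M N (avgRight M N F) := by
  have h := congrArg CStarCategory.dag M.middle_assoc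
  simp only [CStarCategory.dag_comp, dag_wl, dag_wr, dag_a, Category.assoc] at h
  simp only [avgLeft, avgRight, comp_whiskerRight, whiskerLeft_comp, Category.assoc]
  rw [reassoc_of% h, N.middle_assoc]
  simp

/-- The average of a morphism of `T` over both actions. -/
@[simps] def avg (M N : DaggerBimod A B) (F : M.X ⟶ N.X) : M ⟶ N where
  hom := avgRight M N (avgLeft M N F)
  left_act_hom := by
    rw [avgRight_avgLeft]
    exact actLeft_avgLeft _
  right_act_hom := actRight_avgRight _

theorem avg_comp_left (f : M ⟶ N) (F : N.X ⟶ L.X) : avg M L (f.hom ≫ F) = f ≫ avg N L F := by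
  apply hom_ext
  rw [avg_hom, avgLeft_comp_left, avgRight_comp_left]
  rfl

theorem avg_comp_right (F : M.X ⟶ N.X) (f : N ⟶ L) : avg M L (F ≫ f.hom) = avg M N F ≫ f := by
  apply hom_ext
  rw [avg_hom, avgLeft_comp_right, avgRight_comp_right]
  rfl

theorem avgLeft_outer {M M' : DaggerBimod A B} {N : DaggerBimod C D} (F : M.X ⟶ M'.X) :
    avgLeft (outer M N) (outer M' N) (F ▷ N.X) = avgLeft M M' F ▷ N.X := by
  simp [avgLeft]

theorem avgRight_outer {M : DaggerBimod A B} {N N' : DaggerBimod C D} (F : N.X ⟶ N'.X) :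
    avgRight (outer M N) (outer M N') (M.X ◁ F) = M.X ◁ avgRight N N' F := by
  simp [avgRight]

/-- The action of an endomorphism of the identity bimodule from the left. -/
noncomputable def leftMul (M : DaggerBimod A B) (z : regular A ⟶ regular A) : M ⟶ M :=
  (actLeftHom M)† ≫ outerWhiskerRight z M ≫ actLeftHom M

/-- The action of an endomorphism of the identity bimodule from the right. -/
noncomputable def rightMul (M : DaggerBimod A B) (z : regular B ⟶ regular B) : M ⟶ M :=
  (actRightHom M)† ≫ outerWhiskerLeft M z ≫ actRightHom M

theorem actLeft_leftMul (z : regular A ⟶ regular A) :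
    M.actLeft ≫ (leftMul M z).hom = z.hom ▷ M.X ≫ M.actLeft := by
  have h := M.left_frob'
  have hz : μ[A.X] ≫ z.hom = z.hom ▷ A.X ≫ μ[A.X] := SSFA.central_left z
  change M.actLeft ≫ M.actLeft† ≫ z.hom ▷ M.X ≫ M.actLeft = _
  rw [reassoc_of% h, ← comp_whiskerRight_assoc, hz, comp_whiskerRight_assoc,
    ← associator_inv_naturality_left_assoc, whisker_exchange_assoc, ← reassoc_of% h, left_sep,
    Category.comp_id]

theorem actRight_rightMul (z : regular B ⟶ regular B) :
    M.actRight ≫ (rightMul M z).hom = M.X ◁ z.hom ≫ M.actRight := by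
  have h := M.right_frob'
  have hz : μ[B.X] ≫ z.hom = B.X ◁ z.hom ≫ μ[B.X] := SSFA.central_right z
  change M.actRight ≫ M.actRight† ≫ M.X ◁ z.hom ≫ M.actRight = _
  rw [reassoc_of% h, ← whiskerLeft_comp_assoc, hz, whiskerLeft_comp_assoc,
    ← associator_naturality_right_assoc, ← whisker_exchange_assoc, ← reassoc_of% h, right_sep,
    Category.comp_id]

instance : IsSplitEpi M.actLeft := ⟨⟨⟨M.actLeft†, M.left_sep⟩⟩⟩

instance : IsSplitEpi M.actRight := ⟨⟨⟨M.actRight†, M.right_sep⟩⟩⟩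

theorem leftMul_unique {z : regular A ⟶ regular A} {G : M.X ⟶ M.X}
    (h : M.actLeft ≫ G = z.hom ▷ M.X ≫ M.actLeft) : (leftMul M z).hom = G := by
  rw [← cancel_epi M.actLeft, actLeft_leftMul, h]

theorem rightMul_unique {z : regular B ⟶ regular B} {G : M.X ⟶ M.X}
    (h : M.actRight ≫ G = M.X ◁ z.hom ≫ M.actRight) : (rightMul M z).hom = G := by
  rw [← cancel_epi M.actRight, actRight_rightMul, h]

theorem leftMul_natural (z : regular A ⟶ regular A) (f : M ⟶ N) :
    f ≫ leftMul N z = leftMul M z ≫ f := by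
  apply hom_ext
  rw [← cancel_epi M.actLeft, comp_hom, comp_hom, reassoc_of% (actLeft_leftMul (M := M) z),
    f.left_act_hom, reassoc_of% f.left_act_hom, actLeft_leftMul, whisker_exchange_assoc]

theorem rightMul_natural (z : regular B ⟶ regular B) (f : M ⟶ N) :
    f ≫ rightMul N z = rightMul M z ≫ f := by
  apply hom_ext
  rw [← cancel_epi M.actRight, comp_hom, comp_hom, reassoc_of% (actRight_rightMul (M := M) z),
    f.right_act_hom, reassoc_of% f.right_act_hom, actRight_rightMul, ← whisker_exchange_assoc]

theorem leftMul_comp (z w : regular A ⟶ regular A) :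
    leftMul M (z ≫ w) = leftMul M z ≫ leftMul M w := by
  apply hom_ext
  apply leftMul_unique
  rw [comp_hom, reassoc_of% (actLeft_leftMul (M := M) z), actLeft_leftMul, comp_hom,
    comp_whiskerRight, Category.assoc]

theorem rightMul_comp (z w : regular B ⟶ regular B) :
    rightMul M (z ≫ w) = rightMul M z ≫ rightMul M w := by
  apply hom_ext
  apply rightMul_unique
  rw [comp_hom, reassoc_of% (actRight_rightMul (M := M) z), actRight_rightMul, comp_hom,
    whiskerLeft_comp, Category.assoc]

theorem leftMul_id : leftMul M (𝟙 (regular A)) = 𝟙 M := by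
  apply hom_ext
  apply leftMul_unique
  simp

theorem rightMul_id : rightMul M (𝟙 (regular B)) = 𝟙 M := by
  apply hom_ext
  apply rightMul_unique
  simp

theorem leftMul_dag (z : regular A ⟶ regular A) : (leftMul M z)† = leftMul M z† := by
  apply hom_ext
  simp [leftMul]

theorem rightMul_dag (z : regular B ⟶ regular B) : (rightMul M z)† = rightMul M z† := by
  apply hom_ext
  simp [rightMul]

instance (z : regular A ⟶ regular A) [IsIso z] : IsIso (leftMul M z) :=
  ⟨leftMul M (inv z), by rw [← leftMul_comp, IsIso.hom_inv_id, leftMul_id],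
    by rw [← leftMul_comp, IsIso.inv_hom_id, leftMul_id]⟩

instance (z : regular B ⟶ regular B) [IsIso z] : IsIso (rightMul M z) :=
  ⟨rightMul M (inv z), by rw [← rightMul_comp, IsIso.hom_inv_id, rightMul_id],
    by rw [← rightMul_comp, IsIso.inv_hom_id, rightMul_id]⟩

instance (f : M ⟶ N) [IsIso f] : IsIso f.hom :=
  ⟨(inv f).hom, by rw [← comp_hom, IsIso.hom_inv_id, id_hom],
    by rw [← comp_hom, IsIso.inv_hom_id, id_hom]⟩

theorem inv_hom (f : M ⟶ N) [IsIso f] : (inv f).hom = inv f.hom := by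
  apply IsIso.eq_inv_of_hom_inv_id
  rw [← comp_hom, IsIso.hom_inv_id, id_hom]

theorem leftMul_regular (z : regular A ⟶ regular A) : leftMul (regular A) z = z :=
  hom_ext (leftMul_unique (SSFA.central_left z))

theorem rightMul_regular (z : regular A ⟶ regular A) : rightMul (regular A) z = z :=
  hom_ext (rightMul_unique (SSFA.central_right z))

theorem leftMul_outer {M : DaggerBimod A B} {N : DaggerBimod C D} (z : regular A ⟶ regular A) :
    (leftMul (outer M N) z).hom = (leftMul M z).hom ▷ N.X := by
  apply leftMul_unique
  rw [Category.assoc, ← comp_whiskerRight, actLeft_leftMul]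
  simp

theorem rightMul_outer {M : DaggerBimod A B} {N : DaggerBimod C D} (z : regular D ⟶ regular D) :
    (rightMul (outer M N) z).hom = M.X ◁ (rightMul N z).hom := by
  apply rightMul_unique
  rw [Category.assoc, ← whiskerLeft_comp, actRight_rightMul]
  simp

end

end DaggerBimod
end

/-! ### Weights on the center and standardness of the twist -/

section
open MonoidalCategory MonObj DaggerBimod
variable {T : Type u} [Category.{v} T] [MonoidalCategory T] [RigidCStarTensorCategory T]

/-- The Eckmann–Hilton argument. -/
theorem unit_comm {T : Type u} [Category.{v} T] [MonoidalCategory T] (f g : 𝟙_ T ⟶ 𝟙_ T) : f ≫ g = g ≫ f := by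
  have h := whisker_exchange f g
  rw [← cancel_epi (λ_ (𝟙_ T)).inv, ← cancel_mono (λ_ (𝟙_ T)).hom] at h
  rw [id_whiskerLeft, whiskerRight_id, unitors_equal, unitors_inv_equal] at h
  simpa using h.symm

theorem finiteDimensional_end (X : T) : FiniteDimensional ℂ (X ⟶ X) :=
  finiteDimensional_hom X X

namespace SSFA

/-- The functional `z ↦ Tr(a† ∘ z ∘ a)` on the center of an algebra is a weighted trace. -/
theorem exists_weight (S : SSFA T) (a : 𝟙_ T ⟶ S.X)
    (ha : ∀ p : regular S ⟶ regular S, a ≫ p.hom = 0 → p = 0) :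
    ∃ g : regular S ⟶ regular S, IsPositive g ∧ g† = g ∧ IsIso g ∧
      ∀ z : regular S ⟶ regular S, endTrace (𝟙_ T) (a ≫ z.hom ≫ a†) =
        endTrace (regular S) (g ≫ g ≫ g ≫ g ≫ z) := by
  have := finiteDimensional_end (𝟙_ T)
  let τ : (regular S ⟶ regular S) →ₗ[ℂ] ℂ :=
    { toFun := fun z => endTrace (𝟙_ T) (a ≫ z.hom ≫ a†)
      map_add' := fun z w => by
        rw [← CStarCategory.endTrace_add]
        simp
      map_smul' := fun c z => by
        rw [RingHom.id_apply, ← CStarCategory.endTrace_smul]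
        simp }
  -- On a projection `p` the functional is the trace of `(a ≫ p) ≫ (a ≫ p)†`, which is positive
  -- because `ha` excludes `a ≫ p = 0` for `p ≠ 0`.
  refine CStarCategory.exists_weight (regular_comm S) τ fun p hd hp h0 => ?_
  have hd : p.hom† = p.hom := congrArg Bimod.Hom.hom hd
  have hp : p.hom ≫ p.hom = p.hom := congrArg Bimod.Hom.hom hp
  have := CStarCategory.endTrace_pos unit_comm (a ≫ p.hom) (fun h => h0 (ha p h))
  rw [CStarCategory.dag_comp, hd, Category.assoc, reassoc_of% hp] at this
  exact this

/-- A central endomorphism is multiplication by its value on the unit. -/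
theorem eq_zero_of_one_comp (S : SSFA T) (p : regular S ⟶ regular S) (h : η[S.X] ≫ p.hom = 0) :
    p = 0 := by
  apply hom_ext
  have h1 := central_left p
  rw [← cancel_epi (λ_ S.X).hom, ← MonObj.one_mul, Category.assoc, h1, ← comp_whiskerRight_assoc, h]
  simp

/-- The averaged expression is the cup of `S` with `z` on the left wire. Standardness moves `z` to
the right wire, where left linearity brings it out of the product and separability removes the loop.
-/
theorem trace_avgRight (S : SSFA T) (z : S.X ⟶ S.X) (hz : μ[S.X] ≫ z = S.X ◁ z ≫ μ[S.X]) :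
    endTrace (𝟙_ T) (η[S.X] ≫ avgRight (regular S) (regular S) z ≫ η[S.X]†) =
      endTrace (𝟙_ T) (η[S.X] ≫ z ≫ η[S.X]†) := by
  have h := S.isStandardCup z
  have h2 := S.separable
  rw [← reassoc_of% hz, reassoc_of% h2] at h
  rw [h, avgRight]
  simp

theorem trace_avgLeft (S : SSFA T) (z : S.X ⟶ S.X) (hz : μ[S.X] ≫ z = z ▷ S.X ≫ μ[S.X]) :
    endTrace (𝟙_ T) (η[S.X] ≫ avgLeft (regular S) (regular S) z ≫ η[S.X]†) =
      endTrace (𝟙_ T) (η[S.X] ≫ z ≫ η[S.X]†) := by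
  have h := S.isStandardCup z
  have h2 := S.separable
  rw [← reassoc_of% hz, reassoc_of% h2] at h
  rw [← h, avgLeft]
  simp

end SSFA

namespace IsRelAlg
variable {R : SSFA T} {P : DaggerBimod R R} {m : outer P P ⟶ P} {u : regular R ⟶ P}

theorem balanced (h : IsRelAlg m u) :
    P.actRight ▷ P.X ≫ m.hom = (α_ P.X R.X P.X).hom ≫ P.X ◁ P.actLeft ≫ m.hom := by
  have := congrArg (fun t => t ≫ m.hom) (relIdem_balanced P P)
  simpa only [Category.assoc, h.idem] using this

theorem balanced_dag (h : IsRelAlg m u) :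
    m.hom† ≫ P.X ◁ P.actLeft† = m.hom† ≫ P.actRight† ▷ P.X ≫ (α_ P.X R.X P.X).hom := by
  have := congrArg CStarCategory.dag h.balanced
  simp only [CStarCategory.dag_comp, dag_wl, dag_wr, dag_a, Category.assoc] at this
  rw [reassoc_of% this]
  simp

/-- The unit as a morphism of `T`. -/
abbrev one (u : regular R ⟶ P) : 𝟙_ T ⟶ P.X := η[R.X] ≫ u.hom

/-- Forgetting `R` loses nothing except standardness, which depends on the trace of the unit object.
-/
theorem isFrobAlg (h : IsRelAlg m u) : IsFrobAlg m.hom (one u) where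
  one_mul := by rw [comp_whiskerRight, Category.assoc, h.one_left, Bimod.one_actLeft]
  mul_one := by rw [whiskerLeft_comp, Category.assoc, h.one_right, Bimod.actRight_one]
  mul_assoc := h.mul_assoc
  frob_left := h.frob
  frob_right := by simpa using congrArg CStarCategory.dag h.frob
  sep := h.sep

/-- The multiplication is balanced over `R`, so acting by `g` between the two factors can be read on
either of them. On the unit both actions agree, since on `regular R` both are `g` itself. -/
theorem isMulPair (h : IsRelAlg m u) (g : regular R ⟶ regular R) (hg : g† = g) :
    IsMulPair m.hom (one u) (rightMul P g).hom (leftMul P g).hom where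
  bal := by
    rw [← cancel_epi (P.actRight ▷ P.X), ← comp_whiskerRight_assoc, actRight_rightMul,
      comp_whiskerRight_assoc, h.balanced, ← whisker_exchange_assoc, h.balanced]
    rw [associator_naturality_middle_assoc, associator_naturality_right_assoc,
      ← whiskerLeft_comp_assoc, ← whiskerLeft_comp_assoc, ← actLeft_leftMul,
      (leftMul P g).left_act_hom]
  right := by
    have := congrArg Bimod.Hom.hom (rightMul_natural g m)
    rw [comp_hom, comp_hom, rightMul_outer] at this
    exact this
  left := by
    have := congrArg Bimod.Hom.hom (leftMul_natural g m)
    rw [comp_hom, comp_hom, leftMul_outer] at this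
    exact this
  one := by
    have h1 := congrArg Bimod.Hom.hom (leftMul_natural g u)
    have h2 := congrArg Bimod.Hom.hom (rightMul_natural g u)
    rw [leftMul_regular, comp_hom, comp_hom] at h1
    rw [rightMul_regular, comp_hom, comp_hom] at h2
    rw [Category.assoc, Category.assoc, h1, h2]
  dag_right := by rw [← dag_hom, rightMul_dag, hg]
  dag_left := by rw [← dag_hom, leftMul_dag, hg]

/-- The endomorphism of `regular R` given by the cup and an endomorphism of the right wire. -/
noncomputable def cupLeft (m : outer P P ⟶ P) (u : regular R ⟶ P) (f : P ⟶ P) :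
    regular R ⟶ regular R :=
  u ≫ m† ≫ outerWhiskerLeft P f ≫ m ≫ u†

/-- The endomorphism of `regular R` given by the cup and an endomorphism of the left wire. -/
noncomputable def cupRight (m : outer P P ⟶ P) (u : regular R ⟶ P) (f : P ⟶ P) :
    regular R ⟶ regular R :=
  u ≫ m† ≫ outerWhiskerRight f P ≫ m ≫ u†

/-- Averaging `F` over the left action changes nothing under the loop: by balancedness the action
moves to the other wire, where separability removes it. The loop is then a left linear endomorphism
of `R.X`, and averaging it over the right action preserves the trace by standardness of `R`. -/
theorem trace_cupLeft (h : IsRelAlg m u) (F : P.X ⟶ P.X) :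
    endTrace (𝟙_ T) (one u ≫ m.hom† ≫ P.X ◁ F ≫ m.hom ≫ (one u)†) =
      endTrace (𝟙_ T) (η[R.X] ≫ (cupLeft m u (avg P P F)).hom ≫ η[R.X]†) := by
  have e1 : m.hom† ≫ P.X ◁ avgLeft P P F ≫ m.hom = m.hom† ≫ P.X ◁ F ≫ m.hom := by
    have hb := h.balanced_dag
    rw [avgLeft, whiskerLeft_comp_assoc, whiskerLeft_comp_assoc, reassoc_of% hb,
      ← associator_naturality_right_assoc, ← h.balanced, whisker_exchange_assoc,
      ← comp_whiskerRight_assoc, P.right_sep]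
    simp
  let z : R.X ⟶ R.X := u.hom ≫ m.hom† ≫ P.X ◁ avgLeft P P F ≫ m.hom ≫ u.hom†
  have hu : μ[R.X] ≫ u.hom = R.X ◁ u.hom ≫ P.actLeft := u.left_act_hom
  have hu' : P.actLeft ≫ u.hom† = R.X ◁ u.hom† ≫ μ[R.X] := (u†).left_act_hom
  have hm : (outer P P).actLeft ≫ m.hom = R.X ◁ m.hom ≫ P.actLeft := m.left_act_hom
  have hm' : P.actLeft ≫ m.hom† = R.X ◁ m.hom† ≫ (outer P P).actLeft := (m†).left_act_hom
  have hF : (outer P P).actLeft ≫ P.X ◁ avgLeft P P F =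
      R.X ◁ P.X ◁ avgLeft P P F ≫ (outer P P).actLeft := by
    rw [Category.assoc, ← whisker_exchange]
    simp
  have hz : μ[R.X] ≫ z = R.X ◁ z ≫ μ[R.X] := by
    simp only [z]
    rw [reassoc_of% hu, reassoc_of% hm', reassoc_of% hF, reassoc_of% hm, hu']
    simp only [whiskerLeft_comp, Category.assoc]
  have hz' : avgRight (regular R) (regular R) z = (cupLeft m u (avg P P F)).hom := by
    simp only [z]
    rw [avgRight_comp_left u, ← dag_hom m, avgRight_comp_left m†]
    rw [show m.hom ≫ u.hom† = (m ≫ u†).hom from rfl, avgRight_comp_right _ (m ≫ u†),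
      avgRight_outer]
    rfl
  have := R.trace_avgRight z hz
  rw [hz'] at this
  rw [this]
  simp only [z, CStarCategory.dag_comp, Category.assoc]
  rw [reassoc_of% e1]

theorem trace_cupRight (h : IsRelAlg m u) (F : P.X ⟶ P.X) :
    endTrace (𝟙_ T) (one u ≫ m.hom† ≫ F ▷ P.X ≫ m.hom ≫ (one u)†) =
      endTrace (𝟙_ T) (η[R.X] ≫ (cupRight m u (avg P P F)).hom ≫ η[R.X]†) := by
  have e1 : m.hom† ≫ avgRight P P F ▷ P.X ≫ m.hom = m.hom† ≫ F ▷ P.X ≫ m.hom := by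
    have hb := h.balanced_dag
    rw [avgRight, comp_whiskerRight_assoc, comp_whiskerRight_assoc, h.balanced,
      associator_naturality_left_assoc, ← reassoc_of% hb, ← whisker_exchange_assoc,
      ← whiskerLeft_comp_assoc, P.left_sep]
    simp
  let z : R.X ⟶ R.X := u.hom ≫ m.hom† ≫ avgRight P P F ▷ P.X ≫ m.hom ≫ u.hom†
  have hu : μ[R.X] ≫ u.hom = u.hom ▷ R.X ≫ P.actRight := u.right_act_hom
  have hu' : P.actRight ≫ u.hom† = u.hom† ▷ R.X ≫ μ[R.X] := (u†).right_act_hom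
  have hm : (outer P P).actRight ≫ m.hom = m.hom ▷ R.X ≫ P.actRight := m.right_act_hom
  have hm' : P.actRight ≫ m.hom† = m.hom† ▷ R.X ≫ (outer P P).actRight := (m†).right_act_hom
  have hF : (outer P P).actRight ≫ avgRight P P F ▷ P.X =
      avgRight P P F ▷ P.X ▷ R.X ≫ (outer P P).actRight := by
    rw [Category.assoc, whisker_exchange]
    simp
  have hz : μ[R.X] ≫ z = z ▷ R.X ≫ μ[R.X] := by
    simp only [z]
    rw [reassoc_of% hu, reassoc_of% hm', reassoc_of% hF, reassoc_of% hm, hu']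
    simp only [comp_whiskerRight, Category.assoc]
  have hz' : avgLeft (regular R) (regular R) z = (cupRight m u (avg P P F)).hom := by
    simp only [z]
    rw [avgLeft_comp_left u, ← dag_hom m, avgLeft_comp_left m†]
    rw [show m.hom ≫ u.hom† = (m ≫ u†).hom from rfl, avgLeft_comp_right _ (m ≫ u†),
      avgLeft_outer, ← avgRight_avgLeft]
    rfl
  have := R.trace_avgLeft z hz
  rw [hz'] at this
  rw [this]
  simp only [z, CStarCategory.dag_comp, Category.assoc]
  rw [reassoc_of% e1]

/-- By naturality, the central element slides from the base onto the outermost right action, which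
is on the right wire. For `cupRight` it slides onto the left wire as a left action. -/
theorem comp_cupLeft (z : regular R ⟶ regular R) (f : P ⟶ P) :
    z ≫ cupLeft m u f = cupLeft m u (rightMul P z ≫ f) := by
  have h1 := rightMul_natural z u
  have h2 := rightMul_natural z m†
  have h3 : rightMul (outer P P) z = outerWhiskerLeft P (rightMul P z) := hom_ext (rightMul_outer z)
  have h4 : outerWhiskerLeft P (rightMul P z ≫ f) =
      outerWhiskerLeft P (rightMul P z) ≫ outerWhiskerLeft P f := hom_ext (whiskerLeft_comp _ _ _)
  rw [rightMul_regular] at h1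
  rw [cupLeft, cupLeft, ← reassoc_of% h1, ← reassoc_of% h2, h3, h4, Category.assoc]

theorem comp_cupRight (z : regular R ⟶ regular R) (f : P ⟶ P) :
    z ≫ cupRight m u f = cupRight m u (leftMul P z ≫ f) := by
  have h1 := leftMul_natural z u
  have h2 := leftMul_natural z m†
  have h3 : leftMul (outer P P) z = outerWhiskerRight (leftMul P z) P := hom_ext (leftMul_outer z)
  have h4 : outerWhiskerRight (leftMul P z ≫ f) P =
      outerWhiskerRight (leftMul P z) P ≫ outerWhiskerRight f P := hom_ext (comp_whiskerRight _ _ _)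
  rw [leftMul_regular] at h1
  rw [cupRight, cupRight, ← reassoc_of% h1, ← reassoc_of% h2, h3, h4, Category.assoc]

/-- The twist of an algebra over `R` by the weight of `R` is standard. -/
theorem isStandardCup_twist (h : IsRelAlg m u) {g : regular R ⟶ regular R} [IsIso g] (hg : g† = g)
    (hw : ∀ z : regular R ⟶ regular R, endTrace (𝟙_ T) (η[R.X] ≫ z.hom ≫ η[R.X]†) =
        endTrace (regular R) (g ≫ g ≫ g ≫ g ≫ z))
    {k : P.X ⟶ P.X} [IsIso k] (hk : k† = k) :
    IsStandardCup (twistMul m.hom (rightMul P g).hom k) (twistOne (one u) (rightMul P g).hom k) := by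
  intro F
  have hp := h.isMulPair g hg
  have h1 := twistOne_twistMul_dag (k := k) h.isFrobAlg hp hk
  have h2 := twistOne_twistMul_dag' (k := k) h.isFrobAlg hp hk
  have h1' := congrArg CStarCategory.dag h1
  have h2' := congrArg CStarCategory.dag h2
  simp only [CStarCategory.dag_comp, CStarCategory.dag_dag, dag_wl, dag_wr, dag_inv,
    hp.dag_left, hp.dag_right] at h1' h2'
  have hG := inv_hom (rightMul P g)
  have hG' := inv_hom (leftMul P g)
  have hc := leftMul_natural g (rightMul P g)
  have hf := leftMul_natural g (avg P P F)
  have hf' := rightMul_natural g (avg P P F)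
  -- The weight contributes `x⁴`, while the cup and cap contribute `x⁻¹ ≫ y` and `y ≫ x⁻¹`. The
  -- result `x² y²` is symmetric in the left and right action of `g`, so both sides are tested on
  -- the same endomorphism in the standardness condition of the relative algebra.
  have hcomm : ∀ (x y f : P ⟶ P) [IsIso x], x ≫ y = y ≫ x → f ≫ x = x ≫ f → f ≫ y = y ≫ f →
      x ≫ x ≫ x ≫ x ≫ (inv x ≫ y) ≫ f ≫ y ≫ inv x = x ≫ x ≫ y ≫ y ≫ f := by
    intro x y f _ hxy hfx hfy
    have h1 : y ≫ inv x = inv x ≫ y := by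
      rw [IsIso.comp_inv_eq, Category.assoc, ← hxy, IsIso.inv_hom_id_assoc]
    have h2 : f ≫ inv x = inv x ≫ f := by
      rw [IsIso.comp_inv_eq, Category.assoc, hfx, IsIso.inv_hom_id_assoc]
    rw [Category.assoc, reassoc_of% hfy, h2, reassoc_of% h1, reassoc_of% h1]
    simp
  have e1 := h.trace_cupLeft ((inv (rightMul P g) ≫ leftMul P g).hom ≫ F ≫
    (leftMul P g ≫ inv (rightMul P g)).hom)
  have e2 := h.trace_cupRight ((inv (leftMul P g) ≫ rightMul P g).hom ≫ F ≫
    (rightMul P g ≫ inv (leftMul P g)).hom)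
  rw [hw, avg_comp_left, avg_comp_right, comp_cupLeft, comp_cupLeft, comp_cupLeft, comp_cupLeft,
    hcomm _ _ _ hc hf' hf] at e1
  rw [hw, avg_comp_left, avg_comp_right, comp_cupRight, comp_cupRight, comp_cupRight,
    comp_cupRight, hcomm _ _ _ hc.symm hf hf'] at e2
  have e3 := h.std (rightMul P g ≫ rightMul P g ≫ leftMul P g ≫ leftMul P g ≫ avg P P F)
  have hxy : leftMul P g ≫ leftMul P g ≫ rightMul P g ≫ rightMul P g =
      rightMul P g ≫ rightMul P g ≫ leftMul P g ≫ leftMul P g := by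
    rw [← reassoc_of% hc, ← hc, ← reassoc_of% hc, ← reassoc_of% hc]
  conv_lhs => rw [reassoc_of% h1, h1', ← hG]
  conv_rhs => rw [reassoc_of% h2, h2', ← hG']
  have e5 := e1.trans (e3.trans (Eq.trans ?_ e2.symm))
  · simpa using e5
  · rw [reassoc_of% hxy]
    rfl

end IsRelAlg
end

/-! ### Compatibility of the two multiplications and a trace formula -/

section
open MonoidalCategory MonObj DaggerBimod

section
variable {T : Type u} [Category.{v} T] [MonoidalCategory T] [CStarTensorCategory T]

/-- Two multiplications that associate and satisfy the Frobenius equation with each other. -/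
structure IsCompatible {P : T} (m m' : P ⊗ P ⟶ P) : Prop where
  left : m ▷ P ≫ m' = (α_ P P P).hom ≫ P ◁ m' ≫ m
  right : m' ▷ P ≫ m = (α_ P P P).hom ≫ P ◁ m ≫ m'
  frob_left : P ◁ m† ≫ (α_ P P P).inv ≫ m' ▷ P = m' ≫ m†
  frob_right : m† ▷ P ≫ (α_ P P P).hom ≫ P ◁ m' = m' ≫ m†

theorem IsCentral.dag_left {P : T} {m : P ⊗ P ⟶ P} {k : P ⟶ P} (h : IsCentral m k) (hk : k† = k) :
    k ≫ m† = m† ≫ k ▷ P := by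
  simpa [hk] using congrArg CStarCategory.dag h.left

theorem IsCentral.dag_right {P : T} {m : P ⊗ P ⟶ P} {k : P ⟶ P} (h : IsCentral m k) (hk : k† = k) :
    k ≫ m† = m† ≫ P ◁ k := by
  simpa [hk] using congrArg CStarCategory.dag h.right

variable {P : T} {m : P ⊗ P ⟶ P} {u : 𝟙_ T ⟶ P} {G G' k : P ⟶ P}

/-- The mixed equations hold because the inserted element acts on the wire facing the other factor,
while the outer wire carries only module maps; the central `k` passes to any wire. -/
theorem isCompatible_twist (hf : IsFrobAlg m u) (h : IsMulPair m u G G') (hk : IsCentral m k)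
    (hkd : k† = k) : IsCompatible m (twistMul m G k) where
  left := mul_twistMul hf h hk
  right := twistMul_mul hf hk
  frob_left := by
    rw [twistMul, comp_whiskerRight, comp_whiskerRight, ← associator_inv_naturality_left_assoc,
      whisker_exchange_assoc, reassoc_of% hf.frob_left, ← hk.dag_left hkd, Category.assoc,
      Category.assoc]
  frob_right := by
    rw [twistMul_eq h, whiskerLeft_comp, whiskerLeft_comp, ← associator_naturality_right_assoc,
      ← whisker_exchange_assoc, reassoc_of% hf.frob_right, ← hk.dag_right hkd, Category.assoc,
      Category.assoc]

/-- The trace of the cup of `m` in terms of the unit, for a standard twist of `m`. -/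
theorem trace_twist [IsIso G] [IsIso G'] [IsIso k] (hf : IsFrobAlg m u) (h : IsMulPair m u G G')
    (hk : IsCentral m k) (hkd : k† = k) (hs : IsFrobAlg (twistMul m G k) (twistOne u G k))
    (hst : IsStandardCup (twistMul m G k) (twistOne u G k)) {n : P ⟶ P} [IsIso n]
    (hn : IsCentral m n) (hnd : n† = n) (f : P ⟶ P)
    (hfr : twistMul m G k ≫ f = f ▷ P ≫ twistMul m G k) :
    endTrace (𝟙_ T) ((twistOne u G k ≫ k ≫ k) ≫ inv n ≫ m† ≫ P ◁ f ≫ m ≫ inv n ≫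
      (twistOne u G k ≫ k ≫ k)†) =
    endTrace (𝟙_ T) (u ≫ inv G' ≫ inv G' ≫ inv n ≫ f ≫ inv n ≫ inv G' ≫ inv G' ≫ u†) := by
  have hi := h.inv hf.mul_one
  have hkn : k ≫ inv n = inv n ≫ k := comm_of_linear hf.mul_one hk.right hn.inv.left
  have hkG : k ≫ inv G' = inv G' ≫ k := comm_of_linear hf.mul_one hk.right hi.left
  have hnG : inv n ≫ inv G' = inv G' ≫ inv n := comm_of_linear hf.mul_one hn.inv.right hi.left
  have hnd' : (inv n)† = inv n := by rw [dag_inv]; simp [hnd]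
  have hs1 : twistOne u G k = u ≫ inv G' ≫ inv k := by
    rw [twistOne, ← Category.assoc, hi.one, Category.assoc]
  -- Chosen so that `D` on the right wire turns the cup of the twist into that of `m` with the
  -- factors `k²` and `n⁻¹`; on the unit of the twist the `k` in `D` cancels, leaving `G'⁻²` and
  -- `n⁻¹` applied to `u`.
  let D := k ≫ inv n ≫ inv G'
  have hD : D† = D := by
    simp only [D, CStarCategory.dag_comp, hkd, hnd', hi.dag_left, Category.assoc]
    rw [← hkn, ← reassoc_of% hkG, hnG]
  have hA : (twistOne u G k ≫ k ≫ k) ≫ inv n ≫ m† =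
      twistOne u G k ≫ (twistMul m G k)† ≫ P ◁ D := by
    have e : G' ≫ D = k ≫ inv n := by
      have h1 := comm_of_linear hf.mul_one hk.right h.left
      have h2 := comm_of_linear hf.mul_one hn.inv.right h.left
      simp only [D]
      rw [← reassoc_of% h1, ← reassoc_of% h2, IsIso.hom_inv_id, Category.comp_id]
    rw [twistMul_dag' h hkd]
    simp only [Category.assoc]
    rw [← whiskerLeft_comp, e,
      whiskerLeft_comp, ← reassoc_of% (hk.dag_right hkd), ← hn.inv.dag_right hnd']
  have hA' := congrArg CStarCategory.dag hA
  simp only [CStarCategory.dag_comp, CStarCategory.dag_dag, dag_wl, hnd', hD, hkd,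
    Category.assoc] at hA'
  have hB : twistOne u G k ≫ D = u ≫ inv G' ≫ inv G' ≫ inv n := by
    rw [hs1]
    simp [D, hnG]
  have hB' := congrArg CStarCategory.dag hB
  simp only [CStarCategory.dag_comp, hnd', hD, hi.dag_left, Category.assoc] at hB'
  have hDr : twistMul m G k ≫ D = D ▷ P ≫ twistMul m G k := by
    have h1 : twistMul m G k ≫ inv G' = inv G' ▷ P ≫ twistMul m G k := by
      have h2 := comm_of_linear hf.mul_one h.right hi.left
      rw [twistMul, Category.assoc, Category.assoc, hkG, reassoc_of% hi.left,
        ← comp_whiskerRight_assoc, h2, comp_whiskerRight_assoc]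
    have h2 := (hk.twist hf h hk).left
    have h3 := (hk.twist hf h hn.inv).left
    simp only [D]
    rw [reassoc_of% h2, reassoc_of% h3, h1]
    simp
  -- Standardness of the twist moves `D ≫ f ≫ D` to the left wire, where right linearity brings it
  -- out and separability removes the loop.
  have hst := hst (D ≫ f ≫ D)
  have e1 : (twistMul m G k)† ≫ (D ≫ f ≫ D) ▷ P ≫ twistMul m G k = D ≫ f ≫ D := by
    have : (D ≫ f ≫ D) ▷ P ≫ twistMul m G k = twistMul m G k ≫ D ≫ f ≫ D := by
      rw [reassoc_of% hDr, reassoc_of% hfr, hDr]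
      simp
    rw [this, reassoc_of% hs.sep]
  rw [reassoc_of% e1, reassoc_of% hB, hB'] at hst
  rw [← hst]
  simp only [CStarCategory.dag_comp, hkd, Category.assoc] at hA ⊢
  rw [reassoc_of% hA, hA']
  simp

end
end

/-! ### The two modules and their duality -/

section
open MonoidalCategory MonObj DaggerBimod
variable {T : Type u} [Category.{v} T] [MonoidalCategory T] [RigidCStarTensorCategory T]

/-- A standard Frobenius algebra, bundled. -/
abbrev SSFA.ofFrobAlg {P : T} {m : P ⊗ P ⟶ P} {u : 𝟙_ T ⟶ P} (h : IsFrobAlg m u)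
    (hst : IsStandardCup m u) : SSFA T :=
  ofMul P m u h.one_mul h.mul_one h.mul_assoc h.frob_left h.sep hst

namespace IsRelAlg
variable {R : SSFA T} {P : DaggerBimod R R} {m : outer P P ⟶ P} {u : regular R ⟶ P}
variable (h : IsRelAlg m u) {m' : P.X ⊗ P.X ⟶ P.X} {u' : 𝟙_ T ⟶ P.X} (hs : IsFrobAlg m' u')
  (hst : IsStandardCup m' u') (hc : IsCompatible m.hom m')

/-- The algebra as a bimodule over the twisted algebra from the right. -/
abbrev rightModule : DaggerBimod R (SSFA.ofFrobAlg hs hst) where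
  X := P.X
  actLeft := P.actLeft
  one_actLeft := P.one_actLeft
  left_assoc := P.left_assoc
  actRight := m'
  actRight_one := (regular (SSFA.ofFrobAlg hs hst)).actRight_one
  right_assoc := (regular (SSFA.ofFrobAlg hs hst)).right_assoc
  middle_assoc := by
    change P.actLeft ▷ P.X ≫ m' = (α_ R.X P.X P.X).hom ≫ R.X ◁ m' ≫ P.actLeft
    rw [← h.one_left, comp_whiskerRight_assoc, hc.left, associator_naturality_left_assoc,
      ← whisker_exchange_assoc]
  left_dag := P.left_dag
  right_dag := (regular (SSFA.ofFrobAlg hs hst)).right_dag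

/-- The algebra as a bimodule over the twisted algebra from the left. -/
abbrev leftModule : DaggerBimod (SSFA.ofFrobAlg hs hst) R where
  X := P.X
  actLeft := m'
  one_actLeft := (regular (SSFA.ofFrobAlg hs hst)).one_actLeft
  left_assoc := (regular (SSFA.ofFrobAlg hs hst)).left_assoc
  actRight := P.actRight
  actRight_one := P.actRight_one
  right_assoc := P.right_assoc
  middle_assoc := by
    change m' ▷ R.X ≫ P.actRight = (α_ P.X P.X R.X).hom ≫ P.X ◁ P.actRight ≫ m'
    rw [← h.one_right, ← whisker_exchange_assoc, hc.right]
    simp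
  left_dag := (regular (SSFA.ofFrobAlg hs hst)).left_dag
  right_dag := P.right_dag

/-- The multiplication of `P` over `R` as a bimodule homomorphism over the twisted algebra. -/
@[simps hom] def mulOverBase :
    outer (h.leftModule hs hst hc) (h.rightModule hs hst hc) ⟶ regular (SSFA.ofFrobAlg hs hst) where
  hom := m.hom
  left_act_hom := by
    change ((α_ P.X P.X P.X).inv ≫ m' ▷ P.X) ≫ m.hom = P.X ◁ m.hom ≫ m'
    rw [Category.assoc, hc.right, Iso.inv_hom_id_assoc]
  right_act_hom := by
    change ((α_ P.X P.X P.X).hom ≫ P.X ◁ m') ≫ m.hom = m.hom ▷ P.X ≫ m'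
    rw [Category.assoc, hc.left]

/-- The twisted multiplication as a bimodule homomorphism over `R`. -/
@[simps hom] def mulOverTwist :
    outer (h.rightModule hs hst hc) (h.leftModule hs hst hc) ⟶ P where
  hom := m'
  left_act_hom := by
    have := (h.rightModule hs hst hc).middle_assoc
    change ((α_ R.X P.X P.X).inv ≫ P.actLeft ▷ P.X) ≫ m' = R.X ◁ m' ≫ P.actLeft
    rw [Category.assoc, this, Iso.inv_hom_id_assoc]
  right_act_hom := by
    have := (h.leftModule hs hst hc).middle_assoc
    change ((α_ P.X P.X R.X).hom ≫ P.X ◁ P.actRight) ≫ m' = m' ▷ R.X ≫ P.actRight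
    rw [Category.assoc, this]

/-- Hence the tensor product over the twisted algebra is the object `P.X` itself, identified with it
by the twisted multiplication. -/
theorem relIdem_modules :
    relIdem (h.rightModule hs hst hc) (h.leftModule hs hst hc) = m' ≫ m'† := by
  rw [relIdem_eq_left]
  exact hs.frob_left

/-- A central endomorphism of the algebra as a bimodule homomorphism over `R`. -/
theorem central_linear (h : IsRelAlg m u) {k : P.X ⟶ P.X} (hk : IsCentral m.hom k) :
    P.actLeft ≫ k = R.X ◁ k ≫ P.actLeft ∧ P.actRight ≫ k = k ▷ R.X ≫ P.actRight := by
  constructor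
  · rw [← h.one_left, Category.assoc, hk.right, ← whisker_exchange_assoc]
  · rw [← h.one_right, Category.assoc, hk.left, whisker_exchange_assoc]

theorem cup_relIdem (n : regular (SSFA.ofFrobAlg hs hst) ⟶ regular (SSFA.ofFrobAlg hs hst)) :
    (n ≫ (h.mulOverBase hs hst hc)†).hom ≫
      relIdem (h.leftModule hs hst hc) (h.rightModule hs hst hc) =
        (n ≫ (h.mulOverBase hs hst hc)†).hom := by
  have hi := congrArg CStarCategory.dag h.idem
  rw [CStarCategory.dag_comp, relIdem_dag] at hi
  change (n.hom ≫ m.hom†) ≫ relIdem P P = n.hom ≫ m.hom†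
  rw [Category.assoc, hi]

variable (n : regular (SSFA.ofFrobAlg hs hst) ⟶ regular (SSFA.ofFrobAlg hs hst)) [IsIso n]
  (hn : IsCentral m.hom n.hom)

/-- The cap of the duality between the two modules. -/
@[simps! hom] noncomputable def cap :
    outer (h.rightModule hs hst hc) (h.leftModule hs hst hc) ⟶ regular R :=
  h.mulOverTwist hs hst hc ≫
    { hom := inv n.hom
      left_act_hom := (h.central_linear hn.inv).1
      right_act_hom := (h.central_linear hn.inv).2 } ≫ u†

/-- The duality between the two modules. -/
noncomputable abbrev adjunction (hnd : n.hom† = n.hom) : Bicategory.Adjunction (B := SSFA T) (h.leftModule hs hst hc)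
    (h.rightModule hs hst hc) :=
  adjunctionOfOuter (h.rightModule hs hst hc) (h.leftModule hs hst hc)
    (n ≫ (h.mulOverBase hs hst hc)†) (h.cap hs hst hc n hn)
    (by
      rw [relIdem_modules, cap_hom]
      rw [Category.assoc, reassoc_of% hs.sep])
    (by
      have hn' : m' ≫ n.hom = n.hom ▷ P.X ≫ m' := SSFA.central_left n
      have hu : m.hom† ≫ P.X ◁ u.hom† = P.actRight† := by
        simpa using congrArg CStarCategory.dag h.one_right
      have hd : m.hom† ≫ P.X ◁ inv n.hom = inv n.hom ≫ m.hom† :=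
        (hn.inv.dag_right (by rw [dag_inv]; simp [hnd])).symm
      change (n.hom ≫ m.hom†) ▷ P.X ≫ (α_ P.X P.X P.X).hom ≫
        P.X ◁ (m' ≫ inv n.hom ≫ u.hom†) ≫ P.actRight = m'
      -- The mixed Frobenius equation straightens the wire, `n` meets its inverse, and the counit
      -- with separability of the `R`-action leaves only `m'`. The other snake equation is the
      -- mirror image.
      rw [comp_whiskerRight_assoc, whiskerLeft_comp_assoc, whiskerLeft_comp_assoc,
        reassoc_of% hc.frob_right, ← reassoc_of% hn', reassoc_of% hd, IsIso.hom_inv_id_assoc,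
        reassoc_of% hu, P.right_sep, Category.comp_id])
    (by
      have hn' : m' ≫ n.hom = P.X ◁ n.hom ≫ m' := SSFA.central_right n
      have hu : m.hom† ≫ u.hom† ▷ P.X = P.actLeft† := by
        simpa using congrArg CStarCategory.dag h.one_left
      have hd : m.hom† ≫ inv n.hom ▷ P.X = inv n.hom ≫ m.hom† :=
        (hn.inv.dag_left (by rw [dag_inv]; simp [hnd])).symm
      change P.X ◁ (n.hom ≫ m.hom†) ≫ (α_ P.X P.X P.X).inv ≫
        (m' ≫ inv n.hom ≫ u.hom†) ▷ P.X ≫ P.actLeft = m'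
      rw [whiskerLeft_comp_assoc, comp_whiskerRight_assoc, comp_whiskerRight_assoc,
        reassoc_of% hc.frob_left, ← reassoc_of% hn', reassoc_of% hd, IsIso.hom_inv_id_assoc,
        reassoc_of% hu, P.left_sep, Category.comp_id])

end IsRelAlg
end

/-! ### Standardness of the duality -/

section
open MonoidalCategory MonObj DaggerBimod
variable {T : Type u} [Category.{v} T] [MonoidalCategory T] [RigidCStarTensorCategory T]

section
variable {A B : SSFA T} {X : DaggerBimod A B} {Y : DaggerBimod B A}
  {c : regular B ⟶ outer Y X} {e : outer X Y ⟶ regular A}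

/-- The cup and the cap absorb the idempotents of the relative tensor products, so both loops can be
computed for the outer actions. -/
theorem isStandardDual_adjunctionOfOuter (he h₁ h₂) (hc : c.hom ≫ relIdem Y X = c.hom)
    (hst : ∀ f : X ⟶ X, endTrace (regular B) (c ≫ outerWhiskerLeft Y f ≫ c†) =
      endTrace (regular A) (e† ≫ outerWhiskerRight f Y ≫ e)) :
    IsStandardDual (B := SSFA T) (adjunctionOfOuter X Y c e he h₁ h₂) := by
  intro f
  have e1 : (c ≫ projHom Y X) ≫ relWhiskerLeft Y f ≫ (c ≫ projHom Y X)† =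
      c ≫ outerWhiskerLeft Y f ≫ c† := by
    have hc' := congrArg CStarCategory.dag hc
    rw [CStarCategory.dag_comp, relIdem_dag] at hc'
    apply hom_ext
    simp only [comp_hom, dag_hom, CStarCategory.dag_comp, projHom_hom, CStarCategory.dag_dag,
      outerWhiskerLeft_hom, Category.assoc]
    rw [proj_relWhiskerLeft_assoc, proj_incl_assoc, hc']
  have e2 : (inclHom X Y ≫ e)† ≫ relWhiskerRight f Y ≫ inclHom X Y ≫ e =
      e† ≫ outerWhiskerRight f Y ≫ e := by
    apply hom_ext
    simp only [comp_hom, dag_hom, CStarCategory.dag_comp, inclHom_hom,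
      outerWhiskerRight_hom, Category.assoc]
    rw [proj_relWhiskerRight_assoc, proj_incl_assoc, he]
  have := hst f
  rw [← e1, ← e2] at this
  exact this

theorem leftDim_adjunctionOfOuter (he h₁ h₂) (hc : c.hom ≫ relIdem Y X = c.hom) :
    leftDim (B := SSFA T) (adjunctionOfOuter X Y c e he h₁ h₂) = c ≫ c† := by
  change (c ≫ projHom Y X) ≫ (c ≫ projHom Y X)† = c ≫ c†
  apply hom_ext
  simp only [comp_hom, dag_hom, CStarCategory.dag_comp, projHom_hom, CStarCategory.dag_dag,
    Category.assoc]
  rw [proj_incl_assoc, ← Category.assoc, hc]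

end

section
variable {C : Type u} [Category.{v} C] [MonoidalCategory C] [CStarTensorCategory C]

/-- The inverse of a unitary homomorphism of algebras to a Frobenius algebra is a
`*`-homomorphism. -/
theorem isStarHom_of_unitary (A : SSFA C) {B : C} {mB : B ⊗ B ⟶ B} {uB : 𝟙_ C ⟶ B} {φ : B ⟶ A.X}
    (hφ : IsUnitary φ) (hm : mB ≫ φ = (φ ⊗ₘ φ) ≫ μ[A.X]) (hu : uB ≫ φ = η[A.X]) :
    IsStarHom μ[A.X] η[A.X] mB uB φ† := by
  have h1 : φ† ≫ φ = 𝟙 _ := hφ.2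
  have h2 : φ ≫ φ† = 𝟙 _ := hφ.1
  have hmul : μ[A.X] ≫ φ† = (φ† ⊗ₘ φ†) ≫ mB := by
    have : mB = (φ ⊗ₘ φ) ≫ μ[A.X] ≫ φ† := by
      rw [← reassoc_of% hm, h2, Category.comp_id]
    rw [this, MonoidalCategory.tensorHom_comp_tensorHom_assoc, h1, MonoidalCategory.id_tensorHom_id,
      Category.id_comp]
  have hone : η[A.X] ≫ φ† = uB := by rw [← hu, Category.assoc, h2, Category.comp_id]
  refine ⟨hmul, hone, ?_⟩
  -- An isomorphism of algebras that is unitary carries one cap to the other. The formula for the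
  -- dagger is then the snake equation of `A`.
  have hc : A.X ◁ φ† ≫ φ† ▷ B ≫ mB ≫ uB† = μ[A.X] ≫ η[A.X]† := by
    rw [← MonoidalCategory.tensorHom_def'_assoc, ← reassoc_of% hmul, ← hone,
      CStarCategory.dag_comp, reassoc_of% CStarCategory.dag_dag,
      reassoc_of% h1]
  have hA := A.cup_right
  have : φ† ≫ (λ_ B).inv ≫ (η[A.X] ≫ μ[A.X]†) ▷ B ≫ (α_ A.X A.X B).hom ≫ A.X ◁ φ† ▷ B ≫
      A.X ◁ (mB ≫ uB†) ≫ (ρ_ A.X).hom = 𝟙 _ := by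
    calc _ = (λ_ A.X).inv ≫ frobCup A.X ▷ A.X ≫ (α_ _ _ _).hom ≫
          A.X ◁ (A.X ◁ φ† ≫ φ† ▷ B ≫ mB ≫ uB†) ≫ (ρ_ A.X).hom := by
          rw [leftUnitor_inv_naturality_assoc, whisker_exchange_assoc]
          simp [frobCup]
      _ = 𝟙 _ := by
          rw [hc, whiskerLeft_comp_assoc, reassoc_of% hA, A.counit_right, Category.comp_id,
            Iso.inv_hom_id]
  rw [CStarCategory.dag_dag]
  have h3 := congrArg (fun t => φ ≫ t) this
  simp only [reassoc_of% h2, Category.comp_id] at h3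
  exact h3.symm

end

namespace IsRelAlg
variable {R : SSFA T} {P : DaggerBimod R R} {m : outer P P ⟶ P} {u : regular R ⟶ P}

/-- The weight `n⁴` rewrites the trace over the twisted algebra as a trace in `T` with the factors
`n` inverted; `trace_twist` turns this into a trace on the unit of `R` with two factors `G'⁻¹` on
each side. Moved to `regular R`, these are `g⁻⁴`, which the weight `g⁴` cancels exactly, leaving the
trace of the other loop. -/
theorem isStandardDual (h : IsRelAlg m u) {g : regular R ⟶ regular R} [IsIso g] (hg : g† = g)
    (hw : ∀ z : regular R ⟶ regular R, endTrace (𝟙_ T) (η[R.X] ≫ z.hom ≫ η[R.X]†) =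
        endTrace (regular R) (g ≫ g ≫ g ≫ g ≫ z))
    {k : P.X ⟶ P.X} [IsIso k] (hkd : k† = k) (hk : IsCentral m.hom k)
    (hs : IsFrobAlg (twistMul m.hom (rightMul P g).hom k) (twistOne (one u) (rightMul P g).hom k))
    (hst : IsStandardCup (twistMul m.hom (rightMul P g).hom k)
      (twistOne (one u) (rightMul P g).hom k))
    (hc : IsCompatible m.hom (twistMul m.hom (rightMul P g).hom k))
    (n : regular (SSFA.ofFrobAlg hs hst) ⟶ regular (SSFA.ofFrobAlg hs hst)) [IsIso n]
    (hn : IsCentral m.hom n.hom) (hnd : n.hom† = n.hom)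
    (hwn : ∀ z : regular (SSFA.ofFrobAlg hs hst) ⟶ regular (SSFA.ofFrobAlg hs hst),
      endTrace (𝟙_ T) ((twistOne (one u) (rightMul P g).hom k ≫ k ≫ k) ≫ z.hom ≫
        (twistOne (one u) (rightMul P g).hom k ≫ k ≫ k)†) =
        endTrace (regular (SSFA.ofFrobAlg hs hst)) (n ≫ n ≫ n ≫ n ≫ z)) :
    IsStandardDual (B := SSFA T) (h.adjunction hs hst hc n hn hnd) := by
  apply isStandardDual_adjunctionOfOuter
  · exact h.cup_relIdem hs hst hc n
  · intro f
    have hp := h.isMulPair g hg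
    have hfr : twistMul m.hom (rightMul P g).hom k ≫ f.hom =
      f.hom ▷ P.X ≫ twistMul m.hom (rightMul P g).hom k := f.right_act_hom
    have key := trace_twist h.isFrobAlg hp hk hkd hs hst hn hnd f.hom hfr
    let w : regular (SSFA.ofFrobAlg hs hst) ⟶ regular (SSFA.ofFrobAlg hs hst) :=
      (h.mulOverBase hs hst hc)† ≫ outerWhiskerLeft (h.leftModule hs hst hc) f ≫
        h.mulOverBase hs hst hc
    let z := (h.cap hs hst hc n hn)† ≫ outerWhiskerRight f (h.leftModule hs hst hc) ≫
      h.cap hs hst hc n hn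
    have hz : z.hom = u.hom ≫ inv n.hom ≫ f.hom ≫ inv n.hom ≫ u.hom† := by
      have hnd' : (inv n.hom)† = inv n.hom := by rw [dag_inv]; simp [hnd]
      change (twistMul m.hom (rightMul P g).hom k ≫ inv n.hom ≫ u.hom†)† ≫ f.hom ▷ P.X ≫
        twistMul m.hom (rightMul P g).hom k ≫ inv n.hom ≫ u.hom† = _
      rw [← reassoc_of% hfr]
      simp only [CStarCategory.dag_comp, CStarCategory.dag_dag, hnd', Category.assoc]
      rw [reassoc_of% hs.sep]
    have h1 : n ≫ n ≫ n ≫ n ≫ inv n ≫ w ≫ inv n = n ≫ w ≫ n := by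
      rw [IsIso.hom_inv_id_assoc, SSFA.regular_comm _ w, IsIso.hom_inv_id_assoc,
        SSFA.regular_comm _ w]
    have h2 : g ≫ g ≫ g ≫ g ≫ inv g ≫ inv g ≫ z ≫ inv g ≫ inv g = z := by
      rw [SSFA.regular_comm _ z]
      simp
    have e1 := hwn (inv n ≫ w ≫ inv n)
    have e2 := hw (inv g ≫ inv g ≫ z ≫ inv g ≫ inv g)
    rw [h1] at e1
    rw [h2] at e2
    have hu : inv g ≫ u = u ≫ inv (leftMul P g) := by
      have := leftMul_natural g u
      rw [leftMul_regular] at this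
      rw [IsIso.inv_comp_eq, ← Category.assoc, IsIso.eq_comp_inv, this]
    have hud : u† ≫ inv g = inv (leftMul P g) ≫ u† := by
      have := congrArg CStarCategory.dag hu
      simpa [dag_inv, hg, leftMul_dag] using this
    have hu := congrArg Bimod.Hom.hom hu
    have hud := congrArg Bimod.Hom.hom hud
    simp only [comp_hom, inv_hom, dag_hom] at hu hud
    have e3 : endTrace (𝟙_ T) (η[R.X] ≫ (inv g ≫ inv g ≫ z ≫ inv g ≫ inv g).hom ≫ η[R.X]†) =
        endTrace (𝟙_ T) (one u ≫ inv (leftMul P g).hom ≫ inv (leftMul P g).hom ≫ inv n.hom ≫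
          f.hom ≫ inv n.hom ≫ inv (leftMul P g).hom ≫ inv (leftMul P g).hom ≫ (one u)†) := by
      simp only [comp_hom, hz, inv_hom, CStarCategory.dag_comp, Category.assoc]
      rw [reassoc_of% hu, reassoc_of% hu, reassoc_of% hud, reassoc_of% hud]
    have hnd' : n† = n := hom_ext hnd
    rw [CStarCategory.dag_comp, CStarCategory.dag_dag, hnd']
    refine Eq.trans ?_ (e1.symm.trans (Eq.trans ?_ (key.trans (e3.symm.trans e2))))
    · simp [w]
    · simp [w, inv_hom]

end IsRelAlg
end

/-! ### Identification with the pair of pants algebra -/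

section
open MonoidalCategory MonObj DaggerBimod
variable {T : Type u} [Category.{v} T] [MonoidalCategory T] [RigidCStarTensorCategory T]

theorem DaggerBimod.leftUnitor_conj {A B : SSFA T} (M : DaggerBimod A B)
    (z : regular A ⟶ regular A) :
    (relLeftUnitor M).inv ≫ relWhiskerRight z M ≫ relLeftUnitorHom M = leftMul M z := by
  refine hom_ext (leftMul_unique ?_).symm
  have h := congrArg Bimod.Hom.hom (relLeftUnitor M).hom_inv_id
  rw [comp_hom, id_hom, relLeftUnitor_hom] at h
  conv_lhs => rw [← proj_leftUnitor]
  rw [comp_hom, comp_hom, Category.assoc, reassoc_of% h, proj_relWhiskerRight_assoc,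
    proj_leftUnitor]

namespace IsRelAlg
variable {R : SSFA T} {P : DaggerBimod R R} {m : outer P P ⟶ P} {u : regular R ⟶ P}
variable (h : IsRelAlg m u) {m' : P.X ⊗ P.X ⟶ P.X} {u' : 𝟙_ T ⟶ P.X} (hs : IsFrobAlg m' u')
  (hst : IsStandardCup m' u') (hc : IsCompatible m.hom m')

/-- The twisted multiplication as a homomorphism from the relative tensor product. -/
noncomputable abbrev ofPants :
    relTensor (h.rightModule hs hst hc) (h.leftModule hs hst hc) ⟶ P :=
  inclHom _ _ ≫ h.mulOverTwist hs hst hc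

theorem isUnitary_ofPants : IsUnitary (h.ofPants hs hst hc) :=
  isUnitary_of_outer _ (h.relIdem_modules hs hst hc).symm hs.sep

theorem proj_ofPants :
    relProj (h.rightModule hs hst hc) (h.leftModule hs hst hc) ≫ (h.ofPants hs hst hc).hom = m' := by
  rw [comp_hom, inclHom_hom, proj_incl_assoc, relIdem_modules, mulOverTwist_hom, Category.assoc,
    hs.sep, Category.comp_id]

variable (n : regular (SSFA.ofFrobAlg hs hst) ⟶ regular (SSFA.ofFrobAlg hs hst)) [IsIso n]
  (hn : IsCentral m.hom n.hom) (hnd : n.hom† = n.hom)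

theorem proj_unit_dag :
    relProj (h.leftModule hs hst hc) (h.rightModule hs hst hc) ≫
      (Bimod.Hom.hom (h.adjunction hs hst hc n hn hnd).unit†) = m.hom ≫ n.hom := by
  change relProj _ _ ≫ ((n.hom ≫ m.hom†) ≫ relProj _ _)† = _
  rw [CStarCategory.dag_comp, CStarCategory.dag_dag, proj_incl_assoc]
  simp only [CStarCategory.dag_comp, CStarCategory.dag_dag, hnd]
  exact (reassoc_of% h.idem) n.hom

/-- The adjoint of the cup is `m` followed by `n`, and the normalization `n⁻¹` of the pair of pants
cancels this factor. What remains has the form `x m' ((y m z) m' w)`, which mixed associativity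
turns into `(x m' y) m (z m' w)`. -/
theorem pantsMul_ofPants :
    relProj (h.rightModule hs hst hc) (h.leftModule hs hst hc) ▷ (P.X ⊗ P.X) ≫
      (relTensor (h.rightModule hs hst hc) (h.leftModule hs hst hc)).X ◁
        relProj (h.rightModule hs hst hc) (h.leftModule hs hst hc) ≫
      relProj (relTensor (h.rightModule hs hst hc) (h.leftModule hs hst hc))
        (relTensor (h.rightModule hs hst hc) (h.leftModule hs hst hc)) ≫
      (Bimod.Hom.hom (pantsMul (B := SSFA T) (h.adjunction hs hst hc n hn hnd) (inv n))) ≫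
        (h.ofPants hs hst hc).hom =
      (m' ⊗ₘ m') ≫ m.hom := by
  have e1 : (Bimod.Hom.hom (pantsMul (B := SSFA T) (h.adjunction hs hst hc n hn hnd) (inv n))) =
      (relAssocHom (h.rightModule hs hst hc) (h.leftModule hs hst hc)
        (relTensor (h.rightModule hs hst hc) (h.leftModule hs hst hc))).hom ≫
      (relWhiskerLeft (h.rightModule hs hst hc)
        ((relAssocHom (h.leftModule hs hst hc) (h.rightModule hs hst hc)
          (h.leftModule hs hst hc))† ≫
          relWhiskerRight ((h.adjunction hs hst hc n hn hnd).unit† ≫ inv n) (h.leftModule hs hst hc) ≫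
          relLeftUnitorHom (h.leftModule hs hst hc))).hom := rfl
  have e2 : P.X ◁ relProj (h.rightModule hs hst hc) (h.leftModule hs hst hc) ≫
      relProj (h.leftModule hs hst hc)
        (relTensor (h.rightModule hs hst hc) (h.leftModule hs hst hc)) ≫
      (Bimod.Hom.hom ((relAssocHom (h.leftModule hs hst hc) (h.rightModule hs hst hc)
          (h.leftModule hs hst hc))† ≫
          relWhiskerRight ((h.adjunction hs hst hc n hn hnd).unit† ≫ inv n) (h.leftModule hs hst hc) ≫
          relLeftUnitorHom (h.leftModule hs hst hc))) =
      (α_ P.X P.X P.X).inv ≫ m.hom ▷ P.X ≫ m' := by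
    have e3 : relProj (h.leftModule hs hst hc) (h.rightModule hs hst hc) ≫
        (Bimod.Hom.hom (h.adjunction hs hst hc n hn hnd).unit†) ≫ (inv n).hom = m.hom := by
      rw [← Category.assoc, proj_unit_dag, inv_hom, Category.assoc, IsIso.hom_inv_id,
        Category.comp_id]
    rw [comp_hom, dag_hom]
    refine (proj_assoc_dag_assoc (h.leftModule hs hst hc) (h.rightModule hs hst hc)
      (h.leftModule hs hst hc) _).trans ?_
    rw [comp_hom, proj_relWhiskerRight_assoc, proj_leftUnitor, ← comp_whiskerRight_assoc, comp_hom,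
      e3]
  rw [e1, Category.assoc, ← whisker_exchange_assoc, proj_assoc_assoc, proj_relWhiskerLeft_assoc,
    proj_ofPants, associator_naturality_right_assoc, ← whiskerLeft_comp_assoc,
    ← whiskerLeft_comp_assoc, Category.assoc, e2, hc.left, Iso.inv_hom_id_assoc, whiskerLeft_comp,
    Category.assoc, ← associator_naturality_right_assoc, ← hc.right,
    MonoidalCategory.tensorHom_def', Category.assoc]

/-- The inverse of `n` in the cap cancels the normalization `n` of the unit, and separability of
`m'` removes the loop. -/
theorem pantsUnit_ofPants :
    Bimod.Hom.hom (pantsUnit (B := SSFA T) (h.adjunction hs hst hc n hn hnd) n) ≫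
      (h.ofPants hs hst hc).hom = u.hom := by
  have hnd' : (inv n.hom)† = inv n.hom := by rw [dag_inv]; simp [hnd]
  have e1 : Bimod.Hom.hom (pantsUnit (B := SSFA T) (h.adjunction hs hst hc n hn hnd) n) =
      (relIncl (h.rightModule hs hst hc) (h.leftModule hs hst hc) ≫
        (m' ≫ inv n.hom ≫ u.hom†))† ≫
      (relWhiskerLeft (h.rightModule hs hst hc) ((relLeftUnitor (h.leftModule hs hst hc)).inv ≫
        relWhiskerRight n (h.leftModule hs hst hc) ≫
          relLeftUnitorHom (h.leftModule hs hst hc))).hom := by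
    rw [← inclHom_hom]
    rfl
  have h2 : m' ≫ n.hom = P.X ◁ n.hom ≫ m' := SSFA.central_right n
  have h3 : (leftMul (h.leftModule hs hst hc) n).hom = n.hom :=
    leftMul_unique (SSFA.central_left n)
  rw [e1, CStarCategory.dag_comp, Category.assoc, Category.assoc, proj_relWhiskerLeft_assoc,
    proj_ofPants, leftUnitor_conj, h3, ← h2]
  simp only [CStarCategory.dag_comp, CStarCategory.dag_dag, hnd', Category.assoc]
  rw [reassoc_of% hs.sep, IsIso.inv_hom_id, Category.comp_id]

end IsRelAlg
end

/-! ### Every algebra splits; the theorem -/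

section
open MonoidalCategory MonObj DaggerBimod
variable {T : Type u} [Category.{v} T] [MonoidalCategory T] [RigidCStarTensorCategory T]

theorem isUnitary_dag {C : Type u} [Category.{v} C] [CStarCategory C] {X Y : C} {f : X ⟶ Y}
    (h : IsUnitary f) : IsUnitary f† := by
  have h1 : f ≫ f† = 𝟙 X := h.1
  have h2 : f† ≫ f = 𝟙 Y := h.2
  exact ⟨by rw [CStarCategory.dag_dag, h2], by rw [CStarCategory.dag_dag, h1]⟩

theorem SSFA.splits {R : SSFA T} (S : SSFA (R ⟶ R)) : S.Splits := by
  have h := isRelAlg S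
  obtain ⟨g, -, hg, _, hw⟩ := R.exists_weight η[R.X] R.eq_zero_of_one_comp
  have hp := h.isMulPair g hg
  have := finiteDimensional_end (relBimod S).X
  obtain ⟨k, _, hkd, hk, hks⟩ := exists_normalization h.isFrobAlg hp
  have hs := isFrobAlg_twist h.isFrobAlg hp hk hkd hks
  have hst := h.isStandardCup_twist hg hw hkd
  have hc := isCompatible_twist h.isFrobAlg hp hk hkd
  -- The vector `u' ≫ k ≫ k`, with `u'` the unit of the twist, is the one for which `trace_twist`
  -- matches the two traces. It is faithful on the center because `k` is invertible and commutes
  -- with central endomorphisms.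
  obtain ⟨n, hnp, hnd, _, hwn⟩ := (SSFA.ofFrobAlg hs hst).exists_weight
    (twistOne (IsRelAlg.one (outerOne S)) (rightMul (relBimod S) g).hom k ≫ k ≫ k)
    (by
      intro p h0
      have hp' := comm_of_linear hs.mul_one (hk.twist h.isFrobAlg hp hk).right
        (SSFA.central_left p)
      apply SSFA.eq_zero_of_one_comp
      let q : (relBimod S).X ⟶ (relBimod S).X := p.hom
      have hq : q ≫ k ≫ k = k ≫ k ≫ q := by
        change k ≫ q = q ≫ k at hp'
        rw [hp', reassoc_of% hp']
      change twistOne (IsRelAlg.one (outerOne S)) (rightMul (relBimod S) g).hom k ≫ q = 0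
      rw [← cancel_mono k, ← cancel_mono k, Limits.zero_comp, Limits.zero_comp, Category.assoc,
        Category.assoc, hq]
      simpa using h0)
  have hnd : n.hom† = n.hom := congrArg Bimod.Hom.hom hnd
  have hn : IsCentral (outerMul S).hom n.hom := IsCentral.of_twist hs h.isFrobAlg hp hk
    ⟨SSFA.central_left n, SSFA.central_right n⟩
  -- The cup is `n` followed by the isometry `m†`, so the positive `n` is the required square root
  -- of the left dimension.
  have hdim : n ≫ n = leftDim (B := SSFA T) (h.adjunction hs hst hc n hn hnd) := by
    refine Eq.trans ?_ (leftDim_adjunctionOfOuter _ _ _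
      (h.cup_relIdem hs hst hc n)).symm
    apply hom_ext
    change n.hom ≫ n.hom = (n.hom ≫ (outerMul S).hom†) ≫ (n.hom ≫ (outerMul S).hom†)†
    rw [CStarCategory.dag_comp, CStarCategory.dag_dag, Category.assoc, reassoc_of% h.sep, hnd]
  have hu := h.isUnitary_ofPants hs hst hc
  refine ⟨SSFA.ofFrobAlg hs hst, h.rightModule hs hst hc, h.leftModule hs hst hc,
    h.adjunction hs hst hc n hn hnd, n, inv n,
    h.isStandardDual hg hw hkd hk hs hst hc n hn hnd hwn, ?_, hnp, hdim, IsIso.hom_inv_id n,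
    IsIso.inv_hom_id n, (h.ofPants hs hst hc)†, isUnitary_dag hu, ?_⟩
  · rw [← hdim]
    infer_instance
  · refine isStarHom_of_unitary (C := (R ⟶ R)) S hu ?_
      (hom_ext (h.pantsUnit_ofPants hs hst hc n hn hnd))
    apply hom_ext
    -- Multiplicativity is tested on the fourfold tensor power of `P.X` in `T`, where all relative
    -- tensor products are unfolded.
    rw [← cancel_epi (relProj (relTensor (h.rightModule hs hst hc) (h.leftModule hs hst hc))
        (relTensor (h.rightModule hs hst hc) (h.leftModule hs hst hc))),
      ← cancel_epi ((relTensor (h.rightModule hs hst hc) (h.leftModule hs hst hc)).X ◁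
        relProj (h.rightModule hs hst hc) (h.leftModule hs hst hc)),
      ← cancel_epi (relProj (h.rightModule hs hst hc) (h.leftModule hs hst hc) ▷
        ((relBimod S).X ⊗ (relBimod S).X))]
    refine (h.pantsMul_ofPants hs hst hc n hn hnd).trans (Eq.symm ?_)
    have e := h.proj_ofPants hs hst hc
    change relProj _ _ ▷ _ ≫ _ ◁ relProj _ _ ≫ relProj _ _ ≫
      ((relWhiskerRight (h.ofPants hs hst hc) _).hom ≫
      (relWhiskerLeft (relBimod S) (h.ofPants hs hst hc)).hom) ≫ (relMul S).hom = _
    rw [Category.assoc, proj_relWhiskerRight_assoc, proj_relWhiskerLeft_assoc, whisker_exchange_assoc,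
      ← comp_whiskerRight_assoc, ← whiskerLeft_comp_assoc, e, MonoidalCategory.tensorHom_def,
      Category.assoc]
    rfl

end

theorem mainTheorem6 (T : Type u) [Category.{v} T] [MonoidalCategory T]
    [RigidCStarTensorCategory T] : IsSemisimpleTwoCat (BimodTwoCat T) where
  locally_semisimple r s := DaggerBimod.isSemisimple r s
  rigid X := exists_leftAdjoint X
  exists_zero := by
    obtain ⟨Z, hZ⟩ := (RigidCStarTensorCategory.semisimple (T := T)).exists_zero
    exact ⟨SSFA.zeroAlg hZ, SSFA.isZeroObject_zeroAlg hZ⟩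
  exists_directSum := SSFA.exists_directSum
  decomposition := SSFA.exists_decomposition
  splits A := SSFA.splits A
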